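/- Let $(R,\mathfrak m)$ be a Noetherian local ring that is reduced, Nagata, and satisfies Serre's condition $(S_2)$. Here $R$ is called Nagata if for every prime ideal $P$ of $R$ and every finite field extension $L$ of the fraction field of $R/P$, the integral closure of $R/P$ in $L$ is a finitely generated $R/P$-module; and a Noetherian ring $A$ is called an $(S_2)$-ring if $\operatorname{depth} A_P \ge \min\{2, \dim A_P\}$ for every prime ideal $P$ of $A$. Let $\mathcal I=\{I_n\}_{n\in\mathbb Z}$ be a filtration of ideals of $R$, that is, $I_0=R$, $I_{n}\supseteq I_{n+1}$ for all $n\in\mathbb Z$, and $I_mI_n\subseteq I_{m+n}$ for all $m,n\in\mathbb Z$. Assume that $I_1\neq R$, that $\operatorname{ht}_R I_1\ge 2$, and that the Rees algebra $\mathcal R(\mathcal I)=\sum_{n\ge 0} I_n t^n\subseteq R[t]$ is Noetherian, where $t$ is an indeterminate over $R$. Then the integral closure of $\mathcal R(\mathcal I)$ in $R[t]$ is Noetherian and is an $(S_2)$-ring. -/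

import Mathlib

universe u

section NagataRings

/-- A commutative ring `R` is Nagata if it is Noetherian and, for every prime ideal `P` and every
finite field extension `L` of the fraction field of `R ⧸ P`, the integral closure of `R ⧸ P` in `L`
is a finitely generated `R ⧸ P`-module. -/
structure IsNagataRing (R : Type u) [CommRing R] : Prop where
  isNoetherianRing : IsNoetherianRing R
  finite_integralClosure : ∀ (P : Ideal R) [P.IsPrime] (L : Type u) [Field L]
    [Algebra (FractionRing (R ⧸ P)) L] [Algebra (R ⧸ P) L]
    [IsScalarTower (R ⧸ P) (FractionRing (R ⧸ P)) L],
    FiniteDimensional (FractionRing (R ⧸ P)) L →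
      Module.Finite (R ⧸ P) (integralClosure (R ⧸ P) L)

end NagataRings

section SerreCondition

/-- The depth of a local ring: the supremum of the lengths of the regular sequences
contained in the maximal ideal. -/
noncomputable def localRingDepth (A : Type*) [CommRing A] [IsLocalRing A] : ℕ∞ :=
  ⨆ rs : {rs : List A // (∀ r ∈ rs, r ∈ IsLocalRing.maximalIdeal A) ∧
    RingTheory.Sequence.IsRegular A rs}, (rs.1.length : ℕ∞)

/-- `A` is an `(S_k)`-ring: it is Noetherian and `depth A_P ≥ min {k, dim A_P}` for every prime
ideal `P`. -/
structure IsSerreRing (k : ℕ) (A : Type*) [CommRing A] : Prop where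
  isNoetherianRing : IsNoetherianRing A
  min_le_depth : ∀ (P : Ideal A) [P.IsPrime],
    min (k : WithBot ℕ∞) (ringKrullDim (Localization.AtPrime P)) ≤
      (localRingDepth (Localization.AtPrime P) : WithBot ℕ∞)

end SerreCondition

section Filtrations

/-- A filtration `{I_n}` of ideals of `R`, indexed by the integers. -/
structure IdealFiltration (R : Type*) [CommRing R] where
  ideal : ℤ → Ideal R
  ideal_zero : ideal 0 = ⊤
  ideal_succ_le : ∀ n : ℤ, ideal (n + 1) ≤ ideal n
  ideal_mul_le : ∀ m n : ℤ, ideal m * ideal n ≤ ideal (m + n)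

/-- The Rees algebra `∑_{n ≥ 0} I_n t ^ n ⊆ R[t]` of a filtration: the polynomials whose
coefficient of `t ^ n` lies in `I_n` for every `n`. -/
def IdealFiltration.reesAlgebra {R : Type*} [CommRing R] (I : IdealFiltration R) :
    Subalgebra R (Polynomial R) where
  carrier := {f | ∀ n : ℕ, f.coeff n ∈ I.ideal (n : ℤ)}
  mul_mem' := by
    intro f g hf hg n
    rw [Polynomial.coeff_mul]
    refine Ideal.sum_mem _ fun x hx => ?_
    have h := I.ideal_mul_le (x.1 : ℤ) (x.2 : ℤ) (Ideal.mul_mem_mul (hf x.1) (hg x.2))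
    rwa [← Nat.cast_add, Finset.HasAntidiagonal.mem_antidiagonal.mp hx] at h
  add_mem' := by
    intro f g hf hg n
    rw [Polynomial.coeff_add]
    exact Ideal.add_mem _ (hf n) (hg n)
  algebraMap_mem' := by
    intro r n
    rw [Polynomial.algebraMap_apply, Polynomial.coeff_C]
    split_ifs with h
    · subst h
      simp [I.ideal_zero]
    · exact Ideal.zero_mem _

end Filtrations

/-!
Let `A` be the Rees algebra and `B` its integral closure in `R[t]`. There are two assertions: `B` is
a finite `A`-module, hence Noetherian, and `B` satisfies `(S₂)`.

*Finiteness.* A finitely generated algebra over a Nagata ring is Nagata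
(`HasFiniteIntegralClosures.of_finiteType`), and a Noetherian Rees algebra is finitely generated
over `R` (`IdealFiltration.finiteType_reesAlgebra`). As `I₁` has positive height it lies in no
minimal prime `P` of `R`, so the image of `A` in `(R ⧸ P)[t]` has the same fraction field as
`(R ⧸ P)[t]`. Since `R` is reduced, `B` embeds in the product over the finitely many `P` of the
integral closures of `A` in these fields, each of which is finite.

The theorem on finitely generated algebras reduces to polynomial rings in one variable
(`HasFiniteIntegralClosures.polynomial`), that is, to `R[x]` in a finite extension of its fraction
field, with `R` a Nagata domain. If `x` is transcendental, adjoining `p`-power roots makes the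
extension separable, where finiteness follows from the trace form
(`HasFiniteIntegralClosures.finite_integralClosure_polynomial`). If `x` is algebraic, `R` may be
replaced by its normalization in the field in question, so that `R` is normal and `S = R[x]` is a
birational extension of `R` (`finite_integralClosure_of_adjoin_singleton`). With `x = a / b`, every
element of the integral closure `C` of `S` has a power of `u = b` as a denominator, and what has to
be shown is that these powers are bounded locally at each prime of `S`. This goes by induction on
the height of the prime (`exists_isBoundedAt_of_forall_lt`). The input at the maximal ideals is that
the completions of `S` are reduced (`isReduced_tensor_of_monic`): reducedness of a flat algebra may
be tested modulo the associated primes of a nonzero element if the local rings there are discrete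
valuation rings (`isReduced_of_flat_of_associatedPrimes`). By a theorem of Chevalley type
(`exists_integralPowIdeal_le_pow`) the ideals `uᵏC ∩ S` then tend to zero in the topology of the
maximal ideal. Together with `C ⊆ S + uC` this forces `C = S` locally; the inclusion itself is
achieved by enlarging `S` to a finite extension (`IsPowerDenominator.exists_mod_bounded`).

*Serre's condition.* A reduced Noetherian ring satisfies `(S₂)` once the associated primes of its
principal ideals generated by regular elements have height at most one
(`IsSerreRing.of_height_le_one`). Let `Q = (aB : b)` be such a prime of `B`. If `b / a` lies in
`R[t]`, then it is not integral over `B`, so multiplication by it does not map `Q` into `Q`, which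
makes `Q` locally principal. Otherwise `Q` is contained in the contraction of an associated prime
`Q'` of `aR[t]`. As `R` satisfies `(S₂)`, both `Q'` and its contraction to `R` have height at most
one (`IsSerreRing.height_le_one_of_mem_associatedPrimes_polynomial`). Since `I₁` has height at least
two, `Q'` does not contain `I₁`, and away from the zero locus of `I₁` the rings `B` and `R[t]`
agree, so the contraction of `Q'` to `B` again has height at most one
(`Ideal.height_le_one_of_mem_associatedPrimes_of_isIntegrallyClosedIn`).
-/

/-! ### The Nagata property -/

/-- A Noetherian ring `R` has finite integral closures if for every field `L` that is a finite
extension of the field of fractions `k` of the image of `R`, the integral closure of `R` in `L` is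
a finite `R`-module. This is the Nagata property, with the residue field of a prime replaced by any
field `k` all of whose elements are fractions of elements of `R`. -/
def HasFiniteIntegralClosures (R : Type u) [CommRing R] : Prop :=
  IsNoetherianRing R ∧ ∀ (k L : Type u) [Field k] [Field L] [Algebra R k] [Algebra R L]
    [Algebra k L] [IsScalarTower R k L],
    (∀ z : k, ∃ a b : R, algebraMap R k b ≠ 0 ∧ z * algebraMap R k b = algebraMap R k a) →
    FiniteDimensional k L → Module.Finite R (integralClosure R L)

lemma finite_integralClosure_of_le {R L : Type*} [CommRing R] [IsNoetherianRing R] [CommRing L]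
    [Algebra R L] (N : Submodule R L) (hN : N.FG) (h : ∀ x : L, IsIntegral R x → x ∈ N) :
    Module.Finite R (integralClosure R L) := by
  have : IsNoetherian R N := isNoetherian_of_fg_of_noetherian N hN
  have hle : Subalgebra.toSubmodule (integralClosure R L) ≤ N := fun x hx => h x hx
  have : IsNoetherian R (Subalgebra.toSubmodule (integralClosure R L)) := isNoetherian_of_le hle
  exact (inferInstance : Module.Finite R (Subalgebra.toSubmodule (integralClosure R L)))

/-- Elements of the fraction field as fractions, in the form used in `HasFiniteIntegralClosures`. -/
lemma IsFractionRing.exists_mul_algebraMap_eq (R K : Type*) [CommRing R] [IsDomain R] [Field K]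
    [Algebra R K] [IsFractionRing R K] (z : K) :
    ∃ a b : R, algebraMap R K b ≠ 0 ∧ z * algebraMap R K b = algebraMap R K a := by
  obtain ⟨a, b, hb, rfl⟩ := IsFractionRing.div_surjective (A := R) z
  have hb' : algebraMap R K b ≠ 0 :=
    (map_ne_zero_iff _ (IsFractionRing.injective R K)).mpr (nonZeroDivisors.ne_zero hb)
  exact ⟨a, b, hb', div_mul_cancel₀ _ hb'⟩

lemma IsNagataRing.hasFiniteIntegralClosures {R : Type u} [CommRing R] (h : IsNagataRing R) :
    HasFiniteIntegralClosures R := by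
  refine ⟨h.isNoetherianRing, fun k L _ _ _ _ _ _ hk hfin => ?_⟩
  have := h.isNoetherianRing
  let P : Ideal R := RingHom.ker (algebraMap R k)
  have hP : P.IsPrime := RingHom.ker_isPrime _
  let _ : Algebra (R ⧸ P) k := (RingHom.kerLift (algebraMap R k)).toAlgebra
  have t1 : IsScalarTower R (R ⧸ P) k := IsScalarTower.of_algebraMap_eq fun x => rfl
  let _ : Algebra (R ⧸ P) L := ((algebraMap k L).comp (algebraMap (R ⧸ P) k)).toAlgebra
  have t2 : IsScalarTower (R ⧸ P) k L := IsScalarTower.of_algebraMap_eq fun x => rfl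
  have t3 : IsScalarTower R (R ⧸ P) L := IsScalarTower.of_algebraMap_eq fun x => by
    rw [IsScalarTower.algebraMap_apply (R ⧸ P) k L, ← IsScalarTower.algebraMap_apply R (R ⧸ P) k,
      ← IsScalarTower.algebraMap_apply R k L]
  have hinj : Function.Injective (algebraMap (R ⧸ P) k) := RingHom.kerLift_injective _
  have : FaithfulSMul (R ⧸ P) k := (faithfulSMul_iff_algebraMap_injective _ _).mpr hinj
  have : IsFractionRing (R ⧸ P) k := by
    refine IsFractionRing.of_field _ _ fun z => ?_
    obtain ⟨a, b, hb, hab⟩ := hk z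
    refine ⟨Ideal.Quotient.mk P a, Ideal.Quotient.mk P b, ?_⟩
    rw [eq_comm]
    exact (div_eq_iff hb).mpr hab.symm
  let e : FractionRing (R ⧸ P) ≃ₐ[R ⧸ P] k := FractionRing.algEquiv (R ⧸ P) k
  let _ : Algebra (FractionRing (R ⧸ P)) k := e.toRingEquiv.toRingHom.toAlgebra
  let _ : Algebra (FractionRing (R ⧸ P)) L :=
    ((algebraMap k L).comp e.toRingEquiv.toRingHom).toAlgebra
  have t4 : IsScalarTower (FractionRing (R ⧸ P)) k L := IsScalarTower.of_algebraMap_eq fun x => rfl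
  have t5 : IsScalarTower (R ⧸ P) (FractionRing (R ⧸ P)) L :=
    IsScalarTower.of_algebraMap_eq fun x => by
      change _ = algebraMap k L (e (algebraMap _ _ x))
      rw [e.commutes, ← IsScalarTower.algebraMap_apply]
  have : Module.Finite (FractionRing (R ⧸ P)) k :=
    Module.Finite.of_surjective (Algebra.linearMap (FractionRing (R ⧸ P)) k) e.surjective
  have : Module.Finite (FractionRing (R ⧸ P)) L := Module.Finite.trans k L
  have hf := h.finite_integralClosure P L this
  have : Module.Finite (R ⧸ P) (integralClosure (R ⧸ P) L) := hf
  have : Module.Finite R (integralClosure (R ⧸ P) L) := Module.Finite.trans (R ⧸ P) _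
  have hfg := (Module.Finite.range ((integralClosure (R ⧸ P) L).val.restrictScalars R).toLinearMap)
  refine finite_integralClosure_of_le _ (Module.Finite.iff_fg.mp hfg) fun x hx => ?_
  exact ⟨⟨x, hx.tower_top⟩, rfl⟩

namespace HasFiniteIntegralClosures

/-- The Nagata property passes to module-finite algebras. -/
lemma of_finite {R S : Type u} [CommRing R] [CommRing S] [Algebra R S] [Module.Finite R S]
    (h : HasFiniteIntegralClosures R) : HasFiniteIntegralClosures S := by
  have := h.1
  have hS : IsNoetherianRing S := IsNoetherianRing.of_finite R S
  refine ⟨hS, fun k L _ _ _ _ _ _ hk hfin => ?_⟩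
  let _ : Algebra R k := ((algebraMap S k).comp (algebraMap R S)).toAlgebra
  have t1 : IsScalarTower R S k := IsScalarTower.of_algebraMap_eq fun x => rfl
  let _ : Algebra R L := ((algebraMap S L).comp (algebraMap R S)).toAlgebra
  have t2 : IsScalarTower R S L := IsScalarTower.of_algebraMap_eq fun x => rfl
  have t3 : IsScalarTower R k L := IsScalarTower.of_algebraMap_eq fun x => by
    rw [IsScalarTower.algebraMap_apply R S k, ← IsScalarTower.algebraMap_apply S k L,
      ← IsScalarTower.algebraMap_apply R S L]
  -- The fractions of elements of `R` form a subfield `k₀` of `k`.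
  let k₀ : Subfield k := Subfield.closure (Set.range (algebraMap R k))
  let _ : Algebra R k₀ := ((algebraMap R k).codRestrict k₀ fun x =>
    Subfield.subset_closure ⟨x, rfl⟩).toAlgebra
  have t4 : IsScalarTower R k₀ k := IsScalarTower.of_algebraMap_eq fun x => rfl
  have t5 : IsScalarTower R k₀ L := IsScalarTower.of_algebraMap_eq fun x => by
    rw [IsScalarTower.algebraMap_apply k₀ k L, ← IsScalarTower.algebraMap_apply R k₀ k,
      ← IsScalarTower.algebraMap_apply R k L]
  have hk₀ : ∀ z : k₀, ∃ a b : R, algebraMap R k₀ b ≠ 0 ∧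
      z * algebraMap R k₀ b = algebraMap R k₀ a := by
    rintro ⟨z, hz⟩
    rw [Subfield.mem_closure_iff] at hz
    have hcl : Subring.closure (Set.range (algebraMap R k)) = (algebraMap R k).range := by
      rw [← RingHom.coe_range, Subring.closure_eq]
    rw [hcl] at hz
    obtain ⟨_, ⟨a, rfl⟩, _, ⟨b, rfl⟩, rfl⟩ := hz
    by_cases hb : algebraMap R k b = 0
    · refine ⟨0, 1, by simp, ?_⟩
      ext; simp [hb]
    · refine ⟨a, b, fun h0 => hb (congrArg Subtype.val h0), ?_⟩
      ext
      exact div_mul_cancel₀ _ hb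
  -- `k` is generated over `k₀` by the image of `S`, which is a finite-dimensional domain.
  have hfk : Module.Finite k₀ k := by
    obtain ⟨s, hs⟩ := (Module.Finite.fg_top : (⊤ : Submodule R S).FG)
    let W : Subalgebra k₀ k := Algebra.adjoin k₀ ((algebraMap S k) '' s)
    have hint : ∀ x ∈ (algebraMap S k) '' s, IsIntegral k₀ x := by
      rintro _ ⟨x, -, rfl⟩
      exact ((Algebra.IsIntegral.isIntegral (R := R) x).map
        (IsScalarTower.toAlgHom R S k)).tower_top
    have hWfg : (Subalgebra.toSubmodule W).FG := fg_adjoin_of_finite (s.finite_toSet.image _) hint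
    have hSW : ∀ x : S, algebraMap S k x ∈ W := by
      intro x
      have hx : x ∈ Submodule.span R (s : Set S) := hs ▸ Submodule.mem_top
      induction hx using Submodule.span_induction with
      | mem x hx => exact Algebra.subset_adjoin ⟨x, hx, rfl⟩
      | zero => simp
      | add x y _ _ hx hy => rw [map_add]; exact add_mem hx hy
      | smul r x _ hx =>
        rw [Algebra.smul_def, map_mul, ← IsScalarTower.algebraMap_apply R S k,
          IsScalarTower.algebraMap_apply R k₀ k]
        exact mul_mem (algebraMap_mem _ _) hx
    have hWi : Algebra.IsIntegral k₀ W :=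
      Algebra.IsIntegral.adjoin hint
    have htop : W = ⊤ := by
      refine eq_top_iff.mpr fun z _ => ?_
      obtain ⟨a, b, hb, hab⟩ := hk z
      have : z = algebraMap S k a * (algebraMap S k b)⁻¹ := by
        rw [← hab, mul_assoc, mul_inv_cancel₀ hb, mul_one]
      rw [this]
      exact mul_mem (hSW a) (Algebra.IsIntegral.inv_mem (hSW b))
    rw [htop] at hWfg
    exact ⟨hWfg⟩
  have : Module.Finite k₀ L := Module.Finite.trans k L
  have hR := h.2 k₀ L hk₀ this
  obtain ⟨s, hs⟩ := (Module.Finite.iff_fg (N := Subalgebra.toSubmodule (integralClosure R L))).mp hR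
  refine finite_integralClosure_of_le (Submodule.span S s) ⟨s, rfl⟩ fun x hx => ?_
  have hx' : IsIntegral R x := isIntegral_trans x hx
  have : x ∈ Submodule.span R (s : Set L) := hs ▸ hx'
  exact Submodule.span_le_restrictScalars R S _ this

lemma of_surjective {R S : Type u} [CommRing R] [CommRing S] (f : R →+* S)
    (hf : Function.Surjective f) (h : HasFiniteIntegralClosures R) :
    HasFiniteIntegralClosures S := by
  let _ := f.toAlgebra
  have : Module.Finite R S := Module.Finite.of_surjective (Algebra.linearMap R S) hf
  exact h.of_finite

lemma of_isLocalization {R S : Type u} [CommRing R] [CommRing S] [Algebra R S] (M : Submonoid R)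
    [IsLocalization M S] (h : HasFiniteIntegralClosures R) : HasFiniteIntegralClosures S := by
  have := h.1
  have hS : IsNoetherianRing S := IsLocalization.isNoetherianRing M S h.1
  refine ⟨hS, fun k L _ _ _ _ _ _ hk hfin => ?_⟩
  let _ : Algebra R k := ((algebraMap S k).comp (algebraMap R S)).toAlgebra
  have t1 : IsScalarTower R S k := IsScalarTower.of_algebraMap_eq fun x => rfl
  let _ : Algebra R L := ((algebraMap S L).comp (algebraMap R S)).toAlgebra
  have t2 : IsScalarTower R S L := IsScalarTower.of_algebraMap_eq fun x => rfl
  have t3 : IsScalarTower R k L := IsScalarTower.of_algebraMap_eq fun x => by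
    rw [IsScalarTower.algebraMap_apply R S k, ← IsScalarTower.algebraMap_apply S k L,
      ← IsScalarTower.algebraMap_apply R S L]
  have hR := h.2 k L (fun z => ?_) hfin
  · obtain ⟨s, hs⟩ :=
      (Module.Finite.iff_fg (N := Subalgebra.toSubmodule (integralClosure R L))).mp hR
    refine finite_integralClosure_of_le (Submodule.span S s) ⟨s, rfl⟩ fun x hx => ?_
    obtain ⟨m, hm⟩ := IsIntegral.exists_multiple_integral_of_isLocalization M x hx
    have hmem : m • x ∈ Submodule.span R (s : Set L) := hs ▸ hm
    have hmem' : m • x ∈ Submodule.span S (s : Set L) :=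
      Submodule.span_le_restrictScalars R S _ hmem
    obtain ⟨v, hv⟩ := (IsLocalization.map_units S m).exists_left_inv
    have : x = v • (m • x) := by
      rw [Submonoid.smul_def, ← algebraMap_smul S (m : R) x, smul_smul, hv, one_smul]
    rw [this]
    exact Submodule.smul_mem _ _ hmem'
  · obtain ⟨a, b, hb, hab⟩ := hk z
    obtain ⟨⟨a', m⟩, hm⟩ := IsLocalization.surj M a
    obtain ⟨⟨b', n⟩, hn⟩ := IsLocalization.surj M b
    have hu : ∀ m : M, algebraMap S k (algebraMap R S m) ≠ 0 := fun m =>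
      ((IsLocalization.map_units S m).map (algebraMap S k)).ne_zero
    refine ⟨a' * n, b' * m, ?_, ?_⟩
    · change algebraMap S k (algebraMap R S (b' * m)) ≠ 0
      rw [map_mul, ← hn, map_mul, map_mul]
      exact mul_ne_zero (mul_ne_zero hb (hu _)) (hu _)
    · change z * algebraMap S k (algebraMap R S (b' * m)) = algebraMap S k (algebraMap R S (a' * n))
      simp only [map_mul, ← hn, ← hm, ← hab]
      ring

end HasFiniteIntegralClosures

/-! ### Associated primes and prime avoidance -/

/-- Over a Noetherian ring, the associated primes of `A ⧸ J` are the primes of the form `(J : z)`.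
-/
lemma mem_associatedPrimes_quotient_iff {A : Type*} [CommRing A] [IsNoetherianRing A]
    {J p : Ideal A} :
    p ∈ associatedPrimes A (A ⧸ J) ↔ p.IsPrime ∧ ∃ z, ∀ r, r ∈ p ↔ r * z ∈ J := by
  rw [AssociatedPrimes.mem_iff, isAssociatedPrime_iff]
  refine and_congr_right fun _ => ⟨?_, ?_⟩
  · rintro ⟨x, hx⟩
    obtain ⟨z, rfl⟩ := Ideal.Quotient.mk_surjective x
    refine ⟨z, fun r => ?_⟩
    rw [hx, Submodule.mem_colon_singleton, ← Ideal.Quotient.eq_zero_iff_mem, map_mul]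
    rfl
  · rintro ⟨z, hz⟩
    refine ⟨Ideal.Quotient.mk J z, ?_⟩
    ext r
    rw [hz, Submodule.mem_colon_singleton, ← Ideal.Quotient.eq_zero_iff_mem, map_mul]
    rfl

lemma associatedPrimes_quotient_le {A : Type*} [CommRing A] [IsNoetherianRing A]
    {J p : Ideal A} (hp : p ∈ associatedPrimes A (A ⧸ J)) : J ≤ p := by
  obtain ⟨-, z, hz⟩ := mem_associatedPrimes_quotient_iff.mp hp
  exact fun r hr => (hz r).mpr (J.mul_mem_right _ hr)

/-- By prime avoidance, an ideal contained in no associated prime of `A ⧸ J` contains an element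
that is regular modulo `J`. -/
lemma exists_mem_regular_of_not_le {A : Type*} [CommRing A] [IsNoetherianRing A]
    {J I : Ideal A} (h : ∀ p ∈ associatedPrimes A (A ⧸ J), ¬ I ≤ p) :
    ∃ s ∈ I, ∀ b, s * b ∈ J → b ∈ J := by
  have hfin : (associatedPrimes A (A ⧸ J)).Finite := associatedPrimes.finite A (A ⧸ J)
  have hnot : ¬ ((I : Set A) ⊆ ⋃ p ∈ hfin.toFinset, (p : Set A)) := by
    intro hsub
    obtain ⟨p, hp, hle⟩ := (Ideal.subset_union_prime (f := fun p : Ideal A => p) ⊤ ⊤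
      fun p hp _ _ => (hfin.mem_toFinset.mp hp).isPrime).mp (by simpa using hsub)
    exact h p (hfin.mem_toFinset.mp hp) hle
  obtain ⟨s, hsI, hs⟩ := Set.not_subset.mp hnot
  refine ⟨s, hsI, fun b hb => ?_⟩
  by_contra hbJ
  apply hs
  have hz : s ∈ {r : A | ∃ x : A ⧸ J, x ≠ 0 ∧ r • x = 0} := by
    refine ⟨Ideal.Quotient.mk J b, by rwa [Ne, Ideal.Quotient.eq_zero_iff_mem], ?_⟩
    exact Ideal.Quotient.eq_zero_iff_mem.mpr hb
  rw [← biUnion_associatedPrimes_eq_zero_divisors] at hz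
  simpa using hz

/-! ### Reducedness of flat algebras -/

/-- A nonzerodivisor modulo `y` stays a nonzerodivisor modulo `y` in a flat algebra. -/
lemma Module.Flat.exists_mul_of_mul_eq {A E : Type*} [CommRing A] [CommRing E] [Algebra A E]
    [Module.Flat A E] {s y : A} (h : ∀ b, s * b ∈ Ideal.span {y} → b ∈ Ideal.span {y})
    {z w : E} (hzw : algebraMap A E s * z = algebraMap A E y * w) :
    ∃ w', z = algebraMap A E y * w' := by
  have hrel : ∑ i, (![s, -y] : Fin 2 → A) i • (![z, w] : Fin 2 → E) i = 0 := by
    simp [Fin.sum_univ_two, Algebra.smul_def, hzw]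
  obtain ⟨k, a, x, hx, ha⟩ := Module.Flat.isTrivialRelation_of_sum_smul_eq_zero (R := A) (M := E)
    (f := ![s, -y]) (x := ![z, w]) hrel
  have h1 : ∀ j, ∃ b, a 0 j = y * b := fun j => by
    have := ha j
    simp only [Fin.sum_univ_two, Matrix.cons_val_zero, Matrix.cons_val_one] at this
    obtain ⟨b, hb⟩ := Ideal.mem_span_singleton'.mp (h (a 0 j) (Ideal.mem_span_singleton'.mpr
      ⟨a 1 j, by linear_combination -this⟩))
    exact ⟨b, by rw [← hb, mul_comm]⟩
  choose b hb using h1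
  refine ⟨∑ j, b j • x j, ?_⟩
  have := hx 0
  simp only [Matrix.cons_val_zero] at this
  rw [this, Finset.mul_sum]
  refine Finset.sum_congr rfl fun j _ => ?_
  rw [hb, Algebra.smul_def, Algebra.smul_def, map_mul, mul_assoc]

lemma Module.Flat.eq_zero_of_algebraMap_mul {A E : Type*} [CommRing A] [IsDomain A] [CommRing E]
    [Algebra A E] [Module.Flat A E] {s : A} (hs : s ≠ 0) {z : E}
    (hz : algebraMap A E s * z = 0) : z = 0 := by
  obtain ⟨w, rfl⟩ := Module.Flat.exists_mul_of_mul_eq (y := (0 : A)) (s := s) (z := z) (w := 0)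
    (fun b hb => by simpa [hs] using hb) (by simpa using hz)
  simp

/-- Reducedness of a flat algebra `E` over a domain `A` follows from reducedness modulo the
associated primes of a nonzero `y`, provided the local rings at these primes are discrete valuation
rings and `E` is `y`-adically separated: a nilpotent `z` vanishes modulo each such prime, hence is
divisible there by every power of a uniformizer, hence `y` divides `z`, and the quotient is
nilpotent again. -/
lemma isReduced_of_flat_of_associatedPrimes {A E : Type*} [CommRing A] [IsDomain A]
    [IsNoetherianRing A] [CommRing E] [Algebra A E] [Module.Flat A E] {y : A} (hy : y ≠ 0)
    (hsep : ∀ z : E, (∀ n, algebraMap A E y ^ n ∣ z) → z = 0)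
    (h : ∀ p ∈ associatedPrimes A (A ⧸ Ideal.span {y}),
      (∃ π ∈ p, ∃ t ∉ p, ∀ f ∈ p, ∃ a, t * f = π * a) ∧
        ∀ z : E, IsNilpotent z → z ∈ p.map (algebraMap A E)) :
    IsReduced E := by
  have key : ∀ z : E, IsNilpotent z → ∃ w, IsNilpotent w ∧ z = algebraMap A E y * w := by
    intro z hz
    let I : Ideal A := ((Ideal.span {algebraMap A E y}).restrictScalars A).comap
      (LinearMap.toSpanSingleton A E z)
    have hI : ∀ s, s ∈ I ↔ algebraMap A E y ∣ algebraMap A E s * z := fun s => by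
      rw [← Ideal.mem_span_singleton, ← Algebra.smul_def]
      rfl
    suffices ∃ s ∈ I, ∀ b, s * b ∈ Ideal.span {y} → b ∈ Ideal.span {y} by
      obtain ⟨s, hsI, hs⟩ := this
      obtain ⟨w, hw⟩ := (hI s).mp hsI
      obtain ⟨w', rfl⟩ := Module.Flat.exists_mul_of_mul_eq hs hw
      refine ⟨w', ?_, rfl⟩
      obtain ⟨n, hn⟩ := hz
      refine ⟨n, Module.Flat.eq_zero_of_algebraMap_mul (pow_ne_zero n hy) ?_⟩
      rw [map_pow, ← mul_pow, hn]
    refine exists_mem_regular_of_not_le fun p hp hle => ?_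
    obtain ⟨⟨π, hπ, t, ht, hπt⟩, hnil⟩ := h p hp
    have hpp : p.IsPrime := hp.isPrime
    have hyp : y ∈ p := associatedPrimes_quotient_le hp (Ideal.mem_span_singleton_self y)
    have hπ0 : π ≠ 0 := by
      rintro rfl
      obtain ⟨a, ha⟩ := hπt y hyp
      rw [zero_mul] at ha
      exact (mul_eq_zero.mp ha).elim (fun h => ht (h ▸ p.zero_mem)) hy
    -- modulo `p` every nilpotent vanishes, so that `t` times it is divisible by `π`
    have step : ∀ z : E, IsNilpotent z →
        ∃ w, IsNilpotent w ∧ algebraMap A E t * z = algebraMap A E π * w := by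
      intro z hz
      have hle : p.map (algebraMap A E) ≤ Submodule.comap
          (LinearMap.mulLeft E (algebraMap A E t)) (Ideal.span {algebraMap A E π}) := by
        rw [Ideal.map_le_iff_le_comap]
        intro f hf
        obtain ⟨a, ha⟩ := hπt f hf
        refine Ideal.mem_span_singleton'.mpr ⟨algebraMap A E a, ?_⟩
        rw [LinearMap.mulLeft_apply, ← map_mul, ← map_mul, ha, mul_comm]
      obtain ⟨w, hw⟩ := Ideal.mem_span_singleton'.mp (hle (hnil z hz))
      rw [LinearMap.mulLeft_apply] at hw
      refine ⟨w, ?_, by rw [← hw, mul_comm]⟩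
      obtain ⟨n, hn⟩ := hz
      refine ⟨n, Module.Flat.eq_zero_of_algebraMap_mul (pow_ne_zero n hπ0) ?_⟩
      rw [map_pow, ← mul_pow, mul_comm, hw, mul_pow, hn, mul_zero]
    have steps : ∀ n, ∃ w, IsNilpotent w ∧
        algebraMap A E (t ^ n) * z = algebraMap A E (π ^ n) * w := by
      intro n
      induction n with
      | zero => exact ⟨z, hz, by simp⟩
      | succ n ih =>
        obtain ⟨w, hw, hzw⟩ := ih
        obtain ⟨w', hw', hww'⟩ := step w hw
        refine ⟨w', hw', ?_⟩
        rw [map_pow, map_pow] at hzw ⊢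
        linear_combination algebraMap A E t * hzw + algebraMap A E π ^ n * hww'
    -- the order of `y` at `p` is finite
    have hord : ∃ n, ∃ b ∉ p, t ^ n * y = π ^ n * b := by
      by_contra! hcon
      have hall : ∀ n, ∃ b ∈ p, t ^ n * y = π ^ n * b := by
        intro n
        induction n with
        | zero => exact ⟨y, hyp, by simp⟩
        | succ n ih =>
          obtain ⟨b, hb, hyb⟩ := ih
          obtain ⟨a, ha⟩ := hπt b hb
          have : t ^ (n + 1) * y = π ^ (n + 1) * a := by
            linear_combination t * hyb + π ^ n * ha
          refine ⟨a, ?_, this⟩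
          by_contra hap
          exact hcon (n + 1) a hap this
      let Ap := Localization.AtPrime p
      have hmem : algebraMap A Ap y ∈ ⨅ n, IsLocalRing.maximalIdeal Ap ^ n := by
        refine Ideal.mem_iInf.mpr fun n => ?_
        obtain ⟨b, -, hyb⟩ := hall n
        have hu : IsUnit (algebraMap A Ap (t ^ n)) :=
          IsLocalization.map_units Ap (⟨t ^ n, fun h => ht (hpp.mem_of_pow_mem n h)⟩ :
            p.primeCompl)
        rw [← Ideal.unit_mul_mem_iff_mem _ hu, ← map_mul, hyb, map_mul, map_pow]
        refine Ideal.mul_mem_right _ _ (Ideal.pow_mem_pow ?_ n)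
        exact (IsLocalization.AtPrime.to_map_mem_maximal_iff Ap p π).mpr hπ
      rw [Ideal.iInf_pow_eq_bot_of_isLocalRing _ (IsLocalRing.maximalIdeal.isMaximal Ap).ne_top,
        Ideal.mem_bot] at hmem
      refine hy (IsLocalization.injective Ap p.primeCompl_le_nonZeroDivisors ?_)
      rw [hmem, map_zero]
    obtain ⟨n, b, hb, hyb⟩ := hord
    obtain ⟨w, -, hw⟩ := steps n
    have hmem : b * t ^ n ∈ I := by
      refine (hI _).mpr ⟨algebraMap A E (t ^ n) * w, ?_⟩
      rw [map_mul, mul_assoc, hw, ← mul_assoc, ← mul_assoc, ← map_mul, ← map_mul, mul_comm b, ← hyb,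
        mul_comm y]
    exact (hpp.mem_or_mem (hle hmem)).elim hb fun h => ht (hpp.mem_of_pow_mem n h)
  constructor
  intro z hz
  refine hsep z fun n => ?_
  have : ∀ n, ∃ w, IsNilpotent w ∧ z = algebraMap A E y ^ n * w := by
    intro n
    induction n with
    | zero => exact ⟨z, hz, by simp⟩
    | succ n ih =>
      obtain ⟨w, hw, rfl⟩ := ih
      obtain ⟨w', hw', rfl⟩ := key w hw
      exact ⟨w', hw', by ring⟩
  obtain ⟨w, -, rfl⟩ := this n
  exact dvd_mul_right _ _

/-- If `R` is integrally closed, a prime of the form `{r | r w ∈ R}` with `w ∉ R` is locally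
principal: `w` is not integral, so it does not map `p` into `p`, and any `π ∈ p` with `π w ∉ p`
generates `p` locally. -/
lemma IsIntegrallyClosed.exists_uniformizer {R K : Type*} [CommRing R] [IsNoetherianRing R]
    [IsDomain R] [IsIntegrallyClosed R] [Field K] [Algebra R K] [IsFractionRing R K] {w : K}
    {p : Ideal R} (hp : p ≠ ⊤) (hp0 : p ≠ ⊥)
    (h : ∀ r, r ∈ p ↔ ∃ a, algebraMap R K a = algebraMap R K r * w) :
    ∃ π ∈ p, ∃ t ∉ p, ∀ f ∈ p, ∃ a, t * f = π * a := by
  by_cases hcase : ∀ r ∈ p, ∃ a ∈ p, algebraMap R K a = algebraMap R K r * w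
  · exfalso
    have hint : IsIntegral R w := by
      let N : Submodule R K := Submodule.map (Algebra.linearMap R K) p
      refine isIntegral_of_smul_mem_submodule (N := N) ?_ ?_ w ?_
      · intro h0
        apply hp0
        exact Submodule.map_injective_of_injective (f := Algebra.linearMap R K)
          (IsFractionRing.injective R K) (h0.trans (Submodule.map_bot _).symm)
      · exact (IsNoetherian.noetherian p).map _
      · rintro _ ⟨r, hr, rfl⟩
        obtain ⟨a, ha, hra⟩ := hcase r hr
        exact ⟨a, ha, by simp [hra, mul_comm]⟩
    obtain ⟨b, rfl⟩ := IsIntegrallyClosed.isIntegral_iff.mp hint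
    exact hp ((Ideal.eq_top_iff_one p).mpr ((h 1).mpr ⟨b, by simp⟩))
  · push Not at hcase
    obtain ⟨π, hπ, hπ'⟩ := hcase
    obtain ⟨t, ht⟩ := (h π).mp hπ
    refine ⟨π, hπ, t, fun htp => hπ' t htp ht, fun f hf => ?_⟩
    obtain ⟨a, ha⟩ := (h f).mp hf
    refine ⟨a, IsFractionRing.injective R K ?_⟩
    rw [map_mul, map_mul, ht, ha]
    ring

/-! ### Completions of finite Nagata domains are reduced -/

section
open TensorProduct

namespace AdicCompletion

variable {T : Type u} [CommRing T] [IsNoetherianRing T] (I : Ideal T)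

/-- The tensor product of a finite module with the completed ring is the completion. -/
noncomputable def tensorEquiv (M : Type u) [AddCommGroup M] [Module T M] [Module.Finite T M] :
    M ⊗[T] AdicCompletion I T ≃ₗ[T] AdicCompletion I M :=
  (TensorProduct.comm T M (AdicCompletion I T)).trans
    ((ofTensorProductEquivOfFiniteNoetherian I M).restrictScalars T)

variable {M N : Type u} [AddCommGroup M] [Module T M] [Module.Finite T M]
  [AddCommGroup N] [Module T N] [Module.Finite T N]

lemma tensorEquiv_tmul (m : M) (f : AdicCompletion I T) :
    tensorEquiv I M (m ⊗ₜ f) = f • of I M m := by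
  simp [tensorEquiv]

lemma tensorEquiv_rTensor (g : M →ₗ[T] N) (x : M ⊗[T] AdicCompletion I T) :
    tensorEquiv I N (g.rTensor _ x) = map I g (tensorEquiv I M x) := by
  induction x with
  | zero => simp
  | add x y hx hy => simp [hx, hy]
  | tmul m f =>
    rw [LinearMap.rTensor_tmul, tensorEquiv_tmul, tensorEquiv_tmul, map_smul, map_of]

/-- The tensor product of a finite algebra with the completed ring is separated. -/
lemma algebraMap_tensor_separated {C : Type u} [CommRing C] [Algebra T C] [Module.Finite T C]
    {y : T} (hy : y ∈ I) (z : C ⊗[T] AdicCompletion I T)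
    (hz : ∀ n, algebraMap T (C ⊗[T] AdicCompletion I T) y ^ n ∣ z) : z = 0 := by
  rw [← (tensorEquiv I C).map_eq_zero_iff]
  ext n
  obtain ⟨w, rfl⟩ := hz n
  rw [← map_pow, ← Algebra.smul_def, LinearEquiv.map_smul]
  change eval I C n (y ^ n • tensorEquiv I C w) = 0
  rw [map_smul]
  obtain ⟨c, hc⟩ := Submodule.Quotient.mk_surjective _ (eval I C n (tensorEquiv I C w))
  rw [← hc, ← Submodule.Quotient.mk_smul, Submodule.Quotient.mk_eq_zero]
  exact Submodule.smul_mem_smul (Ideal.pow_mem_pow hy n) trivial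

/-- If `I` acts as zero on `C`, then `C` is its own completion. -/
lemma isReduced_tensor_of_ideal_le_ker {C : Type u} [CommRing C] [IsReduced C] [Algebra T C]
    [Module.Finite T C] (h : ∀ t ∈ I, algebraMap T C t = 0) :
    IsReduced (C ⊗[T] AdicCompletion I T) := by
  have hsurj : ∀ z : C ⊗[T] AdicCompletion I T, ∃ c : C, z = c ⊗ₜ 1 := by
    intro z
    induction z with
    | zero => exact ⟨0, by simp⟩
    | add x y hx hy =>
      obtain ⟨a, rfl⟩ := hx
      obtain ⟨b, rfl⟩ := hy
      exact ⟨a + b, by rw [add_tmul]⟩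
    | tmul c f =>
      obtain ⟨t, ht⟩ := Ideal.Quotient.mk_surjective (evalOneₐ I f)
      have hf : f - algebraMap T _ t ∈ RingHom.ker (evalOneₐ I).toRingHom := by
        rw [RingHom.mem_ker]
        change evalOneₐ I (f - algebraMap T _ t) = 0
        rw [map_sub, AlgHom.commutes, ← ht]
        exact sub_self _
      rw [ker_evalOneₐ_eq_map I (IsNoetherian.noetherian I)] at hf
      have hzero : ∀ g ∈ I.map (algebraMap T (AdicCompletion I T)),
          c ⊗ₜ[T] g = (0 : C ⊗[T] AdicCompletion I T) := by
        intro g hg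
        refine Submodule.span_induction (p := fun g _ => c ⊗ₜ[T] g = 0) ?_ (by simp)
          (fun x y _ _ hx hy => by rw [tmul_add, hx, hy, add_zero]) ?_ hg
        · rintro _ ⟨t, ht, rfl⟩
          rw [Algebra.algebraMap_eq_smul_one, tmul_smul, smul_tmul', Algebra.smul_def, h t ht,
            zero_mul, zero_tmul]
        · intro a x _ hx
          have := congrArg (fun w => (1 ⊗ₜ[T] a : C ⊗[T] AdicCompletion I T) * w) hx
          simpa using this
      refine ⟨t • c, ?_⟩
      rw [← sub_add_cancel f (algebraMap T _ t), tmul_add, hzero _ hf, zero_add,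
        Algebra.algebraMap_eq_smul_one, tmul_smul, smul_tmul']
  have hinj : ∀ c : C, c ⊗ₜ[T] (1 : AdicCompletion I T) = 0 → c = 0 := by
    intro c hc
    have h0 := congrArg (tensorEquiv I C) hc
    rw [tensorEquiv_tmul, one_smul, LinearEquiv.map_zero] at h0
    have h1 : eval I C 1 (of I C c) = 0 := by rw [h0, _root_.map_zero]
    rw [eval_of, Submodule.mkQ_apply, Submodule.Quotient.mk_eq_zero, pow_one] at h1
    have hbot : (I • ⊤ : Submodule T C) = ⊥ := by
      rw [eq_bot_iff, Submodule.smul_le]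
      intro t ht x _
      rw [Algebra.smul_def, h t ht, zero_mul]
      exact zero_mem _
    rwa [hbot] at h1
  constructor
  rintro z ⟨n, hn⟩
  obtain ⟨c, rfl⟩ := hsurj z
  rw [Algebra.TensorProduct.tmul_pow, one_pow] at hn
  rw [IsReduced.eq_zero c ⟨n, hinj _ hn⟩, zero_tmul]

end AdicCompletion

lemma mem_map_of_isNilpotent_of_isReduced_quotient {T D F : Type*} [CommRing T] [CommRing D]
    [Algebra T D] [CommRing F] [Algebra T F] (p : Ideal D) [IsReduced ((D ⧸ p) ⊗[T] F)]
    {z : D ⊗[T] F} (hz : IsNilpotent z) : z ∈ p.map (algebraMap D (D ⊗[T] F)) := by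
  have hk := Algebra.TensorProduct.rTensor_ker (R := T) (S := D)
    (C := F) (Ideal.Quotient.mkₐ D p) Ideal.Quotient.mk_surjective
  have hmem : z ∈ RingHom.ker (Algebra.TensorProduct.map (Ideal.Quotient.mkₐ D p)
      (AlgHom.id T F)) := by
    rw [RingHom.mem_ker]
    exact IsReduced.eq_zero _ (hz.map _)
  rw [hk] at hmem
  have hkk : RingHom.ker (Ideal.Quotient.mkₐ D p) = p := Ideal.Quotient.mkₐ_ker D p
  rw [hkk] at hmem
  exact hmem

/-- Completions of module-finite Nagata domains are reduced. By Noetherian induction on the kernel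
of `T → C`: after passing to the normalization, a nonzero element of the ideal has only
height one associated primes, where the local rings are discrete valuation rings. -/
theorem HasFiniteIntegralClosures.isReduced_tensor_adicCompletion {T : Type u} [CommRing T]
    [IsNoetherianRing T] (I : Ideal T) (C : Type u) [CommRing C] [IsDomain C] [Algebra T C]
    [Module.Finite T C] (hC : HasFiniteIntegralClosures C) :
    IsReduced (C ⊗[T] AdicCompletion I T) := by
  have main : ∀ P : Ideal T, ∀ (C : Type u) [CommRing C] [IsDomain C] [Algebra T C]
    [Module.Finite T C], RingHom.ker (algebraMap T C) = P → HasFiniteIntegralClosures C →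
    IsReduced (C ⊗[T] AdicCompletion I T) := by
    intro P
    induction P using WellFoundedGT.induction with
    | ind P ih =>
    intro C _ _ _ _ hP hC
    by_cases hI : ∀ t ∈ I, algebraMap T C t = 0
    · exact AdicCompletion.isReduced_tensor_of_ideal_le_ker I hI
    push Not at hI
    obtain ⟨y, hyI, hy⟩ := hI
    -- It suffices to treat the normalization `D` of `C`, since the completion is flat.
    let K := FractionRing C
    let D := integralClosure C K
    have hDC : Module.Finite C D :=
      hC.2 K K (IsFractionRing.exists_mul_algebraMap_eq C K) inferInstance
    have hD : HasFiniteIntegralClosures D := hC.of_finite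
    have hDN := hD.1
    have hDT : Module.Finite T D := Module.Finite.trans C D
    have hDic : IsIntegrallyClosed D := integralClosure.isIntegrallyClosedOfFiniteExtension K
    have hDfr : IsFractionRing D K := integralClosure.isFractionRing_of_finite_extension K K
    have hCD : Function.Injective (algebraMap C D) := FaithfulSMul.algebraMap_injective _ _
    have hker : RingHom.ker (algebraMap T D) = P := by
      rw [IsScalarTower.algebraMap_eq T C D, RingHom.ker_comp_of_injective _ hCD, hP]
    have hyD : algebraMap T D y ≠ 0 := by
      rw [IsScalarTower.algebraMap_apply T C D]
      exact fun h => hy (hCD (h.trans (map_zero _).symm))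
    have hred : IsReduced (D ⊗[T] AdicCompletion I T) := by
      refine isReduced_of_flat_of_associatedPrimes (A := D)
        (E := D ⊗[T] AdicCompletion I T) hyD (fun z hz => ?_) fun p hp => ?_
      · refine AdicCompletion.algebraMap_tensor_separated I hyI z fun n => ?_
        rw [IsScalarTower.algebraMap_apply T D]
        exact hz n
      · have hpp : p.IsPrime := hp.isPrime
        have hyp : algebraMap T D y ∈ p :=
          associatedPrimes_quotient_le hp (Ideal.mem_span_singleton_self _)
        constructor
        · obtain ⟨-, z, hz⟩ := mem_associatedPrimes_quotient_iff.mp hp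
          have hyK : algebraMap D K (algebraMap T D y) ≠ 0 :=
            fun h => hyD (IsFractionRing.injective D K (h.trans (map_zero _).symm))
          refine IsIntegrallyClosed.exists_uniformizer (K := K)
            (w := algebraMap D K z / algebraMap D K (algebraMap T D y)) hpp.ne_top
            (fun h => hyD (by simpa [h] using hyp)) fun r => ?_
          rw [hz, Ideal.mem_span_singleton']
          refine exists_congr fun a => ?_
          rw [← mul_div_assoc, eq_div_iff hyK, ← map_mul, ← map_mul,
            (IsFractionRing.injective D K).eq_iff]
        · intro z hz
          have hlt : P < RingHom.ker (algebraMap T (D ⧸ p)) := by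
            rw [← hker]
            refine lt_of_le_of_ne (fun t ht => ?_) fun h => ?_
            · rw [RingHom.mem_ker] at ht ⊢
              rw [IsScalarTower.algebraMap_apply T D, ht, map_zero]
            · have : y ∈ RingHom.ker (algebraMap T (D ⧸ p)) := by
                rw [RingHom.mem_ker, IsScalarTower.algebraMap_apply T D]
                exact Ideal.Quotient.eq_zero_iff_mem.mpr hyp
              rw [← h, RingHom.mem_ker] at this
              exact hyD this
          have hfin : Module.Finite T (D ⧸ p) := Module.Finite.trans D _
          have hq : HasFiniteIntegralClosures (D ⧸ p) :=
            hD.of_surjective (Ideal.Quotient.mk p) Ideal.Quotient.mk_surjective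
          have hr := ih _ hlt (D ⧸ p) rfl hq
          exact mem_map_of_isNilpotent_of_isReduced_quotient p hz
    have hinj : Function.Injective (Algebra.TensorProduct.map (IsScalarTower.toAlgHom T C D)
        (AlgHom.id T (AdicCompletion I T))) :=
      Module.Flat.rTensor_preserves_injective_linearMap (M := AdicCompletion I T)
        (IsScalarTower.toAlgHom T C D).toLinearMap hCD
    exact isReduced_of_injective _ hinj
  exact main _ C rfl hC

end

/-! ### Completions of Noetherian rings are Noetherian -/

/-- The completion is a quotient of a power series ring in finitely many variables, the variables
mapping to generators of the ideal. -/
theorem AdicCompletion.isNoetherianRing {T : Type*} [CommRing T] [IsNoetherianRing T]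
    (I : Ideal T) : IsNoetherianRing (AdicCompletion I T) := by
  obtain ⟨s, hs⟩ := IsNoetherian.noetherian I
  let P := MvPolynomial s T
  let J : Ideal P := MvPolynomial.idealOfVars s T
  let g : P →+* T := (MvPolynomial.aeval fun i : s => (i : T)).toRingHom
  have hgC : ∀ t, g (MvPolynomial.C t) = t := fun t => MvPolynomial.aeval_C _ t
  have hgX : ∀ i, g (MvPolynomial.X i) = i := fun i => MvPolynomial.aeval_X _ i
  have hJI : J.map g = I := by
    change (Ideal.span (Set.range MvPolynomial.X)).map g = I
    rw [← hs, Ideal.map_span, ← Set.range_comp]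
    congr 1
    ext x
    simp [hgX]
  have hJn : ∀ n, J ^ n ≤ (I ^ n).comap g := fun n => by
    rw [← Ideal.map_le_iff_le_comap, Ideal.map_pow, hJI]
  let f : (n : ℕ) → AdicCompletion J P →+* T ⧸ I ^ n := fun n =>
    (Ideal.quotientMap (I ^ n) g (hJn n)).comp (AdicCompletion.evalₐ J n).toRingHom
  have hf : ∀ {m n : ℕ} (hle : m ≤ n), (Ideal.Quotient.factorPow I hle).comp (f n) = f m := by
    intro m n hle
    ext x
    obtain ⟨c, rfl⟩ := AdicCompletion.mk_surjective J P x
    have h1 : f n (AdicCompletion.mk J P c) = Ideal.Quotient.mk _ (g (c n)) := by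
      simp only [f, RingHom.comp_apply, AlgHom.toRingHom_eq_coe, RingHom.coe_coe]
      rw [AdicCompletion.evalₐ_mk, Ideal.quotientMap_mk]
    have h2 : f m (AdicCompletion.mk J P c) = Ideal.Quotient.mk _ (g (c m)) := by
      simp only [f, RingHom.comp_apply, AlgHom.toRingHom_eq_coe, RingHom.coe_coe]
      rw [AdicCompletion.evalₐ_mk, Ideal.quotientMap_mk]
    rw [RingHom.comp_apply, h1, h2]
    change Ideal.Quotient.mk (I ^ m) (g (c n)) = _
    rw [Ideal.Quotient.mk_eq_mk_iff_sub_mem, ← map_sub]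
    have hc : c.1 m ≡ c.1 n [SMOD (J ^ m • ⊤ : Submodule P P)] := c.2 hle
    have := hJn m (by simpa [SModEq.sub_mem] using hc.symm : c.1 n - c.1 m ∈ J ^ m)
    exact this
  let φ := AdicCompletion.liftRingHom I f hf
  have hφ : φ.comp (algebraMap P (AdicCompletion J P)) =
      (algebraMap T (AdicCompletion I T)).comp g := by
    refine RingHom.ext fun x => ?_
    apply AdicCompletion.ext_evalₐ
    intro n
    rw [RingHom.comp_apply, AdicCompletion.evalₐ_liftRingHom, RingHom.comp_apply]
    simp only [RingHom.comp_apply, AlgHom.toRingHom_eq_coe, RingHom.coe_coe]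
    rw [AlgHom.commutes, AlgHom.commutes]
    rfl
  have hmap : (J.map (algebraMap P (AdicCompletion J P))).map φ =
      I.map (algebraMap T (AdicCompletion I T)) := by
    rw [Ideal.map_map, hφ, ← Ideal.map_map, hJI]
  have hJfg : J.FG := MvPolynomial.idealOfVars_fg s T
  have hIfg : I.FG := IsNoetherian.noetherian I
  have c1 : IsAdicComplete (J.map (algebraMap P (AdicCompletion J P))) (AdicCompletion J P) :=
    (IsAdicComplete.map_algebraMap_iff _ _).mpr (AdicCompletion.isAdicComplete hJfg)
  have c2 : IsAdicComplete (I.map (algebraMap T (AdicCompletion I T))) (AdicCompletion I T) :=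
    (IsAdicComplete.map_algebraMap_iff _ _).mpr (AdicCompletion.isAdicComplete hIfg)
  have c3 : IsHausdorff ((J.map (algebraMap P (AdicCompletion J P))).map φ)
    (AdicCompletion I T) := hmap ▸ c2.toIsHausdorff
  -- Surjectivity of a map of complete rings may be checked modulo the ideals.
  have hsurj : Function.Surjective φ := by
    refine surjective_of_mk_map_comp_surjective (I := J.map (algebraMap P (AdicCompletion J P)))
      φ fun y => ?_
    obtain ⟨y, rfl⟩ := Ideal.Quotient.mk_surjective y
    obtain ⟨t, ht⟩ := Ideal.Quotient.mk_surjective (AdicCompletion.evalOneₐ I y)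
    refine ⟨algebraMap P _ (MvPolynomial.C t), ?_⟩
    rw [RingHom.comp_apply, Ideal.Quotient.mk_eq_mk_iff_sub_mem, hmap]
    have : φ (algebraMap P _ (MvPolynomial.C t)) = algebraMap T _ t := by
      have := congrArg (fun h : P →+* _ => h (MvPolynomial.C t)) hφ
      simpa [hgC] using this
    rw [this, ← AdicCompletion.ker_evalOneₐ_eq_map I hIfg, RingHom.mem_ker]
    change AdicCompletion.evalOneₐ I (algebraMap T _ t - y) = 0
    rw [map_sub, AlgHom.commutes, ← ht]
    exact sub_self _
  have hN : IsNoetherianRing (MvPowerSeries s T) := inferInstance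
  have hN' : IsNoetherianRing (AdicCompletion J P) :=
    isNoetherianRing_of_ringEquiv _ (MvPowerSeries.toAdicCompletionAlgEquiv s T).toRingEquiv
  exact isNoetherianRing_of_surjective _ _ φ hsurj

/-! ### Integral closures of powers of an element -/

/-- An element `s` that is integrally divisible by an element `u` of a prime `p` lies in `p`: there
is a prime over `p` in the integral closure. -/
lemma mem_of_eq_mul_of_isIntegral {E L : Type*} [CommRing E] [Field L] [Algebra E L]
    (hinj : Function.Injective (algebraMap E L)) {p : Ideal E} [p.IsPrime] {s u : E} {g : L}
    (hg : IsIntegral E g) (hu : u ∈ p) (h : algebraMap E L s = algebraMap E L u * g) : s ∈ p := by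
  have : IsDomain E := hinj.isDomain
  let C := integralClosure E L
  have hinj' : Function.Injective (algebraMap E C) := fun a b hab =>
    hinj (congrArg (algebraMap C L) hab)
  obtain ⟨Q, hQ, hQp⟩ := Ideal.exists_ideal_over_prime_of_isIntegral_of_isDomain (S := C) p (by
    rw [(RingHom.injective_iff_ker_eq_bot _).mp hinj']; exact bot_le)
  rw [← hQp, Ideal.mem_comap]
  have : algebraMap E C s = algebraMap E C u * ⟨g, hg⟩ := Subtype.ext h
  rw [this]
  refine Q.mul_mem_right _ ?_
  rwa [← hQp, Ideal.mem_comap] at hu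

/-- If no prime inside `p` that avoids `u` contains `J`, then locally at `p` the ideal `J`
contains a power of `u`. -/
lemma exists_mul_pow_mem_of_forall_not_le {E : Type*} [CommRing E] {p J : Ideal E} [p.IsPrime]
    {u : E} (h : ∀ Q : Ideal E, Q.IsPrime → Q ≤ p → u ∉ Q → ¬ J ≤ Q) :
    ∃ s ∉ p, ∃ e : ℕ, s * u ^ e ∈ J := by
  by_contra! hcon
  obtain ⟨Q, hQ, hzQ, hdis⟩ := Ideal.exists_le_prime_disjoint J
    (p.primeCompl ⊔ Submonoid.powers u) (by
      rw [Set.disjoint_left]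
      intro x hx hx'
      obtain ⟨s, hs, _, ⟨e, rfl⟩, rfl⟩ := Submonoid.mem_sup.mp hx'
      exact hcon s hs e hx)
  rw [Set.disjoint_left] at hdis
  refine h Q hQ (fun x hx => ?_) (fun hx => hdis hx (Submonoid.mem_sup_right ⟨1, pow_one u⟩)) hzQ
  by_contra hxp
  exact hdis hx (Submonoid.mem_sup_left hxp)

/-- In a Noetherian domain no nonzero element is, locally at a prime containing `u`, integrally
divisible by all powers of `u`. At a minimal prime `q` of `u` the element `z` divides a power of
`u`, and then a multiple of `u` by an integral element lies outside `q`. -/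
lemma eq_zero_of_forall_mul_eq_pow_mul_isIntegral {E L : Type*} [CommRing E] [IsNoetherianRing E]
    [Field L] [Algebra E L] (hinj : Function.Injective (algebraMap E L)) {p : Ideal E} [p.IsPrime]
    {u z : E} (hu : u ∈ p)
    (h : ∀ k : ℕ, ∃ s ∉ p, ∃ f : L, IsIntegral E f ∧
      algebraMap E L s * algebraMap E L z = algebraMap E L u ^ k * f) :
    z = 0 := by
  have : IsDomain E := hinj.isDomain
  by_contra hz
  have hz' : algebraMap E L z ≠ 0 := fun h => hz (hinj (h.trans (map_zero _).symm))
  have hu0 : algebraMap E L u ≠ 0 := by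
    intro h0
    obtain ⟨s, hs, f, -, hf⟩ := h 1
    rw [h0, pow_one, zero_mul, mul_eq_zero, or_iff_left hz'] at hf
    exact hs (by rw [hinj (hf.trans (map_zero _).symm)]; exact zero_mem _)
  obtain ⟨q, hq, hqp⟩ := Ideal.exists_minimalPrimes_le (I := Ideal.span {u}) (J := p)
    (by rwa [Ideal.span_singleton_le_iff_mem])
  have hqq : q.IsPrime := hq.1.1
  have huq : u ∈ q := hq.1.2 (Ideal.mem_span_singleton_self u)
  have hht : q.height ≤ 1 := Ideal.height_le_one_of_isPrincipal_of_mem_minimalPrimes _ q hq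
  -- As `q` has height at most one, the only prime strictly inside it is zero.
  obtain ⟨t, ht, e, hte⟩ := exists_mul_pow_mem_of_forall_not_le (p := q) (J := Ideal.span {z})
    (u := u) fun Q hQ hQq huQ hzQ => by
      have hlt : Q < q := lt_of_le_of_ne hQq fun h => huQ (h ▸ huq)
      have hbot : (⊥ : Ideal E) < Q :=
        bot_lt_iff_ne_bot.mpr fun h => hz (by simpa [h] using hzQ (Ideal.mem_span_singleton_self z))
      have h1 : Q.height < q.height := Ideal.height_strict_mono_of_isPrime hlt
      have h2 : (⊥ : Ideal E).height < Q.height := Ideal.height_strict_mono_of_isPrime hbot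
      have h3 : Q.height < 1 := lt_of_lt_of_le h1 hht
      rw [Order.lt_one_iff.mp h3] at h2
      exact not_lt_bot h2
  obtain ⟨a, ha⟩ := Ideal.mem_span_singleton'.mp hte
  obtain ⟨s, hs, f, hf, hzf⟩ := h (e + 1)
  have hst : s * t ∈ q := by
    refine mem_of_eq_mul_of_isIntegral hinj (g := f * algebraMap E L a)
      (hf.mul isIntegral_algebraMap) huq ?_
    apply mul_right_cancel₀ (pow_ne_zero e hu0)
    have := congrArg (algebraMap E L) ha
    rw [map_mul, map_mul, map_pow] at this
    rw [map_mul, mul_assoc, ← this, mul_left_comm, hzf]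
    ring
  exact (hqq.mem_or_mem hst).elim (fun h => hs (hqp h)) ht

lemma eq_zero_of_forall_eq_pow_mul_isIntegral {E L : Type*} [CommRing E] [IsNoetherianRing E]
    [Field L] [Algebra E L] (hinj : Function.Injective (algebraMap E L)) {u z : E} (hu : ¬ IsUnit u)
    (h : ∀ k : ℕ, ∃ f : L, IsIntegral E f ∧ algebraMap E L z = algebraMap E L u ^ k * f) :
    z = 0 := by
  obtain ⟨p, hp, hup⟩ := exists_max_ideal_of_mem_nonunits hu
  refine eq_zero_of_forall_mul_eq_pow_mul_isIntegral hinj hup fun k => ?_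
  obtain ⟨f, hf, hz⟩ := h k
  exact ⟨1, p.ne_top_iff_one.mp hp.ne_top, f, hf, by rw [map_one, one_mul, hz]⟩

/-- The ideal of elements of `A` that are integrally divisible by `u ^ k`; equivalently, the
integral closure of the ideal `u ^ k A`. -/
def integralPowIdeal {A : Type*} (K : Type*) [CommRing A] [Field K] [Algebra A K] (u : A) (k : ℕ) :
    Ideal A where
  carrier := {z | ∃ f : K, IsIntegral A f ∧ algebraMap A K z = algebraMap A K u ^ k * f}
  add_mem' := by
    rintro a b ⟨f, hf, ha⟩ ⟨g, hg, hb⟩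
    exact ⟨f + g, hf.add hg, by rw [map_add, ha, hb, mul_add]⟩
  zero_mem' := ⟨0, isIntegral_zero, by simp⟩
  smul_mem' := by
    rintro c a ⟨f, hf, ha⟩
    exact ⟨algebraMap A K c * f, isIntegral_algebraMap.mul hf, by
      rw [smul_eq_mul, map_mul, ha]; ring⟩

lemma integralPowIdeal_antitone {A K : Type*} [CommRing A] [Field K] [Algebra A K] (u : A) :
    Antitone (integralPowIdeal K u) := by
  refine antitone_nat_of_succ_le fun k => ?_
  rintro z ⟨f, hf, hz⟩
  exact ⟨algebraMap A K u * f, isIntegral_algebraMap.mul hf, by rw [hz]; ring⟩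

/-- A reduced Noetherian flat algebra sees no nonzero element that is integrally divisible by all
powers of an element of its Jacobson radical. -/
lemma eq_zero_of_forall_mem_map_integralPowIdeal {A E K : Type*} [CommRing A]
    [CommRing E] [IsNoetherianRing E] [IsReduced E] [Algebra A E] [Module.Flat A E]
    [Field K] [Algebra A K] (hinj : Function.Injective (algebraMap A K)) {u : A} (hu : u ≠ 0)
    (hJ : algebraMap A E u ∈ Ideal.jacobson (⊥ : Ideal E)) {z : E}
    (hz : ∀ k, z ∈ (integralPowIdeal K u k).map (algebraMap A E)) : z = 0 := by
  have : IsDomain A := hinj.isDomain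
  by_contra hz0
  -- Since `E` is reduced, it suffices to work modulo a minimal prime `P` of `E`.
  obtain ⟨P, hP, hzP⟩ : ∃ P ∈ minimalPrimes E, z ∉ P := by
    by_contra! hcon
    apply hz0
    have : z ∈ sInf (minimalPrimes E) := Ideal.mem_sInf.mpr fun {P} hP => hcon P hP
    rw [minimalPrimes, Ideal.sInf_minimalPrimes] at this
    exact IsReduced.eq_zero z (mem_nilradical.mp this)
  have hPp : P.IsPrime := hP.1.1
  have huP : algebraMap A E u ∉ P := by
    intro h
    refine Set.disjoint_left.mp (Ideal.disjoint_nonZeroDivisors_of_mem_minimalPrimes hP) h ?_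
    rw [SetLike.mem_coe, mem_nonZeroDivisors_iff_right]
    intro w hw
    exact Module.Flat.eq_zero_of_algebraMap_mul hu (by rwa [mul_comm])
  let L := FractionRing (E ⧸ P)
  have hL : Function.Injective (algebraMap (E ⧸ P) L) := IsFractionRing.injective _ _
  let ψ : A →+* L := ((algebraMap (E ⧸ P) L).comp (Ideal.Quotient.mk P)).comp (algebraMap A E)
  have hψu : ψ u ≠ 0 := by
    intro h
    apply huP
    rw [← Ideal.Quotient.eq_zero_iff_mem]
    exact hL (h.trans (map_zero _).symm)
  have hunit : ¬ IsUnit (Ideal.Quotient.mk P (algebraMap A E u)) := by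
    intro h
    obtain ⟨M, hM, hPM⟩ := Ideal.exists_le_maximal P hPp.ne_top
    have h1 : algebraMap A E u ∈ M := by
      rw [Ideal.jacobson, Ideal.mem_sInf] at hJ
      exact hJ ⟨bot_le, hM⟩
    have h2 := h.map (Ideal.Quotient.factor hPM)
    rw [Ideal.Quotient.factor_mk, Ideal.Quotient.eq_zero_iff_mem.mpr h1] at h2
    have : Nontrivial (E ⧸ M) := Ideal.Quotient.nontrivial_iff.mpr hM.ne_top
    exact not_isUnit_zero h2
  have hzero : Ideal.Quotient.mk P z = 0 := by
    refine eq_zero_of_forall_eq_pow_mul_isIntegral hL hunit fun k => ?_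
    -- An equation of integrality of `a / u ^ k` over `A`, cleared of denominators by `scaleRoots`,
    -- is a relation in `A` and so maps to an equation of integrality over `E ⧸ P`.
    have hgen : ∀ a ∈ integralPowIdeal K u k, ∃ f : L, IsIntegral (E ⧸ P) f ∧
        ψ a = ψ u ^ k * f := by
      rintro a ⟨f, ⟨q, hq, hqf⟩, ha⟩
      refine ⟨ψ a / ψ u ^ k, ?_, (mul_div_cancel₀ _ (pow_ne_zero k hψu)).symm⟩
      have h1 : (q.scaleRoots (u ^ k)).eval a = 0 := by
        apply hinj
        rw [← Polynomial.eval₂_at_apply, ha, ← map_pow, Polynomial.scaleRoots_eval₂_mul, hqf,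
          mul_zero, map_zero]
      have h2 : Polynomial.eval₂ ψ (ψ a / ψ u ^ k) q = 0 := by
        have h3 := congrArg ψ h1
        rw [← Polynomial.eval₂_at_apply, map_zero] at h3
        have h4 : ψ a = ψ (u ^ k) * (ψ a / ψ u ^ k) := by
          rw [map_pow, mul_div_cancel₀ _ (pow_ne_zero k hψu)]
        rw [h4, Polynomial.scaleRoots_eval₂_mul] at h3
        exact (mul_eq_zero.mp h3).resolve_left
          (pow_ne_zero _ (by rw [map_pow]; exact pow_ne_zero _ hψu))
      refine ⟨q.map ((Ideal.Quotient.mk P).comp (algebraMap A E)), hq.map _, ?_⟩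
      rw [Polynomial.eval₂_map]
      exact h2
    have := hz k
    refine Submodule.span_induction (p := fun z _ => ∃ f : L, IsIntegral (E ⧸ P) f ∧
      algebraMap (E ⧸ P) L (Ideal.Quotient.mk P z) = algebraMap (E ⧸ P) L
        (Ideal.Quotient.mk P (algebraMap A E u)) ^ k * f) ?_ ?_ ?_ ?_ this
    · rintro _ ⟨a, ha, rfl⟩
      exact hgen a ha
    · exact ⟨0, isIntegral_zero, by simp⟩
    · rintro x y _ _ ⟨f, hf, hx⟩ ⟨g, hg, hy⟩
      exact ⟨f + g, hf.add hg, by rw [map_add, map_add, hx, hy, mul_add]⟩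
    · rintro c x _ ⟨f, hf, hx⟩
      refine ⟨algebraMap (E ⧸ P) L (Ideal.Quotient.mk P c) * f, isIntegral_algebraMap.mul hf, ?_⟩
      rw [smul_eq_mul, map_mul, map_mul, hx]
      ring
  exact hzP (Ideal.Quotient.eq_zero_iff_mem.mp hzero)

/-! ### A Chevalley-type comparison of topologies -/

section
open TensorProduct

lemma isArtinianRing_quotient_map_pow {S A : Type*} [CommRing S] [CommRing A] [Algebra S A]
    [Module.Finite S A] [IsNoetherianRing A] (q : Ideal S) [q.IsMaximal] (n : ℕ) :
    IsArtinianRing (A ⧸ (q.map (algebraMap S A)) ^ n) := by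
  rw [isArtinianRing_iff_krullDimLE_zero]
  set J := (q.map (algebraMap S A)) ^ n
  refine Ring.KrullDimLE.mk₀ fun P hP => ?_
  have hcomp : q ≤ (P.comap (Ideal.Quotient.mk J)).comap (algebraMap S A) := by
    intro x hx
    have hP' : (P.comap (Ideal.Quotient.mk J)).IsPrime := Ideal.comap_isPrime _ _
    rw [Ideal.mem_comap]
    refine hP'.mem_of_pow_mem n ?_
    rw [Ideal.mem_comap,
      Ideal.Quotient.eq_zero_iff_mem.mpr (Ideal.pow_mem_pow (Ideal.mem_map_of_mem _ hx) n)]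
    exact zero_mem _
  have hP' : (P.comap (Ideal.Quotient.mk J)).IsPrime := Ideal.comap_isPrime _ _
  have hmax : ((P.comap (Ideal.Quotient.mk J)).comap (algebraMap S A)).IsMaximal := by
    rwa [← Ideal.IsMaximal.eq_of_le ‹q.IsMaximal› (Ideal.IsPrime.ne_top inferInstance) hcomp]
  have h2 := Ideal.isMaximal_of_isIntegral_of_isMaximal_comap (R := S) _ hmax
  have h3 := Ideal.map_eq_top_or_isMaximal_of_surjective (Ideal.Quotient.mk J)
    Ideal.Quotient.mk_surjective h2
  rw [Ideal.map_comap_of_surjective _ Ideal.Quotient.mk_surjective] at h3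
  exact h3.resolve_left hP.ne_top

/-- In an Artinian setting, a descending chain of ideals none of which is contained in a given power
of `Q` admits a `Q`-adic Cauchy sequence that is eventually close to all ideals of the chain. -/
lemma exists_cauchy_of_not_le {A : Type*} [CommRing A] (Q : Ideal A)
    (hart : ∀ m, IsArtinianRing (A ⧸ Q ^ m)) {D : ℕ → Ideal A} (hD : Antitone D) {n : ℕ}
    (hn : ∀ k, ¬ D k ≤ Q ^ n) :
    ∃ y : ℕ → A, (∀ j, y j - y (j + 1) ∈ Q ^ j) ∧ (∀ j k, y j ∈ D k ⊔ Q ^ j) ∧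
      ∀ j, y j ∉ Q ^ n := by
  -- Modulo each power of `Q` the chain is stationary.
  have hstab : ∀ m, ∃ k0, ∀ k ≥ k0, D k0 ⊔ Q ^ m ≤ D k ⊔ Q ^ m := by
    intro m
    let f : ℕ →o (Submodule (A ⧸ Q ^ m) (A ⧸ Q ^ m))ᵒᵈ :=
      ⟨fun k => OrderDual.toDual ((D k).map (Ideal.Quotient.mk (Q ^ m))), fun a b hab =>
        OrderDual.toDual_le_toDual.mpr (Ideal.map_mono (hD hab))⟩
    obtain ⟨k0, hk0⟩ := IsArtinian.monotone_stabilizes f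
    refine ⟨k0, fun k hk => ?_⟩
    have h1 : (D k0).map (Ideal.Quotient.mk (Q ^ m)) = (D k).map (Ideal.Quotient.mk (Q ^ m)) :=
      OrderDual.toDual.injective (hk0 k hk)
    have h2 := congrArg (Ideal.comap (Ideal.Quotient.mk (Q ^ m))) h1
    rw [Ideal.comap_map_of_surjective _ Ideal.Quotient.mk_surjective,
      Ideal.comap_map_of_surjective _ Ideal.Quotient.mk_surjective, ← RingHom.ker_eq_comap_bot,
      Ideal.mk_ker] at h2
    exact h2.le
  -- So an element close to all ideals of the chain modulo `Q ^ m` can be corrected by an element of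
  -- `Q ^ m` to be so modulo `Q ^ (m + 1)`.
  have hlift : ∀ m, ∀ y, (∀ k, y ∈ D k ⊔ Q ^ m) →
      ∃ y', (∀ k, y' ∈ D k ⊔ Q ^ (m + 1)) ∧ y - y' ∈ Q ^ m := by
    intro m y hy
    obtain ⟨k0, hk0⟩ := hstab (m + 1)
    obtain ⟨a, ha, b, hb, hab⟩ := Submodule.mem_sup.mp (hy k0)
    refine ⟨a, fun k => ?_, by rw [← hab, add_sub_cancel_left]; exact hb⟩
    rcases le_total k0 k with h | h
    · exact hk0 k h (Ideal.mem_sup_left ha)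
    · exact Ideal.mem_sup_left (hD h ha)
  obtain ⟨k0, hk0⟩ := hstab n
  obtain ⟨y0, hy0, hy0n⟩ := SetLike.not_le_iff_exists.mp (hn k0)
  have hy0' : ∀ k, y0 ∈ D k ⊔ Q ^ n := by
    intro k
    rcases le_total k0 k with h | h
    · exact hk0 k h (Ideal.mem_sup_left hy0)
    · exact Ideal.mem_sup_left (hD h hy0)
  choose! g hg1 hg2 using hlift
  let y : ℕ → A := fun j => Nat.rec y0 (fun j y => g (n + j) y) j
  have hy : ∀ j k, y j ∈ D k ⊔ Q ^ (n + j) := by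
    intro j
    induction j with
    | zero => exact hy0'
    | succ j ih => exact hg1 (n + j) (y j) ih
  have hstep : ∀ j, y j - y (j + 1) ∈ Q ^ (n + j) := fun j => hg2 (n + j) (y j) (hy j)
  refine ⟨y, fun j => Ideal.pow_le_pow_right (Nat.le_add_left j n) (hstep j), fun j k =>
    (sup_le_sup_left (Ideal.pow_le_pow_right (Nat.le_add_left j n)) (D k) :) (hy j k), fun j => ?_⟩
  induction j with
  | zero => exact hy0n
  | succ j ih =>
    intro h
    apply ih
    rw [← sub_add_cancel (y j) (y (j + 1))]
    exact add_mem (Ideal.pow_le_pow_right (Nat.le_add_right n j) (hstep j)) h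

/-- If the completion of `A` at a maximal ideal `q` of `S` is reduced, then the integral closures of
the powers of an element of `q` define a topology finer than the `q`-adic one. -/
theorem exists_integralPowIdeal_le_pow {S A : Type u} [CommRing S] [IsNoetherianRing S]
    [CommRing A] [Algebra S A] [Module.Finite S A] (q : Ideal S) [q.IsMaximal]
    [IsReduced (A ⊗[S] AdicCompletion q S)] {K : Type*} [Field K] [Algebra A K]
    (hinj : Function.Injective (algebraMap A K)) {v : S} (hv : v ∈ q)
    (hu : algebraMap S A v ≠ 0) (n : ℕ) :
    ∃ k, integralPowIdeal K (algebraMap S A v) k ≤ (q.map (algebraMap S A)) ^ n := by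
  have hA : IsNoetherianRing A := IsNoetherianRing.of_finite S A
  have hF : IsNoetherianRing (AdicCompletion q S) := AdicCompletion.isNoetherianRing q
  have hE' : IsNoetherianRing (AdicCompletion q S ⊗[S] A) :=
    IsNoetherianRing.of_finite (AdicCompletion q S) _
  let e : A ⊗[S] AdicCompletion q S ≃ₐ[S] AdicCompletion q S ⊗[S] A :=
    Algebra.TensorProduct.comm S _ _
  have hE : IsNoetherianRing (A ⊗[S] AdicCompletion q S) :=
    isNoetherianRing_of_ringEquiv _ e.symm.toRingEquiv
  by_contra! hcon
  obtain ⟨y, hy1, hy2, hy3⟩ := exists_cauchy_of_not_le (q.map (algebraMap S A))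
    (isArtinianRing_quotient_map_pow q) (integralPowIdeal_antitone (K := K) (algebraMap S A v)) hcon
  have hsmul : ∀ (B : Type u) [CommRing B] [Algebra S B] (m : ℕ),
      (q ^ m • ⊤ : Submodule S B) = ((q.map (algebraMap S B)) ^ m).restrictScalars S := by
    intro B _ _ m
    rw [Ideal.smul_top_eq_map, Ideal.map_pow]
  let c : AdicCompletion.AdicCauchySequence q A := AdicCompletion.AdicCauchySequence.mk q A y
    fun m => by
      rw [SModEq.sub_mem, hsmul]
      exact hy1 m
  -- The limit `ζ` of the Cauchy sequence lies in the extensions of all `integralPowIdeal K v k`,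
  -- and hence vanishes; but the sequence stays outside the `n`-th power.
  let ζ : A ⊗[S] AdicCompletion q S :=
    (AdicCompletion.tensorEquiv q A).symm (AdicCompletion.mk q A c)
  have hζ : ζ = 0 := by
    refine eq_zero_of_forall_mem_map_integralPowIdeal hinj hu ?_ fun k => ?_
    · have h1 : ∀ M : Ideal (AdicCompletion q S ⊗[S] A), M.IsMaximal →
          algebraMap S (AdicCompletion q S ⊗[S] A) v ∈ M := by
        intro M hM
        have h2 := Ideal.isMaximal_comap_of_isIntegral_of_isMaximal
          (R := AdicCompletion q S) M
        have h3 : algebraMap S (AdicCompletion q S) v ∈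
            Ideal.jacobson (⊥ : Ideal (AdicCompletion q S)) := by
          have := AdicCompletion.isAdicComplete (M := S) (IsNoetherian.noetherian q)
          have h4 : IsAdicComplete (q.map (algebraMap S (AdicCompletion q S)))
              (AdicCompletion q S) := (IsAdicComplete.map_algebraMap_iff _ _).mpr this
          exact IsAdicComplete.le_jacobson_bot _ (Ideal.mem_map_of_mem _ hv)
        rw [IsScalarTower.algebraMap_apply S (AdicCompletion q S), ← Ideal.mem_comap]
        rw [Ideal.jacobson, Ideal.mem_sInf] at h3
        exact h3 ⟨bot_le, h2⟩
      rw [Ideal.jacobson, Ideal.mem_sInf]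
      rintro M ⟨-, hM⟩
      have h5 := h1 (M.comap e.symm.toRingEquiv.toRingHom)
        (Ideal.comap_isMaximal_of_equiv e.symm.toRingEquiv)
      have h6 : e.symm (algebraMap S _ v) ∈ M := h5
      rw [AlgEquiv.commutes] at h6
      rwa [← IsScalarTower.algebraMap_apply]
    · set D := integralPowIdeal K (algebraMap S A v) k
      have h1 := Algebra.TensorProduct.rTensor_ker (R := S) (S := S) (C := AdicCompletion q S)
        (Ideal.Quotient.mkₐ S D) (Ideal.Quotient.mkₐ_surjective S D)
      rw [show RingHom.ker (Ideal.Quotient.mkₐ S D) = D from Ideal.Quotient.mkₐ_ker S D] at h1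
      -- The completion of `A ⧸ D` is the quotient of that of `A` by the extension of `D`, so the
      -- claim is that the sequence tends to zero modulo `D`.
      change ζ ∈ D.map (Algebra.TensorProduct.includeLeft :
        A →ₐ[S] A ⊗[S] AdicCompletion q S)
      rw [← h1, RingHom.mem_ker]
      change (Ideal.Quotient.mkₐ S D).toLinearMap.rTensor (AdicCompletion q S) ζ = 0
      rw [← (AdicCompletion.tensorEquiv q (A ⧸ D)).map_eq_zero_iff,
        AdicCompletion.tensorEquiv_rTensor, LinearEquiv.apply_symm_apply]
      ext m
      change Submodule.Quotient.mk (p := (q ^ m • ⊤ : Submodule S (A ⧸ D)))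
        (Ideal.Quotient.mk D (y m)) = 0
      rw [Submodule.Quotient.mk_eq_zero, hsmul]
      obtain ⟨a, ha, b, hb, hab⟩ := Submodule.mem_sup.mp (hy2 m k)
      rw [← hab, map_add, Ideal.Quotient.eq_zero_iff_mem.mpr ha, zero_add]
      have h7 := Ideal.mem_map_of_mem (Ideal.Quotient.mk D) hb
      rw [Ideal.map_pow, Ideal.map_map] at h7
      exact h7
  have h8 : AdicCompletion.mk q A c = 0 := by
    rw [← (AdicCompletion.tensorEquiv q A).symm.map_eq_zero_iff]
    exact hζ
  have h9 : AdicCompletion.eval q A n (AdicCompletion.mk q A c) = 0 := by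
    rw [h8, _root_.map_zero]
  change Submodule.Quotient.mk (p := (q ^ n • ⊤ : Submodule S A)) (y n) = 0 at h9
  rw [Submodule.Quotient.mk_eq_zero, hsmul] at h9
  exact hy3 n h9

end

/-! ### Local conductors of the integral closure -/

/-- Elements that are locally multiplied into `Q` admit a common multiplier when they form a
finitely generated module. -/
lemma Submodule.FG.exists_smul_mem {S V : Type*} [CommRing S] [AddCommGroup V] [Module S V]
    {N Q : Submodule S V} (hN : N.FG) (M : Submonoid S) (h : ∀ x ∈ N, ∃ s ∈ M, s • x ∈ Q) :
    ∃ s ∈ M, ∀ x ∈ N, s • x ∈ Q := by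
  induction N, hN using Submodule.fg_induction with
  | singleton x =>
    obtain ⟨s, hs, hx⟩ := h x (Submodule.mem_span_singleton_self x)
    refine ⟨s, hs, fun y hy => ?_⟩
    obtain ⟨a, rfl⟩ := Submodule.mem_span_singleton.mp hy
    rw [smul_comm]
    exact Q.smul_mem a hx
  | sup N₁ N₂ _ _ h₁ h₂ =>
    obtain ⟨s, hs, hs'⟩ := h₁ fun x hx => h x (Submodule.mem_sup_left hx)
    obtain ⟨t, ht, ht'⟩ := h₂ fun x hx => h x (Submodule.mem_sup_right hx)
    refine ⟨s * t, M.mul_mem hs ht, fun x hx => ?_⟩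
    obtain ⟨y, hy, z, hz, rfl⟩ := Submodule.mem_sup.mp hx
    rw [smul_add]
    refine Q.add_mem ?_ ?_
    · rw [mul_comm, mul_smul]
      exact Q.smul_mem t (hs' y hy)
    · rw [mul_smul]
      exact Q.smul_mem s (ht' z hz)

/-- The saturation of `J` with respect to the submonoid `M`. -/
def Ideal.saturation {S : Type*} [CommRing S] (J : Ideal S) (M : Submonoid S) : Ideal S where
  carrier := {b | ∃ v ∈ M, v * b ∈ J}
  add_mem' := by
    rintro a b ⟨v, hv, ha⟩ ⟨w, hw, hb⟩
    refine ⟨v * w, M.mul_mem hv hw, ?_⟩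
    rw [show v * w * (a + b) = w * (v * a) + v * (w * b) by ring]
    exact J.add_mem (J.mul_mem_left _ ha) (J.mul_mem_left _ hb)
  zero_mem' := ⟨1, M.one_mem, by simp⟩
  smul_mem' := by
    rintro c a ⟨v, hv, ha⟩
    refine ⟨v, hv, ?_⟩
    rw [smul_eq_mul, mul_left_comm]
    exact J.mul_mem_left _ ha

/-- In a Noetherian ring a single element of `M` saturates `J`. -/
lemma Ideal.exists_forall_mul_mem {S : Type*} [CommRing S] [IsNoetherianRing S] (J : Ideal S)
    (M : Submonoid S) : ∃ c ∈ M, ∀ v ∈ M, ∀ b, v * b ∈ J → c * b ∈ J := by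
  obtain ⟨c, hc, h⟩ := (IsNoetherian.noetherian (J.saturation M)).exists_smul_mem (Q := J) M
    fun x hx => hx
  exact ⟨c, hc, fun v hv b hb => h b ⟨v, hv, hb⟩⟩

/-- Associated primes of a saturation are the associated primes disjoint from the submonoid. -/
lemma mem_associatedPrimes_of_saturation {S : Type*} [CommRing S] [IsNoetherianRing S] {J : Ideal S}
    {M : Submonoid S} {P : Ideal S} (hP : P ∈ associatedPrimes S (S ⧸ J.saturation M)) :
    P ∈ associatedPrimes S (S ⧸ J) ∧ ∀ s ∈ M, s ∉ P := by
  rw [mem_associatedPrimes_quotient_iff] at hP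
  obtain ⟨hPp, z, hz⟩ := hP
  obtain ⟨c, hc, hcJ⟩ := J.exists_forall_mul_mem M
  constructor
  · rw [mem_associatedPrimes_quotient_iff]
    refine ⟨hPp, c * z, fun r => ?_⟩
    rw [hz]
    constructor
    · rintro ⟨v, hv, h⟩
      rw [mul_left_comm]
      exact hcJ v hv _ h
    · intro h
      exact ⟨c, hc, by rwa [mul_left_comm]⟩
  · intro s hs hsP
    obtain ⟨v, hv, h⟩ := (hz s).mp hsP
    refine hPp.ne_top ((Ideal.eq_top_iff_one _).mpr ((hz 1).mpr ⟨v * s, M.mul_mem hv hs, ?_⟩))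
    rwa [one_mul, mul_assoc]

/-- If `c` saturates `u S` with respect to `M`, then `c ^ j` saturates `u ^ j S`. -/
lemma pow_mul_mem_span_pow {S : Type*} [CommRing S] [IsDomain S] {u c : S}
    {M : Submonoid S} (hu : u ≠ 0)
    (hc : ∀ v ∈ M, ∀ b, v * b ∈ Ideal.span {u} → c * b ∈ Ideal.span {u}) {v : S} (hv : v ∈ M)
    (j : ℕ) : ∀ b, u ^ j ∣ v * b → u ^ j ∣ c ^ j * b := by
  simp only [Ideal.mem_span_singleton] at hc
  induction j with
  | zero => simp
  | succ j ih =>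
    intro b hb
    obtain ⟨b', hb'⟩ := hc v hv b ((dvd_pow_self u (Nat.succ_ne_zero j)).trans hb)
    have h1 : u ^ j ∣ v * b' := by
      rw [← mul_dvd_mul_iff_left hu, ← pow_succ']
      rw [show u * (v * b') = c * (v * b) by rw [mul_left_comm, ← hb']; ring]
      exact hb.mul_left c
    obtain ⟨d, hd⟩ := ih b' h1
    exact ⟨d, by rw [pow_succ, mul_assoc, hb', mul_left_comm, hd]; ring⟩

section
variable {S K : Type*} [CommRing S] [Field K] [Algebra S K]

/-- An element all of whose powers have the common denominator `a` is integral, as `S[g]` is then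
contained in the finite module `a⁻¹ S`. -/
lemma isIntegral_of_forall_mul_pow_mem {S E : Type*} [CommRing S] [CommRing E] [Algebra S E]
    [IsNoetherianRing S] {a g : E} (ha : a ∈ nonZeroDivisors E)
    (h : ∀ i : ℕ, ∃ b, a * g ^ i = algebraMap S E b) : IsIntegral S g := by
  let m : E →ₗ[S] E := LinearMap.mulLeft S a
  have hm : Function.Injective m := fun x y hxy => (mul_cancel_left_mem_nonZeroDivisors ha).mp hxy
  have hle : ((Algebra.adjoin S {g}).toSubmodule).map m ≤ (1 : Submodule S E) := by
    rw [Submodule.map_le_iff_le_comap, Algebra.adjoin_singleton_eq_range_aeval]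
    rintro _ ⟨q, rfl⟩
    change Polynomial.aeval g q ∈ _
    induction q using Polynomial.induction_on' with
    | add p q hp hq => rw [map_add]; exact add_mem hp hq
    | monomial n a =>
      obtain ⟨b, hb⟩ := h n
      rw [Polynomial.aeval_monomial, ← Algebra.smul_def]
      refine Submodule.smul_mem _ a ?_
      rw [Submodule.mem_comap, Submodule.mem_one]
      exact ⟨b, hb.symm⟩
  have h1 : (1 : Submodule S E).FG := by
    rw [Submodule.one_eq_span]
    exact Submodule.fg_span_singleton 1
  have : IsNoetherian S (1 : Submodule S E) := isNoetherian_of_fg_of_noetherian _ h1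
  have h2 : (((Algebra.adjoin S {g}).toSubmodule).map m).FG := by
    have h3 := IsNoetherian.noetherian
      ((((Algebra.adjoin S {g}).toSubmodule).map m).submoduleOf (1 : Submodule S E))
    have h4 := h3.map (1 : Submodule S E).subtype
    rwa [Submodule.submoduleOf, Submodule.map_comap_subtype, inf_eq_right.mpr hle] at h4
  have h3 : ((Algebra.adjoin S {g}).toSubmodule).FG := Submodule.fg_of_fg_map_injective m hm h2
  exact IsIntegral.of_mem_of_fg _ h3 g (Algebra.subset_adjoin rfl)

lemma isIntegral_of_forall_pow_mem [IsNoetherianRing S] [FaithfulSMul S K] {u : S} (hu0 : u ≠ 0)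
    {g : K} {e : ℕ}
    (h : ∀ i : ℕ, ∃ a, algebraMap S K u ^ e * g ^ i = algebraMap S K a) : IsIntegral S g :=
  isIntegral_of_forall_mul_pow_mem (mem_nonZeroDivisors_of_ne_zero (pow_ne_zero _
    ((map_ne_zero_iff _ (FaithfulSMul.algebraMap_injective S K)).mpr hu0))) h

/-- `u` is a *power denominator* for the integral closure of `S` in `K`: every integral element is
multiplied into `S` by a power of `u`. -/
def IsPowerDenominator (K : Type*) [Field K] [Algebra S K] (u : S) : Prop :=
  ∀ f : K, IsIntegral S f → ∃ (k : ℕ) (a : S), algebraMap S K u ^ k * f = algebraMap S K a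

/-- All powers of an integral element have a common denominator. -/
lemma IsPowerDenominator.exists_forall_pow {u : S} (hu : IsPowerDenominator K u) {f : K}
    (hf : IsIntegral S f) :
    ∃ e : ℕ, ∀ i : ℕ, ∃ a, algebraMap S K u ^ e * f ^ i = algebraMap S K a := by
  have h1 : (Subalgebra.toSubmodule (Algebra.adjoin S {f})).FG := hf.fg_adjoin_singleton
  have h2 : ∀ x ∈ Subalgebra.toSubmodule (Algebra.adjoin S {f}),
      ∃ s ∈ Submonoid.powers u, s • x ∈ (1 : Submodule S K) := by
    intro x hx
    have hx' : IsIntegral S x := IsIntegral.of_mem_of_fg _ h1 x hx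
    obtain ⟨k, a, ha⟩ := hu x hx'
    exact ⟨u ^ k, ⟨k, rfl⟩, by
      rw [Algebra.smul_def, map_pow, ha]; exact Submodule.mem_one.mpr ⟨a, rfl⟩⟩
  obtain ⟨_, ⟨e, rfl⟩, h⟩ := h1.exists_smul_mem _ h2
  refine ⟨e, fun i => ?_⟩
  obtain ⟨a, ha⟩ := Submodule.mem_one.mp
    (h (f ^ i) (pow_mem (Algebra.self_mem_adjoin_singleton S f) i))
  exact ⟨a, by rw [ha, Algebra.smul_def, map_pow]⟩

/-- If `c` saturates `u S`, then local integrality of `g` with `u ^ j g ∈ S` gives integrality of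
`c ^ j g`. -/
lemma IsPowerDenominator.isIntegral_pow_mul [IsNoetherianRing S] [FaithfulSMul S K] {u c : S}
    (hu0 : u ≠ 0) (hu : IsPowerDenominator K u) {M : Submonoid S}
    (hc : ∀ v ∈ M, ∀ b, v * b ∈ Ideal.span {u} → c * b ∈ Ideal.span {u}) {v : S} (hv : v ∈ M)
    {g : K} (hg : IsIntegral S (algebraMap S K v * g)) {j : ℕ} {b : S}
    (hb : algebraMap S K u ^ j * g = algebraMap S K b) :
    IsIntegral S (algebraMap S K c ^ j * g) := by
  have hinj := FaithfulSMul.algebraMap_injective S K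
  have : IsDomain S := hinj.isDomain
  have hφ : algebraMap S K u ≠ 0 := (map_ne_zero_iff _ hinj).mpr hu0
  obtain ⟨e, he⟩ := hu.exists_forall_pow hg
  refine isIntegral_of_forall_pow_mem hu0 (e := e) fun i => ?_
  obtain ⟨a, ha⟩ := he i
  have h1 : v ^ i * (u ^ e * b ^ i) = u ^ (j * i) * a := by
    apply hinj
    simp only [map_mul, map_pow]
    rw [← ha, ← hb]
    ring
  obtain ⟨d, hd⟩ := pow_mul_mem_span_pow hu0 hc (M.pow_mem hv i) (j * i) _ (Dvd.intro a h1.symm)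
  refine ⟨d, mul_left_cancel₀ (pow_ne_zero (j * i) hφ) ?_⟩
  have h2 := congrArg (algebraMap S K) hd
  simp only [map_mul, map_pow] at h2
  rw [← h2, ← hb]
  ring

/-- The local conductor exponent at `p` is at most `k`: locally at `p`, the integral closure of `S`
in `K` is contained in `u ^ (-k) S`. -/
def IsBoundedAt (K : Type*) [Field K] [Algebra S K] (u : S) (k : ℕ) (p : Ideal S) : Prop :=
  ∀ f : K, IsIntegral S f →
    ∃ s ∉ p, ∃ a, algebraMap S K s * (algebraMap S K u ^ k * f) = algebraMap S K a

lemma IsBoundedAt.mono {u : S} {k l : ℕ} (hkl : k ≤ l) {p : Ideal S}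
    (h : IsBoundedAt K u k p) : IsBoundedAt K u l p := by
  intro f hf
  obtain ⟨s, hs, a, ha⟩ := h f hf
  refine ⟨s, hs, u ^ (l - k) * a, ?_⟩
  rw [map_mul, ← ha, map_pow, ← Nat.sub_add_cancel hkl, pow_add, Nat.add_sub_cancel]
  ring

/-- A bound at the associated primes of `u` disjoint from `M` gives a bound after inverting `M`. -/
lemma IsPowerDenominator.exists_mul_pow_mul_mem [IsNoetherianRing S] [FaithfulSMul S K] {u : S}
    (hu0 : u ≠ 0) (hu : IsPowerDenominator K u) {k : ℕ} (M : Submonoid S)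
    (hM : ∀ P ∈ associatedPrimes S (S ⧸ Ideal.span {u}), (∀ s ∈ M, s ∉ P) → IsBoundedAt K u k P)
    {f : K} (hf : IsIntegral S f) :
    ∃ s ∈ M, ∃ a, algebraMap S K s * (algebraMap S K u ^ k * f) = algebraMap S K a := by
  have hinj := FaithfulSMul.algebraMap_injective S K
  have hφ : algebraMap S K u ≠ 0 := (map_ne_zero_iff _ hinj).mpr hu0
  have main : ∀ j : ℕ, ∀ f : K, IsIntegral S f →
      (∃ b, algebraMap S K u ^ (k + j) * f = algebraMap S K b) →
      ∃ s ∈ M, ∃ a, algebraMap S K s * (algebraMap S K u ^ k * f) = algebraMap S K a := by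
    intro j
    induction j with
    | zero => rintro f - ⟨b, hb⟩; exact ⟨1, M.one_mem, b, by rw [map_one, one_mul, ← hb, add_zero]⟩
    | succ j ih =>
      rintro f hf ⟨b, hb⟩
      -- With `b = u ^ (k + j + 1) f`, the ideal `(u : b)` is contained in no associated prime of
      -- the saturation of `u S`, as `f` has denominator `u ^ k` there. Hence `b` lies in the
      -- saturation, and one factor `u` can be removed.
      set J := (Ideal.span {u}).saturation M
      let I : Ideal S := (Ideal.span {u}).colon {b}
      obtain ⟨s, hs, hreg⟩ : ∃ s ∈ I, ∀ b, s * b ∈ J → b ∈ J := by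
        refine exists_mem_regular_of_not_le fun P hP hle => ?_
        obtain ⟨hP1, hP2⟩ := mem_associatedPrimes_of_saturation hP
        obtain ⟨s, hs, a, ha⟩ := hM P hP1 hP2 f hf
        refine hs (hle ?_)
        rw [Submodule.mem_colon_singleton, smul_eq_mul, Ideal.mem_span_singleton]
        refine ⟨u ^ j * a, hinj ?_⟩
        rw [map_mul, ← hb, map_mul, map_mul, ← ha, map_pow]
        ring
      have hbJ : b ∈ J := hreg b ⟨1, M.one_mem, by
        rw [one_mul]
        exact Submodule.mem_colon_singleton.mp hs⟩
      obtain ⟨v, hv, hvb⟩ := hbJ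
      obtain ⟨d, hd⟩ := Ideal.mem_span_singleton.mp hvb
      obtain ⟨s, hs, a, ha⟩ := ih (algebraMap S K v * f) (isIntegral_algebraMap.mul hf)
        ⟨d, mul_left_cancel₀ hφ (by
          rw [← map_mul, ← hd, map_mul, ← hb]; ring)⟩
      exact ⟨s * v, M.mul_mem hs hv, a, by rw [← ha, map_mul]; ring⟩
  obtain ⟨j, a, ha⟩ := hu f hf
  exact main j f hf ⟨u ^ k * a, by rw [map_mul, ← ha, map_pow]; ring⟩

end

section
variable {S K : Type*} [CommRing S] [Field K] [Algebra S K]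

/-- Locally at `p`, the integral closure `C` of `S` in `K` satisfies `C ⊆ S + u C`. -/
def IsIntegralModAt (K : Type*) [Field K] [Algebra S K] (u : S) (p : Ideal S) : Prop :=
  ∀ f : K, IsIntegral S f → ∃ s ∉ p, ∃ (a : S) (h : K), IsIntegral S h ∧
    algebraMap S K s * f = algebraMap S K a + algebraMap S K u * h

/-- An ideal annihilated by elements outside each non-maximal prime is Artinian. -/
lemma isArtinian_of_forall_annihilator_not_le {T : Type*} [CommRing T] [IsNoetherianRing T]
    (D : Ideal T)
    (h : ∀ P : Ideal T, P.IsPrime → ¬ P.IsMaximal → ¬ Module.annihilator T D ≤ P) :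
    IsArtinian T D := by
  have h1 : IsArtinianRing (T ⧸ Module.annihilator T D) := by
    rw [isArtinianRing_iff_krullDimLE_zero]
    refine Ring.KrullDimLE.mk₀ fun P hP => ?_
    have hle : Module.annihilator T D ≤ P.comap (Ideal.Quotient.mk _) := by
      intro x hx
      rw [Ideal.mem_comap, Ideal.Quotient.eq_zero_iff_mem.mpr hx]
      exact zero_mem _
    have h2 : (P.comap (Ideal.Quotient.mk (Module.annihilator T D))).IsMaximal := by
      by_contra hm
      exact h _ (Ideal.comap_isPrime _ _) hm hle
    have h3 := Ideal.map_eq_top_or_isMaximal_of_surjective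
      (Ideal.Quotient.mk (Module.annihilator T D)) Ideal.Quotient.mk_surjective h2
    rw [Ideal.map_comap_of_surjective _ Ideal.Quotient.mk_surjective] at h3
    exact h3.resolve_left hP.ne_top
  let _ : Module (T ⧸ Module.annihilator T D) D := Module.quotientAnnihilator
  have : IsScalarTower T (T ⧸ Module.annihilator T D) D := by
    constructor
    intro x y z
    obtain ⟨y, rfl⟩ := Ideal.Quotient.mk_surjective y
    change (x * y) • z = x • y • z
    rw [mul_smul]
  have : Module.Finite (T ⧸ Module.annihilator T D) D :=
    Module.Finite.of_restrictScalars_finite T _ _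
  have h2 : IsArtinian (T ⧸ Module.annihilator T D) D := inferInstance
  exact isArtinian_of_surjective_algebraMap (R := T ⧸ Module.annihilator T D)
    Ideal.Quotient.mk_surjective

/-- If a descending chain of ideals lies in `J` locally at all primes strictly inside `p`, then it
stabilizes modulo `J` locally at `p`. -/
lemma exists_forall_mul_mem_sup [IsNoetherianRing S] {p : Ideal S} [p.IsPrime] (J : Ideal S)
    {D : ℕ → Ideal S} (hD : Antitone D) {k0 : ℕ}
    (h : ∀ p' : Ideal S, p'.IsPrime → p' < p → ∀ z ∈ D k0, ∃ s ∉ p', s * z ∈ J) :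
    ∃ k1 ≥ k0, ∀ k ≥ k1, ∀ z ∈ D k1, ∃ s ∉ p, s * z ∈ D k ⊔ J := by
  let T := Localization.AtPrime p
  let ι : S →+* T ⧸ J.map (algebraMap S T) := (Ideal.Quotient.mk _).comp (algebraMap S T)
  -- The image of `D k0` in `S_p ⧸ J S_p` vanishes locally at all non-maximal primes.
  have hart : IsArtinian (T ⧸ J.map (algebraMap S T)) ((D k0).map ι) := by
    refine isArtinian_of_forall_annihilator_not_le _ fun P hP hPm hle => ?_
    have hP' : (P.comap ι).IsPrime := Ideal.comap_isPrime _ _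
    have hPT : (P.comap (Ideal.Quotient.mk (J.map (algebraMap S T)))).IsPrime :=
      Ideal.comap_isPrime _ _
    have hlep : P.comap ι ≤ p := by
      intro x hx
      by_contra hxp
      refine hP.ne_top (Ideal.eq_top_of_isUnit_mem _ hx ?_)
      exact (IsLocalization.map_units T (⟨x, hxp⟩ : p.primeCompl)).map (Ideal.Quotient.mk _)
    have hne : P.comap ι ≠ p := by
      intro heq
      apply hPm
      have h1 : P.comap (Ideal.Quotient.mk (J.map (algebraMap S T))) =
          IsLocalRing.maximalIdeal T := by
        rw [← IsLocalization.map_under p.primeCompl T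
          (P.comap (Ideal.Quotient.mk (J.map (algebraMap S T)))),
          ← Localization.AtPrime.map_eq_maximalIdeal]
        exact congrArg _ heq
      have h2 := IsLocalRing.maximalIdeal.isMaximal T
      rw [← h1] at h2
      have h3 := Ideal.map_eq_top_or_isMaximal_of_surjective
        (Ideal.Quotient.mk (J.map (algebraMap S T))) Ideal.Quotient.mk_surjective h2
      rw [Ideal.map_comap_of_surjective _ Ideal.Quotient.mk_surjective] at h3
      exact h3.resolve_left hP.ne_top
    obtain ⟨s, hs, hs'⟩ := (IsNoetherian.noetherian (D k0)).exists_smul_mem (Q := J)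
      (P.comap ι).primeCompl fun z hz => h _ hP' (lt_of_le_of_ne hlep hne) z hz
    refine hs (hle (Module.mem_annihilator.mpr ?_) : ι s ∈ P)
    rintro ⟨x, hx⟩
    refine Subtype.ext ?_
    change ι s * x = 0
    refine Submodule.span_induction (p := fun x _ => ι s * x = 0) ?_ (mul_zero _) ?_ ?_ hx
    · rintro _ ⟨z, hz, rfl⟩
      rw [← map_mul]
      exact Ideal.Quotient.eq_zero_iff_mem.mpr (Ideal.mem_map_of_mem _ (hs' z hz))
    · intro x y _ _ hx hy
      rw [mul_add, hx, hy, add_zero]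
    · intro a x _ hx
      rw [smul_eq_mul, mul_left_comm, hx, mul_zero]
  let F : ℕ →o (Submodule (T ⧸ J.map (algebraMap S T)) ((D k0).map ι))ᵒᵈ :=
    ⟨fun k => OrderDual.toDual (Submodule.submoduleOf ((D (k0 + k)).map ι) ((D k0).map ι)),
      fun a b hab => OrderDual.toDual_le_toDual.mpr
        (Submodule.comap_mono (Ideal.map_mono (hD (Nat.add_le_add_left hab k0))))⟩
  obtain ⟨m, hm⟩ := IsArtinian.monotone_stabilizes F
  refine ⟨k0 + m, Nat.le_add_right _ _, fun k hk z hz => ?_⟩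
  obtain ⟨l, rfl⟩ := Nat.exists_eq_add_of_le hk
  have h1 := OrderDual.toDual.injective (hm (m + l) (Nat.le_add_right m l))
  have h2 : (⟨ι z, Ideal.mem_map_of_mem ι (hD (Nat.le_add_right k0 m) hz)⟩ : (D k0).map ι) ∈
      Submodule.submoduleOf ((D (k0 + m)).map ι) ((D k0).map ι) := Ideal.mem_map_of_mem ι hz
  rw [h1] at h2
  change ι z ∈ (D (k0 + (m + l))).map ι at h2
  rw [← add_assoc] at h2
  have h3 : Ideal.Quotient.mk (J.map (algebraMap S T)) (algebraMap S T z) ∈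
      ((D (k0 + m + l)).map (algebraMap S T)).map (Ideal.Quotient.mk _) := by
    rw [Ideal.map_map]; exact h2
  rw [Ideal.mem_map_iff_of_surjective _ Ideal.Quotient.mk_surjective] at h3
  obtain ⟨y, hy, hyz⟩ := h3
  have h4 : algebraMap S T z ∈ (D (k0 + m + l) ⊔ J).map (algebraMap S T) := by
    rw [Ideal.map_sup, ← add_sub_cancel y (algebraMap S T z)]
    refine Submodule.add_mem_sup hy ?_
    rw [← Ideal.Quotient.eq_zero_iff_mem, _root_.map_sub, hyz, sub_self]
  rw [IsLocalization.algebraMap_mem_map_algebraMap_iff p.primeCompl] at h4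
  exact h4

/-- If the denominators of the integral closure `C` of `S` in `K` are bounded at all primes strictly
inside `p`, then locally at `p` every element of `C` is congruent modulo `u C` to one with bounded
denominator: the ideals `u ^ k C ∩ S` are stationary modulo `u S` locally at `p`. -/
lemma IsPowerDenominator.exists_mod_bounded [IsNoetherianRing S] [FaithfulSMul S K] {u : S}
    (hu0 : u ≠ 0) (hu : IsPowerDenominator K u) {p : Ideal S} [p.IsPrime] {k0 : ℕ}
    (h : ∀ p' : Ideal S, p'.IsPrime → p' < p → IsBoundedAt K u k0 p') :
    ∃ k1 ≥ k0, ∀ f : K, IsIntegral S f → ∃ s ∉ p, ∃ (g h : K), IsIntegral S g ∧ IsIntegral S h ∧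
      (∃ a, algebraMap S K u ^ k1 * g = algebraMap S K a) ∧
      algebraMap S K s * f = g + algebraMap S K u * h := by
  have hinj := FaithfulSMul.algebraMap_injective S K
  have hφ : algebraMap S K u ≠ 0 := (map_ne_zero_iff _ hinj).mpr hu0
  obtain ⟨k1, hk1, hstab⟩ := exists_forall_mul_mem_sup (p := p) (Ideal.span {u})
    (integralPowIdeal_antitone (K := K) u) (k0 := k0 + 1) (by
      rintro p' hp' hlt z ⟨f, hf, hz⟩
      obtain ⟨s, hs, a, ha⟩ := h p' hp' hlt f hf
      refine ⟨s, hs, Ideal.mem_span_singleton.mpr ⟨a, hinj ?_⟩⟩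
      rw [map_mul, hz, map_mul, ← ha]
      ring)
  refine ⟨k1, (Nat.le_succ k0).trans hk1, ?_⟩
  have hone : (1 : S) ∉ p := p.ne_top_iff_one.mp (Ideal.IsPrime.ne_top ‹_›)
  have main : ∀ j : ℕ, ∀ f : K, IsIntegral S f →
      (∃ b, algebraMap S K u ^ (k1 + j) * f = algebraMap S K b) →
      ∃ s ∉ p, ∃ (g h : K), IsIntegral S g ∧ IsIntegral S h ∧
      (∃ a, algebraMap S K u ^ k1 * g = algebraMap S K a) ∧
      algebraMap S K s * f = g + algebraMap S K u * h := by
    intro j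
    induction j with
    | zero =>
      intro f hf hb
      exact ⟨1, hone, f, 0, hf, isIntegral_zero, hb, by simp⟩
    | succ j ih =>
      rintro f hf ⟨b, hb⟩
      -- Locally `b = u ^ (k1 + j + 1) f` is congruent modulo `u` to some `u ^ (k1 + j + 2) f'` with
      -- `f'` integral, so that `f - u f'` has a smaller denominator than `f`.
      have hbD : b ∈ integralPowIdeal K u (k1 + (j + 1)) := ⟨f, hf, hb.symm⟩
      obtain ⟨s, hs, hsb⟩ := hstab (k1 + (j + 2)) (Nat.le_add_right _ _) b
        (integralPowIdeal_antitone u (Nat.le_add_right _ _) hbD)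
      obtain ⟨z, ⟨f', hf', hz⟩, w, hw, hzw⟩ := Submodule.mem_sup.mp hsb
      obtain ⟨a, rfl⟩ := Ideal.mem_span_singleton.mp hw
      obtain ⟨s', hs', g, h, hg, hh, hga, hfg⟩ := ih
        (algebraMap S K s * f - algebraMap S K u * f')
        ((isIntegral_algebraMap.mul hf).sub (isIntegral_algebraMap.mul hf')) ⟨a, by
          apply mul_left_cancel₀ hφ
          have := congrArg (algebraMap S K) hzw
          rw [map_add, map_mul, map_mul, hz, ← hb] at this
          linear_combination -this⟩
      refine ⟨s' * s, fun hmem => ((‹p.IsPrime›.mem_or_mem hmem).elim hs' hs), g,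
        h + algebraMap S K s' * f', hg, hh.add (isIntegral_algebraMap.mul hf'), hga, ?_⟩
      rw [map_mul]
      linear_combination hfg
  intro f hf
  obtain ⟨j, a, ha⟩ := hu f hf
  exact main j f hf ⟨u ^ k1 * a, by rw [map_mul, ← ha, map_pow]; ring⟩

end

section
variable {S K : Type*} [CommRing S] [Field K] [Algebra S K]

/-- Let `C` be the integral closure of `S` in `K`. If `C ⊆ S + u C` locally at `p`, then either
`p C` is locally generated by one element and `p` is a minimal prime of `u`, or `p` contains an
element that is, locally at `p`, regular modulo `u C ∩ S`. -/
lemma IsIntegralModAt.exists_uniformizer_or_regular [IsNoetherianRing S] [FaithfulSMul S K]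
    {u : S} (hu0 : u ≠ 0) {p : Ideal S} [p.IsPrime] (hup : u ∈ p) (h2 : IsIntegralModAt K u p) :
    (∃ π ∈ p, (∃ s₀ ∉ p, ∀ r ∈ p, ∃ c : K, IsIntegral S c ∧
        algebraMap S K s₀ * algebraMap S K r = algebraMap S K π * c) ∧
      ∀ p' : Ideal S, p'.IsPrime → p' < p → u ∉ p') ∨
    ∃ a ∈ p, ∀ b, a * b ∈ integralPowIdeal K u 1 → ∃ s ∉ p, s * b ∈ integralPowIdeal K u 1 := by
  have hinj := FaithfulSMul.algebraMap_injective S K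
  have hφ : algebraMap S K u ≠ 0 := (map_ne_zero_iff _ hinj).mpr hu0
  have hp : p.IsPrime := ‹_›
  by_cases hass : ∀ P ∈ associatedPrimes S
      (S ⧸ (integralPowIdeal K u 1).saturation p.primeCompl), ¬ p ≤ P
  · right
    obtain ⟨a, ha, hreg⟩ := exists_mem_regular_of_not_le hass
    exact ⟨a, ha, fun b hb => hreg b ⟨1, one_mem _, by rwa [one_mul]⟩⟩
  left
  push Not at hass
  obtain ⟨P, hP, hpP⟩ := hass
  obtain ⟨hP1, hP2⟩ := mem_associatedPrimes_of_saturation hP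
  obtain rfl : p = P := le_antisymm hpP fun x hx => by
    by_contra hxp
    exact hP2 x hxp hx
  obtain ⟨-, y, hy⟩ := mem_associatedPrimes_quotient_iff.mp hP1
  -- The element `f = y / u` is not integral at `p`, but `p f` consists of integral elements.
  set f : K := algebraMap S K y / algebraMap S K u with hfdef
  have hyf : algebraMap S K y = algebraMap S K u * f := (mul_div_cancel₀ _ hφ).symm
  have hpf : ∀ r ∈ p, IsIntegral S (algebraMap S K r * f) := by
    intro r hr
    obtain ⟨g, hg, hrg⟩ := (hy r).mp hr
    rw [map_mul, hyf, pow_one, mul_left_comm] at hrg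
    rwa [mul_left_cancel₀ hφ hrg]
  have hnot : ∀ s ∉ p, ¬ IsIntegral S (algebraMap S K s * f) := by
    intro s hs hint
    exact hs ((hy s).mpr ⟨_, hint, by rw [map_mul, hyf, pow_one, mul_left_comm]⟩)
  obtain ⟨T, hT⟩ := IsNoetherian.noetherian p
  let C := integralClosure S K
  let N : Submodule C K := Submodule.span C (algebraMap S K '' T)
  have hpN : ∀ r ∈ p, algebraMap S K r ∈ N := by
    intro r hr
    rw [← hT] at hr
    refine Submodule.span_induction (p := fun r _ => algebraMap S K r ∈ N)
      (fun x hx => Submodule.subset_span ⟨x, hx, rfl⟩) (by rw [map_zero]; exact zero_mem _)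
      (fun x y _ _ hx hy => by rw [map_add]; exact add_mem hx hy) (fun a x _ hx => ?_) hr
    rw [smul_eq_mul, map_mul]
    exact N.smul_mem (algebraMap S C a) hx
  -- The `C`-module `N = p C` is not stable under `f`, even locally, as `f` would be integral.
  obtain ⟨π, hπp, hπ⟩ : ∃ π ∈ p, ∀ s ∉ p, algebraMap S K s * (algebraMap S K π * f) ∉ N := by
    by_contra! hcon
    obtain ⟨s, hs, hsN⟩ := ((IsNoetherian.noetherian p).map
      ((LinearMap.mulRight S f).comp (Algebra.linearMap S K))).exists_smul_mem
      (Q := N.restrictScalars S) p.primeCompl (by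
        rintro _ ⟨r, hr, rfl⟩
        obtain ⟨s, hs, hsr⟩ := hcon r hr
        exact ⟨s, hs, by rw [Algebra.smul_def]; exact hsr⟩)
    have h1 : IsIntegral C (algebraMap S K s * f) := by
      refine isIntegral_of_smul_mem_submodule (N := N) ?_
        (Submodule.fg_span (T.finite_toSet.image _)) _ ?_
      · intro hN
        apply hφ
        have := hpN u hup
        rwa [hN, Submodule.mem_bot] at this
      · intro n hn
        refine Submodule.span_induction (p := fun n _ => (algebraMap S K s * f) • n ∈ N) ?_
          (by rw [smul_zero]; exact zero_mem _)
          (fun x y _ _ hx hy => by rw [smul_add]; exact add_mem hx hy) (fun a x _ hx => ?_) hn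
        · rintro _ ⟨r, hr, rfl⟩
          have := hsN _ ⟨r, hT ▸ Submodule.subset_span hr, rfl⟩
          rw [Algebra.smul_def] at this
          change algebraMap S K s * (algebraMap S K r * f) ∈ N at this
          rwa [smul_eq_mul, mul_assoc, mul_comm f]
        · rw [smul_comm]
          exact N.smul_mem a hx
    exact hnot s hs (isIntegral_trans _ h1)
  have hgint := hpf π hπp
  -- By `C ⊆ S + u C`, the element `π f` of `C` is locally congruent modulo `u` to some `a ∈ S`, and
  -- `a ∉ p` since `π f ∉ p C` locally.
  obtain ⟨s₁, hs₁, a, h, hh, hah⟩ := h2 _ hgint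
  have hap : a ∉ p := by
    intro hap
    refine hπ s₁ hs₁ ?_
    rw [hah, mul_comm (algebraMap S K u)]
    exact add_mem (hpN a hap) (N.smul_mem (⟨h, hh⟩ : C) (hpN u hup))
  -- The element `s₁ π f` is a unit of `C` locally at `p`.
  obtain ⟨s₀, hs₀, c, hc, hsc⟩ : ∃ s₀ ∉ p, ∃ c : K, IsIntegral S c ∧
      algebraMap S K s₀ = algebraMap S K s₁ * (algebraMap S K π * f) * c := by
    by_contra! hcon
    let w : C := ⟨algebraMap S K s₁ * (algebraMap S K π * f), isIntegral_algebraMap.mul hgint⟩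
    obtain ⟨Q, hQw, hQp, hQ⟩ := Ideal.exists_ideal_over_prime_of_isIntegral p (Ideal.span {w}) (by
      intro s hs
      by_contra hsp
      obtain ⟨c, hc⟩ := Ideal.mem_span_singleton.mp hs
      exact hcon s hsp c c.2 (congrArg Subtype.val hc))
    apply hap
    rw [← hQ] at hup ⊢
    have h3 : algebraMap S C a = w - algebraMap S C u * ⟨h, hh⟩ :=
      Subtype.ext (eq_sub_of_add_eq hah.symm)
    rw [Ideal.mem_comap, h3]
    exact Q.sub_mem (hQw (Ideal.mem_span_singleton_self w)) (Q.mul_mem_right _ hup)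
  have hpπ : ∀ r ∈ p, ∃ c : K, IsIntegral S c ∧
        algebraMap S K s₀ * algebraMap S K r = algebraMap S K π * c := fun r hr =>
    ⟨algebraMap S K s₁ * (algebraMap S K r * f) * c,
      (isIntegral_algebraMap.mul (hpf r hr)).mul hc, by rw [hsc]; ring⟩
  refine ⟨π, hπp, ⟨s₀, hs₀, hpπ⟩, fun p' hp' hlt hup' => hu0 ?_⟩
  have hs₀' : s₀ ∉ p' := fun h => hs₀ (hlt.le h)
  have hπ' : π ∉ p' := by
    intro hπ'
    refine hlt.not_ge fun r hr => ?_
    obtain ⟨c, hc, hrc⟩ := hpπ r hr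
    exact (hp'.mem_or_mem (mem_of_eq_mul_of_isIntegral hinj hc hπ'
      (by rw [map_mul, hrc]))).resolve_left hs₀'
  -- If `u ∈ p'`, then the elements of `p' + u C` are locally divisible by `π` within `p' + u C`,
  -- hence by all powers of `π`; applied to `u`, this gives `u = 0`.
  have hdiv : ∀ n : ℕ, ∀ a ∈ p', ∀ h : K, IsIntegral S h → ∃ s ∉ p, ∃ a' ∈ p', ∃ h' : K,
      IsIntegral S h' ∧ algebraMap S K s * (algebraMap S K a + algebraMap S K u * h) =
        algebraMap S K π ^ n * (algebraMap S K a' + algebraMap S K u * h') := by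
    intro n
    induction n with
    | zero => exact fun a ha h hh => ⟨1, p.ne_top_iff_one.mp hp.ne_top, a, ha, h, hh, by simp⟩
    | succ n ih =>
      intro a ha h hh
      obtain ⟨s, hs, a₁, ha₁, h₁, hh₁, heq⟩ := ih a ha h hh
      obtain ⟨c₁, hc₁, hac₁⟩ := hpπ a₁ (hlt.le ha₁)
      obtain ⟨c₂, hc₂, huc₂⟩ := hpπ u hup
      obtain ⟨t, ht, a', h', hh', hah'⟩ := h2 (c₁ + c₂ * h₁) (hc₁.add (hc₂.mul hh₁))
      have hts : t * s₀ ∉ p := fun hmem => (hp.mem_or_mem hmem).elim ht hs₀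
      have key : algebraMap S K (t * s₀) * (algebraMap S K a₁ + algebraMap S K u * h₁) =
          algebraMap S K π * (algebraMap S K a' + algebraMap S K u * h') := by
        rw [← hah', map_mul]
        linear_combination algebraMap S K t * hac₁ + algebraMap S K t * h₁ * huc₂
      refine ⟨t * s₀ * s, fun hmem => (hp.mem_or_mem hmem).elim hts hs, a', ?_, h', hh', ?_⟩
      · have h3 : t * s₀ * a₁ - π * a' ∈ p' := by
          refine mem_of_eq_mul_of_isIntegral hinj
            (g := algebraMap S K π * h' - algebraMap S K (t * s₀) * h₁)
            ((isIntegral_algebraMap.mul hh').sub (isIntegral_algebraMap.mul hh₁)) hup' ?_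
          rw [map_sub, map_mul _ _ a₁, map_mul _ π]
          linear_combination key
        have h4 : π * a' ∈ p' := by
          rw [← sub_sub_cancel (t * s₀ * a₁) (π * a')]
          exact p'.sub_mem (p'.mul_mem_left _ ha₁) h3
        exact (hp'.mem_or_mem h4).resolve_left hπ'
      · rw [map_mul, mul_assoc, heq, pow_succ]
        linear_combination algebraMap S K π ^ n * key
  refine eq_zero_of_forall_mul_eq_pow_mul_isIntegral hinj hπp fun k => ?_
  obtain ⟨s, hs, a', -, h', hh', heq⟩ := hdiv k u hup' 0 isIntegral_zero
  exact ⟨s, hs, _, isIntegral_algebraMap.add (isIntegral_algebraMap.mul hh'), by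
    rw [← heq, mul_zero, add_zero]⟩

/-- If `v f = w + u h` with `f` a root of `q`, then `w / v` is a root of `q` modulo `p`; the
equation is written without denominators. -/
lemma scaleRoots_eval_mem_of_isIntegral {p : Ideal S} [p.IsPrime]
    (hinj : Function.Injective (algebraMap S K)) {u v w : S} (hup : u ∈ p) {f h : K}
    (hf : IsIntegral S f) (hh : IsIntegral S h)
    (heq : algebraMap S K v * f = algebraMap S K w + algebraMap S K u * h) {q : Polynomial S}
    (hq : Polynomial.eval₂ (algebraMap S K) f q = 0) : (q.scaleRoots v).eval w ∈ p := by
  let C := integralClosure S K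
  let F : C := ⟨f, hf⟩
  obtain ⟨d, hd⟩ := Polynomial.sub_dvd_eval_sub (algebraMap S C w) (algebraMap S C v * F)
    ((q.scaleRoots v).map (algebraMap S C))
  have hF : Polynomial.eval₂ (algebraMap S C) F q = 0 := by
    apply Subtype.val_injective
    change C.val.toRingHom _ = 0
    rw [Polynomial.hom_eval₂]
    exact hq
  rw [Polynomial.eval_map, Polynomial.eval_map, Polynomial.scaleRoots_eval₂_mul, hF, mul_zero,
    sub_zero, Polynomial.eval₂_at_apply] at hd
  refine mem_of_eq_mul_of_isIntegral hinj (g := -h * d) (hh.neg.mul d.2) hup ?_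
  have h2 := congrArg Subtype.val hd
  change algebraMap S K _ = (algebraMap S K w - algebraMap S K v * f) * d at h2
  rw [h2, heq]
  ring

/-- A uniform denominator for the normalization of `S ⧸ p`, in terms of `S`: a multiple of every
integral fraction `w / v` over `S ⧸ p` by `c` lies in `S ⧸ p`. -/
def HasUniformDenominatorMod (p : Ideal S) : Prop :=
  ∃ c ∉ p, ∀ v ∉ p, ∀ w, ∀ q : Polynomial S, q.Monic → (q.scaleRoots v).eval w ∈ p →
    ∃ a, c * w - v * a ∈ p

/-- Let `C` be the integral closure of `S` in `K`. If `C = S` locally at all primes strictly inside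
`p`, if `C ⊆ S + u C` locally at `p`, and if the normalization of `S ⧸ p` has a uniform denominator,
then the denominators outside `p` that occur in the inclusion may be taken to be powers of a single
element `c`, so that the inclusion extends to all primes avoiding `c`. -/
lemma IsPowerDenominator.exists_pow_mul_mod [IsNoetherianRing S] [FaithfulSMul S K]
    {u : S} (hu0 : u ≠ 0) (hu : IsPowerDenominator K u) {p : Ideal S} [p.IsPrime] (hup : u ∈ p)
    (h1 : ∀ p' : Ideal S, p'.IsPrime → p' < p → IsBoundedAt K u 0 p')
    (h2 : IsIntegralModAt K u p) (h3 : HasUniformDenominatorMod p) :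
    ∃ c ∉ p, ∀ f : K, IsIntegral S f → ∃ (m : ℕ) (a : S) (h : K), IsIntegral S h ∧
      algebraMap S K c ^ m * f = algebraMap S K a + algebraMap S K u * h := by
  have hinj := FaithfulSMul.algebraMap_injective S K
  have hφ : algebraMap S K u ≠ 0 := (map_ne_zero_iff _ hinj).mpr hu0
  have hp : p.IsPrime := ‹_›
  have : IsDomain S := hinj.isDomain
  obtain ⟨c₀, hc₀, hc₀'⟩ := Ideal.exists_forall_mul_mem (Ideal.span {u}) p.primeCompl
  have hmul : ∀ {x y : S}, x ∉ p → y ∉ p → x * y ∉ p := fun hx hy hxy =>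
    (hp.mem_or_mem hxy).elim hx hy
  obtain ⟨π, hπp, ⟨s₀, hs₀, hpπ⟩, hmin⟩ | ⟨a₀, ha₀, hreg⟩ :=
    h2.exists_uniformizer_or_regular hu0 hup
  · obtain ⟨c₃, hc₃, h3⟩ := h3
    obtain ⟨c₅, hc₅, huc₅⟩ := hpπ u hup
    have hφs : algebraMap S K s₀ ≠ 0 := by
      rw [Ne, map_eq_zero_iff _ hinj]
      rintro rfl
      exact hs₀ (zero_mem p)
    have hφπ : algebraMap S K π ≠ 0 := by
      intro h0
      rw [h0, zero_mul] at huc₅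
      exact mul_ne_zero hφs hφ huc₅
    -- Since `p C` is locally `π C`, inclusion modulo `π` is a matter of uniform denominators for
    -- the normalization of `S ⧸ p`, and iterating gives inclusion modulo `π ^ n`.
    set c₂ := c₀ * s₀ * c₃ with hc₂def
    have step : ∀ f : K, IsIntegral S f → ∃ (m : ℕ) (a : S) (h : K), IsIntegral S h ∧
        algebraMap S K c₂ ^ m * f = algebraMap S K a + algebraMap S K π * h := by
      intro f hf
      obtain ⟨v, hv, w, h', hh', hvf⟩ := h2 f hf
      obtain ⟨q, hq, hqf⟩ := id hf
      obtain ⟨a, ha⟩ := h3 v hv w q hq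
        (scaleRoots_eval_mem_of_isIntegral hinj hup hf hh' hvf hqf)
      obtain ⟨c₄, hc₄, hac₄⟩ := hpπ _ ha
      rw [map_sub, map_mul, map_mul] at hac₄
      set g : K := algebraMap S K s₀ * (algebraMap S K c₃ * f - algebraMap S K a) /
        algebraMap S K π
      have hg : algebraMap S K π * g =
          algebraMap S K s₀ * (algebraMap S K c₃ * f - algebraMap S K a) := mul_div_cancel₀ _ hφπ
      have hvg : algebraMap S K v * g = c₄ + c₅ * (algebraMap S K c₃ * h') := by
        apply mul_left_cancel₀ hφπ
        linear_combination algebraMap S K v * hg + hac₄ + algebraMap S K c₃ * h' * huc₅ +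
          algebraMap S K s₀ * algebraMap S K c₃ * hvf
      have hug : algebraMap S K u * g = c₅ * (algebraMap S K c₃ * f - algebraMap S K a) := by
        apply mul_left_cancel₀ hφπ
        linear_combination algebraMap S K u * hg +
          (algebraMap S K c₃ * f - algebraMap S K a) * huc₅
      obtain ⟨j, b, hb⟩ := hu (algebraMap S K u * g) (by
        rw [hug]
        exact hc₅.mul ((isIntegral_algebraMap.mul hf).sub isIntegral_algebraMap))
      have hint := hu.isIntegral_pow_mul hu0 hc₀' hv (g := g) (j := j + 1) (b := b) (by
        rw [hvg]
        exact hc₄.add (hc₅.mul (isIntegral_algebraMap.mul hh'))) (by rw [← hb]; ring)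
      refine ⟨j + 1, s₀ ^ j * c₃ ^ j * (c₀ ^ (j + 1) * s₀ * a),
        algebraMap S K (s₀ ^ j * c₃ ^ j) * (algebraMap S K c₀ ^ (j + 1) * g),
        isIntegral_algebraMap.mul hint, ?_⟩
      simp only [hc₂def, map_mul, map_pow]
      linear_combination -(algebraMap S K s₀ ^ j * algebraMap S K c₃ ^ j *
        algebraMap S K c₀ ^ (j + 1)) * hg
    have steps : ∀ n : ℕ, ∀ f : K, IsIntegral S f → ∃ (m : ℕ) (a : S) (h : K), IsIntegral S h ∧
        algebraMap S K c₂ ^ m * f = algebraMap S K a + algebraMap S K π ^ n * h := by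
      intro n f hf
      induction n with
      | zero => exact ⟨0, 0, f, hf, by simp⟩
      | succ n ih =>
        obtain ⟨m, a, h, hh, heq⟩ := ih
        obtain ⟨m', a', h', hh', heq'⟩ := step h hh
        refine ⟨m' + m, c₂ ^ m' * a + π ^ n * a', h', hh', ?_⟩
        simp only [map_add, map_mul, map_pow]
        linear_combination algebraMap S K c₂ ^ m' * heq + algebraMap S K π ^ n * heq'
    -- As `p` is minimal over `u`, some power of `π` is a multiple of `u` locally.
    obtain ⟨s₁, hs₁, e, he⟩ := exists_mul_pow_mem_of_forall_not_le (p := p) (J := Ideal.span {u})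
      (u := π) fun Q hQ hQp hπQ huQ => hmin Q hQ
        (lt_of_le_of_ne hQp fun h => hπQ (h ▸ hπp)) (huQ (Ideal.mem_span_singleton_self u))
    obtain ⟨a₁, ha₁⟩ := Ideal.mem_span_singleton.mp he
    refine ⟨c₂ * s₁, hmul (hmul (hmul hc₀ hs₀) hc₃) hs₁, fun f hf => ?_⟩
    obtain ⟨m, a, h, hh, heq⟩ := steps e f hf
    refine ⟨m + 1, c₂ * s₁ ^ (m + 1) * a, algebraMap S K (c₂ * s₁ ^ m * a₁) * h,
      isIntegral_algebraMap.mul hh, ?_⟩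
    have ha₁' := congrArg (algebraMap S K) ha₁
    simp only [map_mul, map_pow] at ha₁' ⊢
    linear_combination algebraMap S K c₂ * algebraMap S K s₁ ^ (m + 1) * heq +
      algebraMap S K c₂ * algebraMap S K s₁ ^ m * h * ha₁'
  · obtain ⟨c₁, hc₁, hc₁'⟩ := Ideal.exists_forall_mul_mem
      (Ideal.span {a₀} ⊔ integralPowIdeal K u 1) p.primeCompl
    -- Write `D = u C ∩ S`. As `a₀` is regular modulo `D` locally, the powers of `c₁` saturate the
    -- ideals `a₀ ^ n S + D`.
    have hsat : ∀ n : ℕ, ∀ v ∉ p, ∀ b x d, d ∈ integralPowIdeal K u 1 → v * b = a₀ ^ n * x + d →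
        ∃ x' d', d' ∈ integralPowIdeal K u 1 ∧ c₁ ^ n * b = a₀ ^ n * x' + d' := by
      intro n
      induction n with
      | zero => exact fun v hv b x d hd h => ⟨b, 0, zero_mem _, by simp⟩
      | succ n ih =>
        intro v hv b x d hd h
        have hb := hc₁' v hv b (by
          rw [h, pow_succ', mul_assoc]
          exact Submodule.add_mem_sup
            (Ideal.mul_mem_right _ _ (Ideal.mem_span_singleton_self _)) hd)
        obtain ⟨_, hy, d₁, hd₁, hyd⟩ := Submodule.mem_sup.mp hb
        obtain ⟨b₁, rfl⟩ := Ideal.mem_span_singleton.mp hy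
        obtain ⟨s, hs, hsb⟩ := hreg (v * b₁ - a₀ ^ n * (c₁ * x)) (by
          rw [show a₀ * (v * b₁ - a₀ ^ n * (c₁ * x)) = c₁ * d - v * d₁ by
            linear_combination v * hyd + c₁ * h]
          exact Ideal.sub_mem _ (Ideal.mul_mem_left _ _ hd) (Ideal.mul_mem_left _ _ hd₁))
        obtain ⟨x', d', hd', hxd⟩ := ih (s * v) (hmul hs hv) b₁ (s * (c₁ * x)) _ hsb (by ring)
        refine ⟨x', a₀ * d' + c₁ ^ n * d₁,
          Ideal.add_mem _ (Ideal.mul_mem_left _ _ hd') (Ideal.mul_mem_left _ _ hd₁), ?_⟩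
        linear_combination a₀ * hxd - c₁ ^ n * hyd
    refine ⟨c₀ * c₁, hmul hc₀ hc₁, fun f hf => ?_⟩
    -- Some `c₀ ^ m * a₀ ^ n * f` lies in `S`: the conductor of `f` is contained in no prime
    -- strictly inside `p`, so that locally it contains a power of `a₀`.
    obtain ⟨m, c, hmc⟩ := hu f hf
    obtain ⟨s, hs, n, hsn⟩ := exists_mul_pow_mem_of_forall_not_le (p := p)
      (J := (Ideal.span {u ^ m}).colon {c}) (u := a₀) fun Q hQ hQp ha₀Q hle => by
        obtain ⟨t, ht, d, hd⟩ := h1 Q hQ (lt_of_le_of_ne hQp fun h => ha₀Q (h ▸ ha₀)) f hf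
        refine ht (hle ?_)
        rw [Submodule.mem_colon_singleton, smul_eq_mul, Ideal.mem_span_singleton]
        refine ⟨d, hinj ?_⟩
        rw [map_mul, map_mul, ← hd, ← hmc, map_pow]
        ring
    rw [Submodule.mem_colon_singleton, smul_eq_mul, Ideal.mem_span_singleton] at hsn
    obtain ⟨b, hb⟩ := pow_mul_mem_span_pow hu0 hc₀' hs m (a₀ ^ n * c) (by rwa [← mul_assoc])
    have hbf : algebraMap S K c₀ ^ m * (algebraMap S K a₀ ^ n * f) = algebraMap S K b := by
      apply mul_left_cancel₀ (pow_ne_zero m hφ)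
      have := congrArg (algebraMap S K) hb
      simp only [map_mul, map_pow] at this
      rw [← this, ← hmc]
      ring
    obtain ⟨v, hv, w, g, hg, hvf⟩ := h2 f hf
    -- So `b` is congruent to `a₀ ^ n c₀ ^ m w` modulo `D` locally, and thus up to a power of `c₁`
    -- to some `a₀ ^ n x` globally.
    obtain ⟨x, d, ⟨h, hh, hdh⟩, hxd⟩ := hsat n v hv b (c₀ ^ m * w) (v * b - a₀ ^ n * (c₀ ^ m * w))
      ⟨algebraMap S K (c₀ ^ m * a₀ ^ n) * g, isIntegral_algebraMap.mul hg, by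
        simp only [map_sub, map_mul, map_pow, ← hbf]
        linear_combination algebraMap S K c₀ ^ m * algebraMap S K a₀ ^ n * hvf⟩ (by ring)
    set g' : K := algebraMap S K (c₁ ^ n * c₀ ^ m) * f - algebraMap S K x with hg'def
    have hg' : IsIntegral S g' := (isIntegral_algebraMap.mul hf).sub isIntegral_algebraMap
    have hag' : algebraMap S K a₀ ^ n * g' = algebraMap S K u * h := by
      have := congrArg (algebraMap S K) hxd
      simp only [map_add, map_mul, map_pow, hdh, ← hbf] at this
      rw [hg'def]
      simp only [map_mul, map_pow]
      linear_combination this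
    -- Locally at `p`, the element `g'` lies in `u C`.
    obtain ⟨v', hv', w', h', hh', hvg'⟩ := h2 g' hg'
    have hcancel : ∀ i : ℕ, ∀ b, a₀ ^ i * b ∈ integralPowIdeal K u 1 →
        ∃ s ∉ p, s * b ∈ integralPowIdeal K u 1 := by
      intro i
      induction i with
      | zero => exact fun b h => ⟨1, p.ne_top_iff_one.mp hp.ne_top, by simpa using h⟩
      | succ i ih =>
        intro b h
        obtain ⟨s, hs, hsb⟩ := hreg (a₀ ^ i * b) (by rwa [← mul_assoc, ← pow_succ'])
        obtain ⟨t, ht, htb⟩ := ih (s * b) (by rwa [mul_left_comm])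
        exact ⟨t * s, hmul ht hs, by rwa [mul_assoc]⟩
    obtain ⟨s', hs', k, hk, hsk⟩ := hcancel n w'
      ⟨algebraMap S K v' * h - algebraMap S K a₀ ^ n * h',
      (isIntegral_algebraMap.mul hh).sub ((isIntegral_algebraMap.pow n).mul hh'), by
        simp only [map_mul, map_pow]
        linear_combination algebraMap S K v' * hag' - algebraMap S K a₀ ^ n * hvg'⟩
    obtain ⟨j, y, hy⟩ := hu g' hg'
    have hint := hu.isIntegral_pow_mul hu0 hc₀' (hmul hs' hv')
      (g := g' / algebraMap S K u) (j := j + 1) (b := y) (by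
        have : algebraMap S K (s' * v') * (g' / algebraMap S K u) =
            k + algebraMap S K s' * h' := by
          apply mul_left_cancel₀ hφ
          rw [mul_left_comm, mul_div_cancel₀ _ hφ]
          rw [map_mul] at hsk ⊢
          linear_combination hsk + algebraMap S K s' * hvg'
        rw [this]
        exact hk.add (isIntegral_algebraMap.mul hh')) (by
        rw [pow_succ, mul_assoc, mul_div_cancel₀ _ hφ, hy])
    refine ⟨j + 1 + n + m, c₀ ^ (n + j + 1) * c₁ ^ (j + 1 + m) * x,
      algebraMap S K (c₀ ^ n * c₁ ^ (j + 1 + m)) *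
        (algebraMap S K c₀ ^ (j + 1) * (g' / algebraMap S K u)),
      isIntegral_algebraMap.mul hint, ?_⟩
    have hdiv : algebraMap S K u * (g' / algebraMap S K u) = g' := mul_div_cancel₀ _ hφ
    rw [hg'def] at hdiv ⊢
    simp only [map_mul, map_pow] at hdiv ⊢
    linear_combination -(algebraMap S K c₀ ^ (n + j + 1) * algebraMap S K c₁ ^ (j + 1 + m)) * hdiv

/-- If `C ⊆ S + u C` locally at a maximal ideal `q`, where `C` is the integral closure of `S` in
`K`, and the ideals `u ^ k C ∩ S` are small in the `q`-adic topology, then `C = S` locally at `q`.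
-/
lemma IsIntegralModAt.isBoundedAt_zero [IsNoetherianRing S] [FaithfulSMul S K]
    {u : S} (hu0 : u ≠ 0) (hu : IsPowerDenominator K u) {q : Ideal S} [q.IsMaximal]
    (h2 : IsIntegralModAt K u q) (hD : ∀ n : ℕ, ∃ k, integralPowIdeal K u k ≤ q ^ n) :
    IsBoundedAt K u 0 q := by
  have hinj := FaithfulSMul.algebraMap_injective S K
  have hφ : algebraMap S K u ≠ 0 := (map_ne_zero_iff _ hinj).mpr hu0
  have hq : q.IsPrime := Ideal.IsMaximal.isPrime ‹_›
  have hone : (1 : S) ∉ q := q.ne_top_iff_one.mp hq.ne_top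
  have hmul : ∀ {x y : S}, x ∉ q → y ∉ q → x * y ∉ q := fun hx hy hxy =>
    (hq.mem_or_mem hxy).elim hx hy
  -- Iterating the inclusion gives `C ⊆ S + u ^ n C` locally at `q` for all `n`.
  have steps : ∀ n : ℕ, ∀ f : K, IsIntegral S f → ∃ s ∉ q, ∃ (a : S) (h : K), IsIntegral S h ∧
      algebraMap S K s * f = algebraMap S K a + algebraMap S K u ^ n * h := by
    intro n f hf
    induction n with
    | zero => exact ⟨1, hone, 0, f, hf, by simp⟩
    | succ n ih =>
      obtain ⟨s, hs, a, h, hh, heq⟩ := ih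
      obtain ⟨t, ht, a', h', hh', heq'⟩ := h2 h hh
      refine ⟨t * s, hmul ht hs, t * a + u ^ n * a', h', hh', ?_⟩
      simp only [map_add, map_mul, map_pow]
      linear_combination algebraMap S K t * heq + algebraMap S K u ^ n * heq'
  -- If `y = u f ∈ S`, then `y ∈ u S + (u ^ (n + 1) C ∩ S)` locally for all `n`, so that `y ∈ u S`
  -- locally by the Krull intersection theorem for `S ⧸ u S`.
  have key : ∀ f : K, IsIntegral S f → ∀ y, algebraMap S K u * f = algebraMap S K y →
      ∃ s ∉ q, ∃ a, algebraMap S K s * f = algebraMap S K a := by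
    intro f hf y hy
    have hmem : ∀ n : ℕ, y ∈ Ideal.span {u} ⊔ q ^ n := by
      intro n
      obtain ⟨k, hk⟩ := hD n
      obtain ⟨s, hs, a, h, hh, heq⟩ := steps k f hf
      have h1 : s * y - u * a ∈ integralPowIdeal K u k :=
        ⟨algebraMap S K u * h, isIntegral_algebraMap.mul hh, by
          rw [map_sub, map_mul, map_mul, ← hy]
          linear_combination algebraMap S K u * heq⟩
      have h2 : s * y ∈ Ideal.span {u} ⊔ q ^ n := by
        rw [← add_sub_cancel (u * a) (s * y)]
        exact Submodule.add_mem_sup (Ideal.mul_mem_right _ _ (Ideal.mem_span_singleton_self u))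
          (hk h1)
      have h3 : IsCoprime (Ideal.span {s}) (q ^ n) := by
        refine IsCoprime.pow_right ?_
        obtain ⟨y, i, hi, hyi⟩ := Ideal.IsMaximal.exists_inv ‹_› hs
        exact Ideal.isCoprime_iff_exists.mpr
          ⟨y * s, Ideal.mul_mem_left _ _ (Ideal.mem_span_singleton_self s), i, hi, hyi⟩
      obtain ⟨i, hi, j, hj, hij⟩ := Ideal.isCoprime_iff_exists.mp h3
      obtain ⟨r, rfl⟩ := Ideal.mem_span_singleton.mp hi
      rw [← one_mul y, ← hij, add_mul, mul_right_comm, mul_comm _ r]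
      exact Ideal.add_mem _ (Ideal.mul_mem_left _ _ h2)
        (Ideal.mem_sup_right (Ideal.mul_mem_right _ _ hj))
    have h4 : Ideal.Quotient.mk (Ideal.span {u}) y ∈
        (⨅ n : ℕ, q ^ n • ⊤ : Submodule S (S ⧸ Ideal.span {u})) := by
      rw [Submodule.mem_iInf]
      intro n
      obtain ⟨a, ha, b, hb, hab⟩ := Submodule.mem_sup.mp (hmem n)
      rw [← hab, map_add, Ideal.Quotient.eq_zero_iff_mem.mpr ha, zero_add,
        show Ideal.Quotient.mk (Ideal.span {u}) b = b • (1 : S ⧸ Ideal.span {u}) by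
          rw [Algebra.smul_def, mul_one]; rfl]
      exact Submodule.smul_mem_smul hb trivial
    rw [Ideal.mem_iInf_smul_pow_eq_bot_iff] at h4
    obtain ⟨⟨r, hr⟩, hry⟩ := h4
    have h5 : y - r * y ∈ Ideal.span {u} := by
      rw [← Ideal.Quotient.eq_zero_iff_mem, map_sub, map_mul, sub_eq_zero]
      exact hry.symm
    obtain ⟨a, ha⟩ := Ideal.mem_span_singleton.mp h5
    refine ⟨1 - r, fun h => hone (by simpa using q.add_mem h hr), a, ?_⟩
    apply mul_left_cancel₀ hφ
    rw [mul_left_comm, hy, ← map_mul, ← map_mul, ← ha]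
    ring_nf
  have main : ∀ m : ℕ, ∀ f : K, IsIntegral S f →
      (∃ b, algebraMap S K u ^ m * f = algebraMap S K b) →
      ∃ s ∉ q, ∃ a, algebraMap S K s * f = algebraMap S K a := by
    intro m
    induction m with
    | zero => rintro f hf ⟨b, hb⟩; exact ⟨1, hone, b, by rw [← hb]; simp⟩
    | succ m ih =>
      rintro f hf ⟨b, hb⟩
      obtain ⟨s, hs, a, ha⟩ := key (algebraMap S K u ^ m * f)
        ((isIntegral_algebraMap.pow m).mul hf) b (by rw [← hb]; ring)
      obtain ⟨t, ht, a', ha'⟩ := ih (algebraMap S K s * f) (isIntegral_algebraMap.mul hf)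
        ⟨a, by rw [← ha]; ring⟩
      exact ⟨t * s, hmul ht hs, a', by rw [← ha', map_mul]; ring⟩
  intro f hf
  obtain ⟨m, b, hb⟩ := hu f hf
  obtain ⟨s, hs, a, ha⟩ := main m f hf ⟨b, hb⟩
  exact ⟨s, hs, a, by rw [pow_zero, one_mul, ha]⟩

end

/-! ### Finite extensions of polynomial rings -/

section
open Polynomial

/-- If `A` is dominated by a module-finite normal overring `A'` inside a field `Ω`, and the
extension becomes separable over the fractions of `A'`, then the integral closure of `A` is
module-finite. -/
lemma finite_integralClosure_of_separable {A A' k L Ω : Type u} [CommRing A] [IsNoetherianRing A]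
    [CommRing A'] [IsDomain A'] [IsIntegrallyClosed A'] [Field k] [Field L] [Field Ω]
    [Algebra A k] [Algebra A L] [Algebra k L] [IsScalarTower A k L] [Algebra L Ω]
    (φ : A →+* A') (hφ : φ.Finite) (ψ : A' →+* Ω) (hψ : Function.Injective ψ)
    (hcomp : ψ.comp φ = (algebraMap L Ω).comp (algebraMap A L))
    (hk : ∀ z : k, ∃ a b : A, algebraMap A k b ≠ 0 ∧ z * algebraMap A k b = algebraMap A k a)
    (B : Finset L) (hB : Submodule.span k (B : Set L) = ⊤)
    (hsep : ∀ β ∈ B, ∃ P : Polynomial Ω, P.Separable ∧ P.eval (algebraMap L Ω β) = 0 ∧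
      ∀ n, ∃ a b : A', ψ b ≠ 0 ∧ P.coeff n * ψ b = ψ a) :
    Module.Finite A (integralClosure A L) := by
  let _ : Algebra A A' := φ.toAlgebra
  let _ : Algebra A' Ω := ψ.toAlgebra
  let _ : Algebra A Ω := ((algebraMap L Ω).comp (algebraMap A L)).toAlgebra
  have t1 : IsScalarTower A A' Ω := IsScalarTower.of_algebraMap_eq' hcomp.symm
  have t2 : IsScalarTower A L Ω := IsScalarTower.of_algebraMap_eq' rfl
  have hfin : Module.Finite A A' := hφ
  have hN : IsNoetherianRing A' := IsNoetherianRing.of_finite A A'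
  have hf : FaithfulSMul A' Ω := (faithfulSMul_iff_algebraMap_injective _ _).mpr hψ
  let k' := FractionRing A'
  let _ : Algebra k' Ω := FractionRing.liftAlgebra A' Ω
  have hrange : ∀ z : Ω, (∃ a b : A', ψ b ≠ 0 ∧ z * ψ b = ψ a) →
      z ∈ (algebraMap k' Ω).range := by
    rintro z ⟨a, b, hb, hab⟩
    refine ⟨algebraMap A' k' a / algebraMap A' k' b, ?_⟩
    rw [map_div₀, ← IsScalarTower.algebraMap_apply, ← IsScalarTower.algebraMap_apply]
    exact (div_eq_iff hb).mpr hab.symm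
  let L' : IntermediateField k' Ω :=
    IntermediateField.adjoin k' (algebraMap L Ω '' (B : Set L))
  have hsep' : ∀ x ∈ algebraMap L Ω '' (B : Set L), IsIntegral k' x ∧ IsSeparable k' x := by
    rintro _ ⟨β, hβ, rfl⟩
    obtain ⟨P, hP, hPβ, hPc⟩ := hsep β hβ
    have hlift : P ∈ Polynomial.lifts (algebraMap k' Ω) := by
      rw [Polynomial.lifts_iff_coeff_lifts]
      intro n
      exact hrange _ (hPc n)
    obtain ⟨Q, hQ⟩ := Polynomial.mem_lifts _ |>.mp hlift
    have hQs : Q.Separable := by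
      rw [← hQ, Polynomial.separable_map] at hP
      exact hP
    have hQβ : aeval (algebraMap L Ω β) Q = 0 := by
      rw [aeval_def, ← eval_map, hQ, hPβ]
    exact ⟨IsAlgebraic.isIntegral ⟨Q, hQs.ne_zero, hQβ⟩, hQs.of_dvd (minpoly.dvd _ _ hQβ)⟩
  have : FiniteDimensional k' L' := by
    have : Finite (algebraMap L Ω '' (B : Set L)) := B.finite_toSet.image _
    exact IntermediateField.finiteDimensional_adjoin fun x hx => (hsep' x hx).1
  have : Algebra.IsSeparable k' L' :=
    (IntermediateField.isSeparable_adjoin_iff_isSeparable _ _).mpr fun x hx => (hsep' x hx).2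
  have hL' : ∀ x : L, algebraMap L Ω x ∈ L' := by
    intro x
    have hx : x ∈ Submodule.span k (B : Set L) := hB ▸ Submodule.mem_top
    refine Submodule.span_induction (p := fun x _ => algebraMap L Ω x ∈ L')
      (fun x hx => IntermediateField.subset_adjoin _ _ ⟨x, hx, rfl⟩)
      (by rw [map_zero]; exact zero_mem _)
      (fun x y _ _ hx hy => by rw [map_add]; exact add_mem hx hy) (fun z x _ hx => ?_) hx
    rw [Algebra.smul_def, map_mul]
    refine mul_mem ?_ hx
    obtain ⟨a, b, hb, hab⟩ := hk z
    obtain ⟨z', hz'⟩ := hrange (algebraMap L Ω (algebraMap k L z)) ⟨φ a, φ b, by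
      have h1 : ψ (φ b) = algebraMap L Ω (algebraMap k L (algebraMap A k b)) := by
        rw [← IsScalarTower.algebraMap_apply A k L]
        exact RingHom.congr_fun hcomp b
      rw [h1]
      simpa using hb, by
      have h1 : ∀ b, ψ (φ b) = algebraMap L Ω (algebraMap k L (algebraMap A k b)) := by
        intro b
        rw [← IsScalarTower.algebraMap_apply A k L]
        exact RingHom.congr_fun hcomp b
      rw [h1, h1, ← map_mul, ← map_mul, hab]⟩
    rw [← hz']
    exact L'.algebraMap_mem z'
  have hC : Module.Finite A' (integralClosure A' L') :=
    IsIntegralClosure.finite A' k' L' (integralClosure A' L')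
  have : IsScalarTower A' L' Ω := IsScalarTower.of_algebraMap_eq fun x => rfl
  let g : integralClosure A' L' →ₗ[A'] Ω :=
    ((IsScalarTower.toAlgHom A' L' Ω).toLinearMap).comp (integralClosure A' L').val.toLinearMap
  have hN' : ((LinearMap.range g).restrictScalars A).FG :=
    Submodule.FG.restrictScalars (Module.Finite.iff_fg.mp inferInstance)
  let j : L →ₗ[A] Ω := (IsScalarTower.toAlgHom A L Ω).toLinearMap
  refine finite_integralClosure_of_le (((LinearMap.range g).restrictScalars A).comap j)
    (Submodule.fg_of_fg_map_injective j (algebraMap L Ω).injective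
      (hN'.of_le (Submodule.map_comap_le _ _))) fun x hx => ?_
  rw [Submodule.mem_comap, Submodule.restrictScalars_mem]
  have hx1 : IsIntegral A (algebraMap L Ω x) := hx.algebraMap
  have hx2 : IsIntegral A' (algebraMap L Ω x) := hx1.tower_top
  have hx3 : IsIntegral A' (⟨algebraMap L Ω x, hL' x⟩ : L') :=
    (isIntegral_algHom_iff (IsScalarTower.toAlgHom A' L' Ω) Subtype.val_injective).mp hx2
  exact ⟨⟨_, hx3⟩, rfl⟩

/-- The integral closure of a polynomial ring over a Nagata domain in a finite extension of its
fraction field is module-finite. Enough `p`-power roots of the variable and of elements of `R` make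
the extension separable. -/
theorem HasFiniteIntegralClosures.finite_integralClosure_polynomial {R : Type u} [CommRing R]
    [IsDomain R] (hR : HasFiniteIntegralClosures R) (k L : Type u) [Field k] [Field L]
    [Algebra R[X] k] [Algebra R[X] L] [Algebra k L] [IsScalarTower R[X] k L]
    (hinj : Function.Injective (algebraMap R[X] k))
    (hk : ∀ z : k, ∃ a b : R[X], algebraMap R[X] k b ≠ 0 ∧
      z * algebraMap R[X] k b = algebraMap R[X] k a)
    (hfin : FiniteDimensional k L) : Module.Finite R[X] (integralClosure R[X] L) := by
  classical
  have := hR.1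
  let Ω := AlgebraicClosure L
  let ι : R[X] →+* Ω := (algebraMap L Ω).comp (algebraMap R[X] L)
  have hι : ∀ x, ι x = algebraMap k Ω (algebraMap R[X] k x) := fun x => by
    change algebraMap L Ω (algebraMap R[X] L x) = _
    rw [IsScalarTower.algebraMap_apply R[X] k L, ← IsScalarTower.algebraMap_apply k L Ω]
  have hιinj : Function.Injective ι := fun x y hxy => by
    rw [hι, hι] at hxy
    exact hinj ((algebraMap k Ω).injective hxy)
  let p := ringExpChar k
  have : ExpChar k p := inferInstance
  have : ExpChar Ω p := expChar_of_injective_algebraMap (algebraMap k Ω).injective p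
  have hp0 : 0 < p := expChar_pos k p
  obtain ⟨B, hB⟩ := hfin.fg_top
  have : Algebra.IsAlgebraic k Ω := Algebra.IsAlgebraic.trans k L Ω
  -- The extension becomes separable over the perfect closure `E` of `k`; only finitely many
  -- elements `Γ` of `E` are involved, the coefficients of the minimal polynomials of a basis.
  let E := perfectClosure k Ω
  have hint : ∀ β : L, IsIntegral E (algebraMap L Ω β) := fun β =>
    (Algebra.IsIntegral.isIntegral (R := k) _).tower_top
  let Γ : Finset Ω := B.biUnion fun β =>
    (minpoly E (algebraMap L Ω β)).coeffs.image (algebraMap E Ω)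
  have hΓ : ∀ γ ∈ Γ, ∃ n : ℕ, γ ^ p ^ n ∈ (algebraMap k Ω).range := by
    intro γ hγ
    obtain ⟨β, -, hβ⟩ := Finset.mem_biUnion.mp hγ
    obtain ⟨e, -, rfl⟩ := Finset.mem_image.mp hβ
    exact (mem_perfectClosure_iff_pow_mem p).mp e.2
  choose! ν hν using hΓ
  let n := Γ.sup ν
  -- The `q`-th powers of the elements of `Γ` are fractions `f γ / g γ` of polynomials over `R`.
  let q := p ^ n
  have hq0 : 0 < q := pow_pos hp0 n
  have hΓ : ∀ γ ∈ Γ, ∃ f g : R[X], ι g ≠ 0 ∧ γ ^ q * ι g = ι f := by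
    intro γ hγ
    obtain ⟨z, hz⟩ := hν γ hγ
    obtain ⟨a, b, hb, hab⟩ := hk (z ^ p ^ (n - ν γ))
    refine ⟨a, b, by rw [hι]; simpa using hb, ?_⟩
    rw [hι, hι, ← hab, map_mul, map_pow, hz, ← pow_mul, ← pow_add,
      Nat.add_sub_cancel' (Finset.le_sup hγ)]
  choose! f g hg hfg using hΓ
  -- Adjoin the `q`-th roots of all coefficients of these polynomials to the fraction field of `R`,
  -- and a `q`-th root `ξ` of `X`; let `R'` be the normalization of `R` in the extension of
  -- constants.
  let Z : Finset R := Γ.biUnion fun γ => (f γ).coeffs ∪ (g γ).coeffs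
  have hroot : ∀ y : Ω, ∃ x, x ^ q = y := fun y => IsAlgClosed.exists_pow_nat_eq y hq0
  choose ρ hρ using hroot
  let _ : Algebra R Ω := (ι.comp C).toAlgebra
  have hRΩ : ∀ r, algebraMap R Ω r = ι (C r) := fun r => rfl
  have hf1 : FaithfulSMul R Ω := (faithfulSMul_iff_algebraMap_injective _ _).mpr
    (hιinj.comp C_injective)
  let K₀ := FractionRing R
  let _ : Algebra K₀ Ω := FractionRing.liftAlgebra R Ω
  let L₀ : IntermediateField K₀ Ω :=
    IntermediateField.adjoin K₀ ((fun r => ρ (algebraMap R Ω r)) '' (Z : Set R))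
  have hfin0 : FiniteDimensional K₀ L₀ := by
    have : Finite ((fun r => ρ (algebraMap R Ω r)) '' (Z : Set R)) := Z.finite_toSet.image _
    refine IntermediateField.finiteDimensional_adjoin ?_
    rintro _ ⟨r, -, rfl⟩
    refine IsIntegral.of_pow hq0 ?_
    rw [hρ, IsScalarTower.algebraMap_apply R K₀ Ω]
    exact isIntegral_algebraMap
  let R' := integralClosure R L₀
  have hR' : Module.Finite R R' := hR.2 K₀ L₀ (IsFractionRing.exists_mul_algebraMap_eq R K₀) hfin0
  have : IsIntegrallyClosed R' := integralClosure.isIntegrallyClosedOfFiniteExtension K₀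
  let η : R' →+* Ω := (algebraMap L₀ Ω).comp (algebraMap R' L₀)
  have hη : Function.Injective η := (algebraMap L₀ Ω).injective.comp Subtype.val_injective
  have hηR : ∀ r, η (algebraMap R R' r) = ι (C r) := fun r => by
    rw [← hRΩ]; rfl
  let ξ : Ω := ρ (ι X)
  have hξ : ξ ^ q = ι X := hρ _
  let ψ : R'[X] →+* Ω := eval₂RingHom η ξ
  let φ : R[X] →+* R'[X] := eval₂RingHom (C.comp (algebraMap R R')) (X ^ q)
  have hcomp : ψ.comp φ = ι := by
    refine Polynomial.ringHom_ext (fun r => ?_) ?_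
    · simp [φ, ψ, hηR]
    · simp [φ, ψ, hξ]
  have hξt : Transcendental L₀ ξ := by
    intro h
    have : Algebra.IsAlgebraic R K₀ := IsLocalization.isAlgebraic K₀ (nonZeroDivisors R)
    have : IsScalarTower R L₀ Ω := IsScalarTower.of_algebraMap_eq fun x => rfl
    have : Algebra.IsAlgebraic R L₀ := Algebra.IsAlgebraic.trans R K₀ L₀
    have h1 : IsAlgebraic R (ι X) := by
      rw [← hξ]
      exact (h.pow q).restrictScalars R
    obtain ⟨P, hP, hPX⟩ := h1
    refine hP (hιinj ?_)
    rw [map_zero, ← hPX, aeval_def]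
    conv_lhs => rw [← Polynomial.eval₂_C_X (p := P), Polynomial.hom_eval₂]
    rfl
  have hψ : Function.Injective ψ := by
    rw [injective_iff_map_eq_zero]
    intro P hP
    by_contra hP0
    refine hξt ⟨P.map (algebraMap R' L₀), ?_, ?_⟩
    · rwa [Ne, Polynomial.map_eq_zero_iff Subtype.val_injective]
    · rw [aeval_def, eval₂_map]
      exact hP
  -- The map `φ` sends `X` to `X ^ q`, and `ψ` sends the new variable to `ξ`.
  have hφ : φ.Finite := by
    refine RingHom.IsIntegral.to_finite ?_ ?_
    · intro z
      induction z using Polynomial.induction_on with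
      | C a =>
        obtain ⟨P, hP, hPa⟩ := a.2
        refine ⟨P.map C, hP.map _, ?_⟩
        have h1 : eval₂ (algebraMap R R') a P = 0 := by
          apply Subtype.val_injective
          change (integralClosure R L₀).val.toRingHom _ = 0
          rw [Polynomial.hom_eval₂]
          exact hPa
        have h2 : φ.comp C = (C : R' →+* R'[X]).comp (algebraMap R R') := by
          ext r; simp [φ]
        rw [eval₂_map, h2, ← Polynomial.hom_eval₂, h1, map_zero]
      | add x y hx hy => exact hx.add φ hy
      | monomial m a h =>
        rw [pow_succ, ← mul_assoc]
        refine h.mul φ ?_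
        refine ⟨X ^ q - C X, monic_X_pow_sub_C _ hq0.ne', ?_⟩
        simp [φ]
    · refine RingHom.FiniteType.of_comp_finiteType (f := C) ?_
      have : φ.comp C = (C : R' →+* R'[X]).comp (algebraMap R R') := by
        ext r; simp [φ]
      rw [this]
      refine RingHom.FiniteType.comp ?_ ?_
      · exact (RingHom.finiteType_algebraMap (A := R') (B := R'[X])).mpr inferInstance
      · exact RingHom.Finite.finiteType hR'
  refine finite_integralClosure_of_separable φ hφ ψ hψ hcomp hk B hB fun β hβ => ?_
  refine ⟨(minpoly E (algebraMap L Ω β)).map (algebraMap E Ω), ?_, ?_, fun m => ?_⟩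
  · refine Polynomial.Separable.map ?_
    exact PerfectField.separable_of_irreducible (minpoly.irreducible (hint β))
  · rw [eval_map, ← aeval_def, minpoly.aeval]
  · by_cases hm : (minpoly E (algebraMap L Ω β)).coeff m = 0
    · exact ⟨0, 1, by simp, by simp [hm]⟩
    rw [coeff_map]
    set γ := algebraMap E Ω ((minpoly E (algebraMap L Ω β)).coeff m)
    have hγ : γ ∈ Γ := Finset.mem_biUnion.mpr ⟨β, hβ, Finset.mem_image_of_mem _
      (Polynomial.coeff_mem_coeffs hm)⟩
    -- By additivity of the Frobenius, polynomials with coefficients in `Z` are `q`-th powers in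
    -- `R'[X]`; thus `γ` is a fraction of elements of `R'[X]`.
    have hlift : ∀ h : R[X], h.coeffs ⊆ Z → ∃ H : R'[X], ψ H ^ q = ι h := by
      intro h hh
      have hmem : ∀ r ∈ Z, ∃ r' : R', η r' ^ q = ι (C r) := by
        intro r hr
        have h1 : ρ (algebraMap R Ω r) ∈ L₀ := IntermediateField.subset_adjoin _ _ ⟨r, hr, rfl⟩
        refine ⟨⟨⟨_, h1⟩, ?_⟩, hρ _⟩
        refine IsIntegral.of_pow hq0 ?_
        have : (⟨_, h1⟩ : L₀) ^ q = algebraMap R L₀ r := Subtype.ext (hρ _)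
        rw [this]
        exact isIntegral_algebraMap
      choose! τ hτ using hmem
      refine ⟨∑ i ∈ h.support, C (τ (h.coeff i)) * X ^ i, ?_⟩
      rw [map_sum, sum_pow_char_pow p n]
      conv_rhs => rw [h.as_sum_support_C_mul_X_pow, map_sum]
      refine Finset.sum_congr rfl fun i hi => ?_
      rw [map_mul, mul_pow, map_pow, map_mul, map_pow, ← hξ]
      simp only [ψ, coe_eval₂RingHom, eval₂_C, eval₂_X]
      rw [← hτ _ (hh (Polynomial.coeff_mem_coeffs (mem_support_iff.mp hi))), ← pow_mul, ← pow_mul,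
        mul_comm i]
    obtain ⟨F, hF⟩ := hlift (f γ) fun r hr =>
      Finset.mem_biUnion.mpr ⟨γ, hγ, Finset.mem_union_left _ hr⟩
    obtain ⟨G, hG⟩ := hlift (g γ) fun r hr =>
      Finset.mem_biUnion.mpr ⟨γ, hγ, Finset.mem_union_right _ hr⟩
    refine ⟨F, G, fun h0 => hg γ hγ ?_, ?_⟩
    · rw [← hG, h0, zero_pow hq0.ne']
    · apply iterateFrobenius_inj Ω p n
      rw [iterateFrobenius_def, iterateFrobenius_def]
      change (γ * ψ G) ^ q = ψ F ^ q
      rw [mul_pow, hG, hfg γ hγ, hF]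

end

/-! ### Completions of simple birational extensions of normal Nagata domains -/

section
open TensorProduct

/-- Reducedness of `A ⊗ F` passes to `B ⊗ F` when `B` is an extension of `A` multiplied into `A` by
a nonzerodivisor. -/
lemma isReduced_tensor_of_mul_mem {T A B F : Type*} [CommRing T] [CommRing A] [CommRing B]
    [Algebra T A] [Algebra T B] [CommRing F] [Algebra T F] [Module.Flat T F] [IsReduced (A ⊗[T] F)]
    (f : A →ₐ[T] B) (hf : Function.Injective f) (μ : B →ₗ[T] A) (hμ : Function.Injective μ)
    (t : T) (hμf : ∀ b, f (μ b) = t • b) : IsReduced (B ⊗[T] F) := by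
  constructor
  intro z hz
  have h1 : Function.Injective (μ.rTensor F) :=
    Module.Flat.rTensor_preserves_injective_linearMap (M := F) μ hμ
  have h2 : Function.Injective (Algebra.TensorProduct.map f (AlgHom.id T F)) :=
    Module.Flat.rTensor_preserves_injective_linearMap (M := F) f.toLinearMap hf
  have h3 : ∀ z : B ⊗[T] F,
      Algebra.TensorProduct.map f (AlgHom.id T F) (μ.rTensor F z) = t • z := by
    intro z
    induction z with
    | zero => simp
    | add x y hx hy => rw [map_add, map_add, hx, hy, smul_add]
    | tmul b c =>
      rw [LinearMap.rTensor_tmul, Algebra.TensorProduct.map_tmul, hμf, TensorProduct.smul_tmul']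
      rfl
  have h4 : IsNilpotent (μ.rTensor F z) := by
    obtain ⟨n, hn⟩ := hz
    refine ⟨n, h2 ?_⟩
    rw [map_pow, h3, map_zero, smul_pow, hn, smul_zero]
  exact h1 ((IsReduced.eq_zero _ h4).trans (map_zero _).symm)

/-- In a domain, the associated primes of `y` containing `x` are associated primes of `x`. -/
lemma mem_associatedPrimes_span_singleton_of_mem {S : Type*} [CommRing S] [IsDomain S]
    [IsNoetherianRing S] {x y : S} (hx : x ≠ 0) (hy : y ≠ 0) {P : Ideal S}
    (hP : P ∈ associatedPrimes S (S ⧸ Ideal.span {y})) (hxP : x ∈ P) :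
    P ∈ associatedPrimes S (S ⧸ Ideal.span {x}) := by
  rw [mem_associatedPrimes_quotient_iff] at hP ⊢
  obtain ⟨hPp, z, hz⟩ := hP
  obtain ⟨z', hz'⟩ := Ideal.mem_span_singleton.mp ((hz x).mp hxP)
  refine ⟨hPp, z', fun r => ?_⟩
  rw [hz, Ideal.mem_span_singleton, Ideal.mem_span_singleton]
  refine exists_congr fun a => ⟨fun h => mul_left_cancel₀ hy ?_, fun h => mul_left_cancel₀ hx ?_⟩
  · linear_combination x * h - r * hz'
  · linear_combination y * h + r * hz'

variable {R₁ S₁ K₁ : Type*} [CommRing R₁] [CommRing S₁] [Field K₁] [Algebra R₁ S₁] [Algebra S₁ K₁]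
  [Algebra R₁ K₁] [IsScalarTower R₁ S₁ K₁]

/-- Elements of `S₁ = R₁[x]` are congruent to elements of `R₁` modulo `x`. -/
lemma exists_eq_algebraMap_add_mul {x : S₁} (hx : Algebra.adjoin R₁ {x} = ⊤) (σ : S₁) :
    ∃ (r : R₁) (Q : Polynomial R₁), σ = algebraMap R₁ S₁ r + x * Polynomial.aeval x Q := by
  have hσ : σ ∈ Algebra.adjoin R₁ {x} := hx ▸ Algebra.mem_top
  rw [Algebra.adjoin_singleton_eq_range_aeval] at hσ
  obtain ⟨Q, rfl⟩ := hσ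
  refine ⟨Q.coeff 0, Q.divX, ?_⟩
  conv_lhs => rw [← Q.divX_mul_X_add]
  change Polynomial.aeval x _ = _
  rw [map_add, map_mul, Polynomial.aeval_X, Polynomial.aeval_C]
  ring

/-- If `ρ = x Q(x)` with `ρ` in the ground ring, then `v = Q(x)` is integral: with `n = deg Q`,
multiplying `v = Σ qᵢ xⁱ` by `vⁿ` gives `vⁿ⁺¹ = Σ qᵢ ρⁱ vⁿ⁻ⁱ`. -/
lemma isIntegral_aeval_of_mul_eq {x : S₁} {Q : Polynomial R₁} {ρ : R₁}
    (h : algebraMap R₁ S₁ ρ = x * Polynomial.aeval x Q) :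
    IsIntegral R₁ (Polynomial.aeval x Q) := by
  nontriviality R₁
  set v := Polynomial.aeval x Q with hv
  let n := Q.natDegree
  let W : Polynomial R₁ := ∑ i ∈ Finset.range (n + 1),
    Polynomial.C (Q.coeff i * ρ ^ i) * Polynomial.X ^ (n - i)
  have hW : W.degree < (n + 1 : ℕ) := by
    refine lt_of_le_of_lt (Polynomial.degree_sum_le _ _) ?_
    rw [Finset.sup_lt_iff (WithBot.bot_lt_coe _)]
    intro i _
    refine lt_of_le_of_lt (Polynomial.degree_C_mul_X_pow_le _ _) ?_
    exact_mod_cast lt_of_le_of_lt (Nat.sub_le n i) (Nat.lt_succ_self n)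
  refine ⟨Polynomial.X ^ (n + 1) - W, Polynomial.monic_X_pow_sub hW, ?_⟩
  rw [Polynomial.eval₂_sub, Polynomial.eval₂_X_pow, Polynomial.eval₂_finsetSum, sub_eq_zero]
  have h1 : v ^ (n + 1) = v ^ n * ∑ i ∈ Finset.range (n + 1),
      algebraMap R₁ S₁ (Q.coeff i) * x ^ i := by
    rw [pow_succ]
    congr 1
    rw [hv, Polynomial.aeval_eq_sum_range]
    simp only [Algebra.smul_def]
    rfl
  rw [h1, Finset.mul_sum]
  refine Finset.sum_congr rfl fun i hi => ?_
  rw [Polynomial.eval₂_mul, Polynomial.eval₂_C, Polynomial.eval₂_X_pow, map_mul, map_pow, h,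
    mul_pow]
  have : v ^ n = v ^ i * v ^ (n - i) := by
    rw [← pow_add, Nat.add_sub_cancel' (Nat.lt_succ_iff.mp (Finset.mem_range.mp hi))]
  rw [this]
  ring

/-- An associated prime of the generator `x` of `S₁ = R₁[x]`, with `R₁` normal, is locally
principal: it lies over a prime `p` of the form `{r | r z / x ∈ R₁}` with `z ∈ R₁`, which is locally
principal by normality, and `S₁` and `R₁` agree locally at `p`. -/
lemma exists_uniformizer_of_mem_associatedPrimes [IsNoetherianRing R₁] [IsDomain R₁]
    [IsIntegrallyClosed R₁] [IsNoetherianRing S₁] [IsFractionRing R₁ K₁]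
    [FaithfulSMul S₁ K₁] {x : S₁} (hx : Algebra.adjoin R₁ {x} = ⊤) (hx0 : x ≠ 0)
    {P : Ideal S₁} (hxP : x ∈ P) (hP : P ∈ associatedPrimes S₁ (S₁ ⧸ Ideal.span {x})) :
    ∃ π ∈ P, ∃ t ∉ P, ∀ f ∈ P, ∃ a, t * f = π * a := by
  have hinj := FaithfulSMul.algebraMap_injective S₁ K₁
  have hφx : algebraMap S₁ K₁ x ≠ 0 := (map_ne_zero_iff _ hinj).mpr hx0
  have hinjR : Function.Injective (algebraMap R₁ K₁) := IsFractionRing.injective R₁ K₁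
  have hRS : Function.Injective (algebraMap R₁ S₁) := fun a b hab => hinjR (by
    rw [IsScalarTower.algebraMap_apply R₁ S₁ K₁, hab, ← IsScalarTower.algebraMap_apply])
  have : IsDomain S₁ := hinj.isDomain
  obtain ⟨hPp, z', hz'⟩ := mem_associatedPrimes_quotient_iff.mp hP
  obtain ⟨z, Qz, rfl⟩ := exists_eq_algebraMap_add_mul hx z'
  have hz : ∀ r, r ∈ P ↔ r * algebraMap R₁ S₁ z ∈ Ideal.span {x} := by
    intro r
    rw [hz', mul_add, Ideal.add_mem_iff_left]
    rw [mul_left_comm]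
    exact Ideal.mul_mem_right _ _ (Ideal.mem_span_singleton_self x)
  -- By normality, an element of `R₁` that is divisible by `x` in `S₁` has its quotient in `R₁`.
  have hnorm : ∀ ρ : R₁, algebraMap R₁ S₁ ρ ∈ Ideal.span {x} ↔
      ∃ v : R₁, algebraMap R₁ S₁ ρ = x * algebraMap R₁ S₁ v := by
    intro ρ
    constructor
    · intro h
      obtain ⟨σ, hσ⟩ := Ideal.mem_span_singleton.mp h
      have hσ' : σ ∈ Algebra.adjoin R₁ {x} := hx ▸ Algebra.mem_top
      rw [Algebra.adjoin_singleton_eq_range_aeval] at hσ'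
      obtain ⟨Q, rfl⟩ := hσ'
      have h1 : IsIntegral R₁ (algebraMap S₁ K₁ (Polynomial.aeval x Q)) :=
        (isIntegral_aeval_of_mul_eq hσ).algebraMap
      obtain ⟨v, hv⟩ := IsIntegrallyClosed.isIntegral_iff.mp h1
      refine ⟨v, ?_⟩
      rw [hσ]
      congr 1
      apply hinj
      change algebraMap S₁ K₁ (Polynomial.aeval x Q) = _
      rw [← hv, ← IsScalarTower.algebraMap_apply]
    · rintro ⟨v, hv⟩
      exact Ideal.mem_span_singleton.mpr ⟨_, hv⟩
  set p := P.comap (algebraMap R₁ S₁) with hp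
  have hpp : p.IsPrime := Ideal.comap_isPrime _ _
  have hpw : ∀ r, r ∈ p ↔ ∃ a, algebraMap R₁ K₁ a =
      algebraMap R₁ K₁ r * (algebraMap R₁ K₁ z / algebraMap S₁ K₁ x) := by
    intro r
    rw [hp, Ideal.mem_comap, hz, ← map_mul, hnorm]
    refine exists_congr fun v => ?_
    rw [← mul_div_assoc, eq_div_iff hφx, ← hinj.eq_iff]
    simp only [map_mul, ← IsScalarTower.algebraMap_apply]
    rw [eq_comm, mul_comm (algebraMap S₁ K₁ x)]
  obtain ⟨d, hdp, hd0⟩ : ∃ d ∈ p, d ≠ 0 := by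
    obtain ⟨c, d, hd, hcd⟩ := IsFractionRing.div_surjective (A := R₁)
      (algebraMap R₁ K₁ z / algebraMap S₁ K₁ x)
    have hd0 := nonZeroDivisors.ne_zero hd
    exact ⟨d, (hpw d).mpr ⟨c, by
      rw [← hcd, mul_div_cancel₀ _ ((map_ne_zero_iff _ hinjR).mpr hd0)]⟩, hd0⟩
  obtain ⟨π, hπ, t, ht, htπ⟩ := IsIntegrallyClosed.exists_uniformizer (K := K₁) hpp.ne_top
    (fun hbot => hd0 (by rwa [hbot] at hdp)) hpw
  have hπ0 : algebraMap R₁ S₁ π ≠ 0 := by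
    rw [Ne, map_eq_zero_iff _ hRS]
    rintro rfl
    obtain ⟨a, ha⟩ := htπ d hdp
    rw [zero_mul, mul_eq_zero, or_iff_left hd0] at ha
    exact ht (ha ▸ zero_mem p)
  -- Write `π z = x v`. Then `v ∉ p`, as otherwise `π` would cancel and put `t` into `p`; so `v`
  -- makes `x` a multiple of `π` locally.
  obtain ⟨v, hv⟩ := (hnorm _).mp (by rw [map_mul]; exact (hz _).mp hπ)
  have hvp : v ∉ p := by
    intro hvp
    obtain ⟨a, ha⟩ := htπ v hvp
    refine ht ((hz _).mpr (Ideal.mem_span_singleton.mpr ⟨algebraMap R₁ S₁ a, ?_⟩))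
    apply mul_left_cancel₀ hπ0
    have ha' := congrArg (algebraMap R₁ S₁) ha
    simp only [map_mul] at ha' hv ⊢
    linear_combination algebraMap R₁ S₁ t * hv + x * ha'
  refine ⟨algebraMap R₁ S₁ π, hπ, algebraMap R₁ S₁ (t * v), fun h =>
    (hpp.mem_or_mem h).elim ht hvp, fun f hf => ?_⟩
  obtain ⟨r, Q, rfl⟩ := exists_eq_algebraMap_add_mul hx f
  have hr : r ∈ p := (Ideal.add_mem_iff_left P (P.mul_mem_right _ hxP)).mp hf
  obtain ⟨a, ha⟩ := htπ r hr
  refine ⟨algebraMap R₁ S₁ (v * a) + algebraMap R₁ S₁ (t * z) * Polynomial.aeval x Q, ?_⟩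
  have ha' := congrArg (algebraMap R₁ S₁) ha
  simp only [map_mul] at ha' hv ⊢
  linear_combination algebraMap R₁ S₁ v * ha' -
    algebraMap R₁ S₁ t * Polynomial.aeval x Q * hv

end

section
open TensorProduct

/-- Completions of `S₁ = R₁[x]`, with `R₁` a normal Nagata domain, are reduced if a product of
elements `x - α` lies in the ideal. Each associated prime `P` of the product contains some `x - α`,
so that it is locally principal, and `S₁ ⧸ P` is a quotient of `R₁`. -/
lemma isReduced_tensor_of_prod_sub {S R₁ S₁ K₁ : Type u} [CommRing S] [IsNoetherianRing S]
    [CommRing R₁] [CommRing S₁]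
    [Field K₁] [Algebra R₁ S₁] [Algebra S₁ K₁] [Algebra R₁ K₁] [IsScalarTower R₁ S₁ K₁]
    [IsDomain R₁] [IsIntegrallyClosed R₁] [IsFractionRing R₁ K₁] [FaithfulSMul S₁ K₁]
    [Algebra S S₁] [Module.Finite S S₁] (hR₁ : HasFiniteIntegralClosures R₁) (q : Ideal S) {x : S₁}
    (hx : Algebra.adjoin R₁ {x} = ⊤) {y : S} (hyq : y ∈ q) (hy0 : algebraMap S S₁ y ≠ 0)
    (m : Multiset R₁) (hm : algebraMap S S₁ y = (m.map fun α => x - algebraMap R₁ S₁ α).prod) :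
    IsReduced (S₁ ⊗[S] AdicCompletion q S) := by
  have := hR₁.1
  have : IsNoetherianRing S₁ := IsNoetherianRing.of_finite S S₁
  have : IsDomain S₁ := (FaithfulSMul.algebraMap_injective S₁ K₁).isDomain
  refine isReduced_of_flat_of_associatedPrimes (A := S₁) hy0 (fun z hz => ?_) fun P hP => ?_
  · refine AdicCompletion.algebraMap_tensor_separated q hyq z fun n => ?_
    rw [IsScalarTower.algebraMap_apply S S₁]
    exact hz n
  have hPp : P.IsPrime := hP.isPrime
  have hyP : algebraMap S S₁ y ∈ P :=
    associatedPrimes_quotient_le hP (Ideal.mem_span_singleton_self _)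
  obtain ⟨α, hα, hxα⟩ : ∃ α ∈ m, x - algebraMap R₁ S₁ α ∈ P := by
    rw [hm] at hyP
    obtain ⟨b, hb, hbP⟩ := (Ideal.IsPrime.multiset_prod_mem_iff_exists_mem hPp _).mp hyP
    obtain ⟨α, hα, rfl⟩ := Multiset.mem_map.mp hb
    exact ⟨α, hα, hbP⟩
  have hx' : Algebra.adjoin R₁ {x - algebraMap R₁ S₁ α} = ⊤ := by
    rw [eq_top_iff, ← hx, Algebra.adjoin_le_iff, Set.singleton_subset_iff]
    have h := add_mem (Algebra.self_mem_adjoin_singleton R₁ (x - algebraMap R₁ S₁ α))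
      (Subalgebra.algebraMap_mem _ α)
    rwa [sub_add_cancel] at h
  have hxα0 : x - algebraMap R₁ S₁ α ≠ 0 := by
    intro h0
    apply hy0
    rw [hm]
    exact Multiset.prod_eq_zero (Multiset.mem_map.mpr ⟨α, hα, h0⟩)
  constructor
  · exact exists_uniformizer_of_mem_associatedPrimes (K₁ := K₁) hx' hxα0 hxα
      (mem_associatedPrimes_span_singleton_of_mem hxα0 hy0 hP hxα)
  · intro z hz
    have hq : HasFiniteIntegralClosures (S₁ ⧸ P) := by
      refine hR₁.of_surjective ((Ideal.Quotient.mk P).comp (algebraMap R₁ S₁)) fun b => ?_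
      obtain ⟨σ, rfl⟩ := Ideal.Quotient.mk_surjective b
      obtain ⟨r, Q, rfl⟩ := exists_eq_algebraMap_add_mul hx' σ
      refine ⟨r, ?_⟩
      rw [RingHom.comp_apply, map_add, map_mul, Ideal.Quotient.eq_zero_iff_mem.mpr hxα, zero_mul,
        add_zero]
    have hfin : Module.Finite S (S₁ ⧸ P) := Module.Finite.trans S₁ _
    have hr := hq.isReduced_tensor_adicCompletion q (S₁ ⧸ P)
    exact mem_map_of_isNilpotent_of_isReduced_quotient P hz

/-- Completions of a simple birational extension `S = R[x]` of a normal Nagata domain `R` are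
reduced. The value `h(x)` of a monic polynomial factors after a finite extension of `R`. -/
lemma isReduced_tensor_of_monic {R S K : Type u} [CommRing R] [IsDomain R] [IsIntegrallyClosed R]
    [CommRing S] [IsNoetherianRing S] [Field K] [Algebra R S] [Algebra S K] [Algebra R K]
    [IsScalarTower R S K] [IsFractionRing R K] [FaithfulSMul S K] (hR : HasFiniteIntegralClosures R)
    {x : S} (hx : Algebra.adjoin R {x} = ⊤) (q : Ideal S) {h : Polynomial R} (hh : h.Monic)
    (hxq : Polynomial.aeval x h ∈ q) (hx0 : Polynomial.aeval x h ≠ 0) :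
    IsReduced (S ⊗[S] AdicCompletion q S) := by
  have := hR.1
  -- Let `h` split in `K₁`, and put `S₁ = R₁[x]`, a finite extension of `S`, with `R₁` the
  -- normalization of `R` in `K₁`.
  let K₁ := (h.map (algebraMap R K)).SplittingField
  have t3 : IsScalarTower R S K₁ := IsScalarTower.of_algebraMap_eq fun r => by
    rw [IsScalarTower.algebraMap_apply R K K₁, IsScalarTower.algebraMap_apply S K K₁,
      ← IsScalarTower.algebraMap_apply R S K]
  have hfin : FiniteDimensional K K₁ := inferInstance
  let R₁ := integralClosure R K₁
  have hR₁fin : Module.Finite R R₁ := hR.2 K K₁ (IsFractionRing.exists_mul_algebraMap_eq R K) hfin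
  have hR₁ : HasFiniteIntegralClosures R₁ := hR.of_finite
  have : IsIntegrallyClosed R₁ := integralClosure.isIntegrallyClosedOfFiniteExtension K
  have : IsFractionRing R₁ K₁ := integralClosure.isFractionRing_of_finite_extension K K₁
  let S₁ : Subalgebra R₁ K₁ := Algebra.adjoin R₁ {algebraMap S K₁ x}
  have hxS₁ : algebraMap S K₁ x ∈ S₁ := Algebra.self_mem_adjoin_singleton R₁ _
  have hSS₁ : ∀ s : S, algebraMap S K₁ s ∈ S₁ := by
    intro s
    have hs : s ∈ Algebra.adjoin R {x} := hx ▸ Algebra.mem_top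
    refine Algebra.adjoin_induction (p := fun s _ => algebraMap S K₁ s ∈ S₁) ?_ ?_ ?_ ?_ hs
    · rintro _ rfl
      exact hxS₁
    · intro r
      rw [← IsScalarTower.algebraMap_apply]
      exact S₁.algebraMap_mem (algebraMap R R₁ r)
    · intro a b _ _ ha hb
      rw [map_add]
      exact add_mem ha hb
    · intro a b _ _ ha hb
      rw [map_mul]
      exact mul_mem ha hb
  let _ : Algebra S S₁ := ((algebraMap S K₁).codRestrict S₁ hSS₁).toAlgebra
  have t4 : IsScalarTower S S₁ K₁ := IsScalarTower.of_algebraMap_eq fun _ => rfl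
  have t5 : IsScalarTower R S S₁ := IsScalarTower.of_algebraMap_eq fun r => Subtype.ext (by
    change algebraMap R K₁ r = algebraMap S K₁ (algebraMap R S r)
    rw [← IsScalarTower.algebraMap_apply])
  have hft : Algebra.FiniteType S S₁ := by
    have : Algebra.FiniteType R₁ S₁ := (Subalgebra.fg_iff_finiteType S₁).mp
      (by simpa using Subalgebra.fg_adjoin_finset (R := R₁) ({algebraMap S K₁ x} : Finset K₁))
    have : Algebra.FiniteType R S₁ := Algebra.FiniteType.trans (S := R₁) inferInstance this
    exact Algebra.FiniteType.of_restrictScalars_finiteType R S S₁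
  have hint : Algebra.IsIntegral S S₁ := by
    constructor
    rintro ⟨s, hs⟩
    rw [← isIntegral_algHom_iff (IsScalarTower.toAlgHom S S₁ K₁) Subtype.val_injective]
    change IsIntegral S s
    refine Algebra.adjoin_induction (p := fun s _ => IsIntegral S s) ?_ ?_ ?_ ?_ hs
    · rintro _ rfl
      exact isIntegral_algebraMap
    · intro r
      exact IsIntegral.tower_top (R := R) r.2
    · exact fun a b _ _ ha hb => ha.add hb
    · exact fun a b _ _ ha hb => ha.mul hb
  have hfinS : Module.Finite S S₁ := Algebra.IsIntegral.finite
  have hSinj : Function.Injective (algebraMap S S₁) := by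
    have h1 : Function.Injective (algebraMap S K₁) :=
      (algebraMap K K₁).injective.comp (FaithfulSMul.algebraMap_injective S K)
    exact fun a b hab => h1 (congrArg Subtype.val hab)
  have hroot : ∀ α ∈ (h.map (algebraMap R K₁)).roots, IsIntegral R α := by
    intro α hα
    refine ⟨h, hh, ?_⟩
    rw [← Polynomial.eval_map]
    exact (Polynomial.mem_roots'.mp hα).2
  have hsplit : (h.map (algebraMap R K₁)).Splits := by
    have := Polynomial.SplittingField.splits (h.map (algebraMap R K))
    rwa [Polynomial.map_map, ← IsScalarTower.algebraMap_eq R K K₁] at this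
  have hred : IsReduced (S₁ ⊗[S] AdicCompletion q S) := by
    refine isReduced_tensor_of_prod_sub (K₁ := K₁) hR₁ q (x := ⟨_, hxS₁⟩) ?_ hxq
      ((map_ne_zero_iff _ hSinj).mpr hx0)
      ((h.map (algebraMap R K₁)).roots.attach.map fun α => (⟨α.1, hroot α.1 α.2⟩ : R₁)) ?_
    · rw [← Algebra.adjoin_adjoin_coe_preimage (R := R₁) (s := {algebraMap S K₁ x})]
      congr 1
      ext s
      exact Subtype.ext_iff
    · apply Subtype.val_injective
      change algebraMap S K₁ (Polynomial.aeval x h) = S₁.val _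
      rw [map_multiset_prod, Multiset.map_map, Multiset.map_map]
      change _ = (Multiset.map (fun α : {a // a ∈ (h.map (algebraMap R K₁)).roots} =>
        algebraMap S K₁ x - α.1) _).prod
      rw [Multiset.attach_map_val' (h.map (algebraMap R K₁)).roots
        (fun α => algebraMap S K₁ x - α)]
      rw [← Polynomial.aeval_algebraMap_apply, Polynomial.aeval_def, ← Polynomial.eval_map]
      conv_lhs => rw [hsplit.eq_prod_roots_of_monic (hh.map _)]
      rw [Polynomial.eval_multiset_prod, Multiset.map_map]
      simp
  have hinj : Function.Injective (Algebra.TensorProduct.map (IsScalarTower.toAlgHom S S S₁)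
      (AlgHom.id S (AdicCompletion q S))) :=
    Module.Flat.rTensor_preserves_injective_linearMap (M := AdicCompletion q S)
      (IsScalarTower.toAlgHom S S S₁).toLinearMap hSinj
  exact isReduced_of_injective _ hinj

end

/-! ### Simple birational extensions of normal Nagata domains -/

section
open Polynomial

lemma finite_integralClosure_of_finite (R L : Type*) [CommRing R] [IsNoetherianRing R] [CommRing L]
    [Algebra R L] [Module.Finite R L] : Module.Finite R (integralClosure R L) :=
  finite_integralClosure_of_le ⊤ Module.Finite.fg_top fun _ _ => Submodule.mem_top

lemma HasFiniteIntegralClosures.of_field (κ : Type u) [Field κ] : HasFiniteIntegralClosures κ := by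
  refine ⟨inferInstance, fun k L _ _ _ _ _ _ hk hfin => ?_⟩
  have hsurj : Function.Surjective (algebraMap κ k) := by
    intro z
    obtain ⟨a, b, hb, hab⟩ := hk z
    exact ⟨a / b, by rw [map_div₀, div_eq_iff hb, hab]⟩
  have : Module.Finite κ k := Module.Finite.of_surjective (Algebra.linearMap κ k) hsurj
  have : Module.Finite κ L := Module.Finite.trans k L
  exact finite_integralClosure_of_finite κ L

lemma HasFiniteIntegralClosures.polynomial_field (κ : Type u) [Field κ] :
    HasFiniteIntegralClosures κ[X] := by
  refine ⟨inferInstance, fun k L _ _ _ _ _ _ hk hfin => ?_⟩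
  by_cases hinj : Function.Injective (algebraMap κ[X] k)
  · exact (HasFiniteIntegralClosures.of_field κ).finite_integralClosure_polynomial k L hinj hk hfin
  have hker : RingHom.ker (algebraMap κ[X] k) ≠ ⊥ := by
    rwa [Ne, ← RingHom.injective_iff_ker_eq_bot]
  have hp : (RingHom.ker (algebraMap κ[X] k)).IsPrime := RingHom.ker_isPrime _
  have hmax : (RingHom.ker (algebraMap κ[X] k)).IsMaximal := hp.isMaximal hker
  have hsurj : Function.Surjective (algebraMap κ[X] k) := by
    intro z
    obtain ⟨a, b, hb, hab⟩ := hk z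
    obtain ⟨c, i, hi, hci⟩ := hmax.exists_inv (x := b) hb
    refine ⟨a * c, ?_⟩
    have h1 := congrArg (algebraMap κ[X] k) hci
    rw [map_add, map_mul, (RingHom.mem_ker).mp hi, add_zero, map_one] at h1
    rw [map_mul, ← hab, mul_assoc, mul_comm (algebraMap κ[X] k b), h1, mul_one]
  have : Module.Finite κ[X] k := Module.Finite.of_surjective (Algebra.linearMap κ[X] k) hsurj
  have : Module.Finite κ[X] L := Module.Finite.trans k L
  exact finite_integralClosure_of_finite κ[X] L

/-- A common denominator `c` of the normalization of `A ⧸ p` will do: `w / v` is integral over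
`A ⧸ p`. -/
lemma HasFiniteIntegralClosures.hasUniformDenominatorMod {A : Type u} [CommRing A] {p : Ideal A}
    [p.IsPrime] (h : HasFiniteIntegralClosures (A ⧸ p)) : HasUniformDenominatorMod p := by
  let D := A ⧸ p
  let k := FractionRing D
  have hfin : Module.Finite D (integralClosure D k) :=
    h.2 k k (IsFractionRing.exists_mul_algebraMap_eq D k) inferInstance
  have hfg : (Subalgebra.toSubmodule (integralClosure D k)).FG := Module.Finite.iff_fg.mp hfin
  obtain ⟨d, hd, hdC⟩ := hfg.exists_smul_mem (Q := (1 : Submodule D k)) (nonZeroDivisors D) (by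
    intro z _
    obtain ⟨a, b, hb, rfl⟩ := IsFractionRing.div_surjective (A := D) z
    refine ⟨b, hb, Submodule.mem_one.mpr ⟨a, ?_⟩⟩
    have hb' : algebraMap D k b ≠ 0 :=
      (map_ne_zero_iff _ (IsFractionRing.injective D k)).mpr (nonZeroDivisors.ne_zero hb)
    rw [Algebra.smul_def, mul_div_cancel₀ _ hb'])
  obtain ⟨c, rfl⟩ := Ideal.Quotient.mk_surjective d
  refine ⟨c, fun hc => nonZeroDivisors.ne_zero hd (Ideal.Quotient.eq_zero_iff_mem.mpr hc),
    fun v hv w q hq hqw => ?_⟩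
  let θ : A →+* k := (algebraMap D k).comp (Ideal.Quotient.mk p)
  have hθ : ∀ a, θ a = 0 ↔ a ∈ p := fun a => by
    rw [← Ideal.Quotient.eq_zero_iff_mem]
    exact map_eq_zero_iff _ (IsFractionRing.injective D k)
  have hv' : θ v ≠ 0 := fun h => hv ((hθ v).mp h)
  have hint : IsIntegral D (θ w / θ v) := by
    refine ⟨q.map (Ideal.Quotient.mk p), hq.map _, ?_⟩
    rw [eval₂_map]
    have h1 : eval₂ θ (θ v * (θ w / θ v)) (q.scaleRoots v) = 0 := by
      rw [mul_div_cancel₀ _ hv', eval₂_at_apply, (hθ _).mpr hqw]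
    rw [scaleRoots_eval₂_mul] at h1
    exact (mul_eq_zero.mp h1).resolve_left (pow_ne_zero _ hv')
  obtain ⟨a, ha⟩ := Submodule.mem_one.mp (hdC _ hint)
  obtain ⟨a, rfl⟩ := Ideal.Quotient.mk_surjective a
  refine ⟨a, (hθ _).mp ?_⟩
  rw [Algebra.smul_def] at ha
  change θ a = θ c * (θ w / θ v) at ha
  rw [map_sub, map_mul, map_mul, ha, mul_left_comm, mul_div_cancel₀ _ hv', sub_self]

end

section
variable {R A : Type*} [CommRing R] [IsLocalRing R] [CommRing A] [Algebra R A]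

/-- In an algebra of finite type over a local ring, the closed fibre is a Jacobson ring, so that a
prime of the closed fibre is an intersection of maximal ideals. -/
lemma exists_isMaximal_ge_notMem [Algebra.FiniteType R A] {p : Ideal A} [p.IsPrime]
    (hp : p.comap (algebraMap R A) = IsLocalRing.maximalIdeal R) {c : A} (hc : c ∉ p) :
    ∃ q : Ideal A, q.IsMaximal ∧ p ≤ q ∧ c ∉ q := by
  have : p.LiesOver (IsLocalRing.maximalIdeal R) := ⟨hp.symm⟩
  let _ : Field (R ⧸ IsLocalRing.maximalIdeal R) := Ideal.Quotient.field _
  have : Algebra.FiniteType R (A ⧸ p) := Algebra.FiniteType.trans (S := A) ‹_› inferInstance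
  have : Algebra.FiniteType (R ⧸ IsLocalRing.maximalIdeal R) (A ⧸ p) :=
    Algebra.FiniteType.of_restrictScalars_finiteType R _ _
  have hJ : IsJacobsonRing (A ⧸ p) :=
    isJacobsonRing_of_finiteType (A := R ⧸ IsLocalRing.maximalIdeal R)
  have h1 : Ideal.jacobson (⊥ : Ideal (A ⧸ p)) = ⊥ := by
    rw [← Ideal.radical_eq_jacobson]
    exact Ideal.isRadical_bot.radical
  have h2 : Ideal.Quotient.mk p c ∉ Ideal.jacobson (⊥ : Ideal (A ⧸ p)) := by
    rw [h1, Ideal.mem_bot, Ideal.Quotient.eq_zero_iff_mem]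
    exact hc
  rw [Ideal.jacobson, Ideal.mem_sInf] at h2
  push Not at h2
  obtain ⟨Q, ⟨-, hQ⟩, hcQ⟩ := h2
  refine ⟨Q.comap (Ideal.Quotient.mk p), Ideal.comap_isMaximal_of_surjective _
    Ideal.Quotient.mk_surjective, fun x hx => ?_, hcQ⟩
  rw [Ideal.mem_comap, Ideal.Quotient.eq_zero_iff_mem.mpr hx]
  exact zero_mem _

/-- The residue field of a maximal ideal in the closed fibre is finite over that of `R`, by the
Nullstellensatz. -/
lemma exists_monic_aeval_mem [Algebra.FiniteType R A] {q : Ideal A} [q.IsMaximal]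
    (hq : q.comap (algebraMap R A) = IsLocalRing.maximalIdeal R) (x : A) :
    ∃ h : Polynomial R, h.Monic ∧ Polynomial.aeval x h ∈ q := by
  have : q.LiesOver (IsLocalRing.maximalIdeal R) := ⟨hq.symm⟩
  let _ : Field (R ⧸ IsLocalRing.maximalIdeal R) := Ideal.Quotient.field _
  let _ : Field (A ⧸ q) := Ideal.Quotient.field _
  have : Algebra.FiniteType R (A ⧸ q) := Algebra.FiniteType.trans (S := A) ‹_› inferInstance
  have : Algebra.FiniteType (R ⧸ IsLocalRing.maximalIdeal R) (A ⧸ q) :=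
    Algebra.FiniteType.of_restrictScalars_finiteType R _ _
  have : Module.Finite (R ⧸ IsLocalRing.maximalIdeal R) (A ⧸ q) :=
    finite_of_finite_type_of_isJacobsonRing _ _
  have : Module.Finite R (A ⧸ q) := Module.Finite.trans (R ⧸ IsLocalRing.maximalIdeal R) _
  obtain ⟨h, hh, hx⟩ := Algebra.IsIntegral.isIntegral (R := R) (Ideal.Quotient.mk q x)
  refine ⟨h, hh, ?_⟩
  rw [← Ideal.Quotient.eq_zero_iff_mem, ← hx, Polynomial.aeval_def, Polynomial.hom_eval₂]
  rfl

end

section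
open TensorProduct
variable {S A K : Type*} [CommRing S] [CommRing A] [Field K] [Algebra S A] [Algebra A K]
  [Algebra S K] [IsScalarTower S A K]

/-- Only finitely many primes, the associated primes of `S ⧸ u S`, matter for boundedness; so bounds
at the primes strictly inside `p` may be taken uniform. -/
lemma IsPowerDenominator.exists_forall_lt_isBoundedAt [IsNoetherianRing S] [FaithfulSMul S K]
    {u : S} (hu0 : u ≠ 0) (hu : IsPowerDenominator K u) (p : Ideal S)
    (ih : ∀ p' : Ideal S, p'.IsPrime → p' < p → ∃ k, IsBoundedAt K u k p') :
    ∃ k, ∀ p' : Ideal S, p'.IsPrime → p' < p → IsBoundedAt K u k p' := by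
  have hfin := associatedPrimes.finite S (S ⧸ Ideal.span {u})
  have ih' : ∀ P : Ideal S, ∃ k, P.IsPrime → P < p → IsBoundedAt K u k P := by
    intro P
    by_cases h : P.IsPrime ∧ P < p
    · obtain ⟨k, hk⟩ := ih P h.1 h.2
      exact ⟨k, fun _ _ => hk⟩
    · exact ⟨0, fun h1 h2 => absurd ⟨h1, h2⟩ h⟩
  choose k hk using ih'
  refine ⟨hfin.toFinset.sup k, fun p' hp' hlt f hf => ?_⟩
  obtain ⟨s, hs, a, ha⟩ := hu.exists_mul_pow_mul_mem hu0 p'.primeCompl (k := hfin.toFinset.sup k)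
    (fun P hP hdis => (hk P hP.isPrime (lt_of_le_of_lt (fun x hx => by
      by_contra hxp
      exact hdis x hxp hx) hlt)).mono (Finset.le_sup (hfin.mem_toFinset.mpr hP))) hf
  exact ⟨s, hs, a, ha⟩

/-- A finite extension of `S` inside `K` is multiplied into `S` by a single power of `u`. -/
lemma IsPowerDenominator.exists_pow_smul_mem [Module.Finite S A] {u : S}
    (hu : IsPowerDenominator K u) : ∃ e : ℕ, ∀ a : A, ∃ s : S,
      algebraMap S K u ^ e * algebraMap A K a = algebraMap S K s := by
  have hfg : (LinearMap.range (IsScalarTower.toAlgHom S A K).toLinearMap).FG :=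
    Module.Finite.iff_fg.mp inferInstance
  obtain ⟨_, ⟨e, rfl⟩, he⟩ := hfg.exists_smul_mem (Q := (1 : Submodule S K))
      (Submonoid.powers u) (by
    rintro _ ⟨a, rfl⟩
    obtain ⟨k, s, hs⟩ := hu (algebraMap A K a) (Algebra.IsIntegral.isIntegral a).algebraMap
    refine ⟨u ^ k, ⟨k, rfl⟩, Submodule.mem_one.mpr ⟨s, ?_⟩⟩
    rw [Algebra.smul_def, map_pow, ← hs]
    rfl)
  refine ⟨e, fun a => ?_⟩
  obtain ⟨s, hs⟩ := Submodule.mem_one.mp (he _ ⟨a, rfl⟩)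
  exact ⟨s, by rw [hs, Algebra.smul_def, map_pow]; rfl⟩

lemma IsPowerDenominator.of_isIntegral [Algebra.IsIntegral S A] {u : S}
    (hu : IsPowerDenominator K u) : IsPowerDenominator K (algebraMap S A u) := by
  intro f hf
  obtain ⟨k, a, ha⟩ := hu f (isIntegral_trans f hf)
  exact ⟨k, algebraMap S A a, by
    rw [← IsScalarTower.algebraMap_apply, ← IsScalarTower.algebraMap_apply, ha]⟩

/-- Boundedness at `p` may be checked at the primes over `p` of a finite extension. -/
lemma IsPowerDenominator.exists_isBoundedAt_of_liesOver [Module.Finite S A] [FaithfulSMul A K]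
    {u : S} (hu : IsPowerDenominator K u) (p : Ideal S) [p.IsPrime]
    (h : ∀ P : Ideal A, P.IsPrime → P.comap (algebraMap S A) = p →
      IsBoundedAt K (algebraMap S A u) 0 P) : ∃ k, IsBoundedAt K u k p := by
  obtain ⟨e, he⟩ := hu.exists_pow_smul_mem (A := A)
  refine ⟨e, fun f hf => ?_⟩
  let I : Ideal A := Submodule.comap (LinearMap.toSpanSingleton A K f) (1 : Submodule A K)
  have hI : ∀ a, a ∈ I ↔ ∃ a', algebraMap A K a' = algebraMap A K a * f := fun a => by
    rw [← Algebra.smul_def, ← Submodule.mem_one]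
    rfl
  have hnot : ¬ I.comap (algebraMap S A) ≤ p := by
    intro hle
    obtain ⟨P, hIP, hPp, hP⟩ := Ideal.exists_ideal_over_prime_of_isIntegral p I hle
    obtain ⟨s, hs, a, ha⟩ := h P hPp hP f hf.tower_top
    exact hs (hIP ((hI s).mpr ⟨a, by rw [← ha, pow_zero, one_mul]⟩))
  obtain ⟨s, hs, hsp⟩ := SetLike.not_le_iff_exists.mp hnot
  obtain ⟨a, ha⟩ := (hI _).mp hs
  obtain ⟨t, ht⟩ := he a
  refine ⟨s, hsp, t, ?_⟩
  rw [← ht, ha, ← IsScalarTower.algebraMap_apply]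
  ring

/-- Reducedness of the completion passes to a finite extension of `S` inside `K`, since the
extension is multiplied into `S` by a power of `u`. -/
lemma IsPowerDenominator.isReduced_tensor {F : Type*} [CommRing F] [Algebra S F] [Module.Flat S F]
    [Module.Finite S A] [FaithfulSMul A K] [FaithfulSMul S K] [IsReduced (S ⊗[S] F)] {u : S}
    (hu0 : u ≠ 0)
    (hu : IsPowerDenominator K u) : IsReduced (A ⊗[S] F) := by
  have hinj := FaithfulSMul.algebraMap_injective S K
  have hinjA := FaithfulSMul.algebraMap_injective A K
  obtain ⟨e, he⟩ := hu.exists_pow_smul_mem (A := A)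
  choose g hg using he
  have hue : algebraMap S K u ^ e ≠ 0 := pow_ne_zero _ ((map_ne_zero_iff _ hinj).mpr hu0)
  let μ : A →ₗ[S] S :=
    { toFun := g
      map_add' := fun a b => hinj (by rw [map_add, ← hg, ← hg, ← hg, map_add, mul_add])
      map_smul' := fun s a => hinj (by
        rw [← hg, RingHom.id_apply, smul_eq_mul, map_mul, ← hg, Algebra.smul_def, map_mul,
          ← IsScalarTower.algebraMap_apply]
        ring) }
  refine isReduced_tensor_of_mul_mem (A := S) (IsScalarTower.toAlgHom S S A) ?_ μ ?_ (u ^ e)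
    fun b => ?_
  · intro a b hab
    apply hinj
    rw [IsScalarTower.algebraMap_apply S A K, IsScalarTower.algebraMap_apply S A K]
    exact congrArg _ hab
  · intro a b hab
    apply hinjA
    apply mul_left_cancel₀ hue
    rw [hg, hg]
    exact congrArg _ hab
  · apply hinjA
    change algebraMap A K (algebraMap S A (g b)) = _
    rw [← IsScalarTower.algebraMap_apply, ← hg, Algebra.smul_def, map_mul,
      ← IsScalarTower.algebraMap_apply, map_pow]

end

section
open TensorProduct

/-- The inductive step for a simple birational extension `S = R[x]` of a normal local Nagata domain:
at a prime `p` over the maximal ideal, the denominators of the integral closure `C` of `S` are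
bounded if they are at all primes strictly inside `p`. One passes to a finite extension `A` of `S`
with `C ⊆ A + u C` locally and shows that `C = A` locally. -/
theorem exists_isBoundedAt_of_forall_lt {R S K : Type u} [CommRing R] [IsDomain R] [IsLocalRing R]
    [IsIntegrallyClosed R] [CommRing S] [IsNoetherianRing S] [Field K] [Algebra R S] [Algebra S K]
    [Algebra R K] [IsScalarTower R S K] [IsFractionRing R K] [FaithfulSMul S K]
    (hR : HasFiniteIntegralClosures R) {x : S} (hx : Algebra.adjoin R {x} = ⊤)
    (hxR : ∀ r, algebraMap R K r ≠ algebraMap S K x) {u : S} (hu0 : u ≠ 0)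
    (hu : IsPowerDenominator K u) (p : Ideal S) [p.IsPrime]
    (hpm : p.comap (algebraMap R S) = IsLocalRing.maximalIdeal R)
    (ih : ∀ p' : Ideal S, p'.IsPrime → p' < p → ∃ k, IsBoundedAt K u k p') :
    ∃ k, IsBoundedAt K u k p := by
  have hinj := FaithfulSMul.algebraMap_injective S K
  have : IsDomain S := hinj.isDomain
  have hφ : algebraMap S K u ≠ 0 := (map_ne_zero_iff _ hinj).mpr hu0
  have hp : p.IsPrime := ‹_›
  by_cases hup : u ∉ p
  · refine ⟨0, fun f hf => ?_⟩
    obtain ⟨k, a, ha⟩ := hu f hf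
    exact ⟨u ^ k, fun h => hup (hp.mem_of_pow_mem k h), a, by rw [← ha, map_pow]; ring⟩
  push Not at hup
  have hftS : Algebra.FiniteType R S := ⟨⟨{x}, by rw [Finset.coe_singleton, hx]⟩⟩
  obtain ⟨k₀, hk₀⟩ := hu.exists_forall_lt_isBoundedAt hu0 p ih
  obtain ⟨k₁, hk₁, hmod⟩ := hu.exists_mod_bounded hu0 (p := p) hk₀
  -- The finite extension `A` of `S` by the integral elements with denominator `u ^ k₁`.
  let F : Submodule S K := (Subalgebra.toSubmodule (integralClosure S K)) ⊓
    (1 : Submodule S K).comap (LinearMap.mulLeft S (algebraMap S K u ^ k₁))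
  have hF : ∀ g, g ∈ F ↔ IsIntegral S g ∧ ∃ a, algebraMap S K u ^ k₁ * g = algebraMap S K a := by
    intro g
    change _ ∧ LinearMap.mulLeft S (algebraMap S K u ^ k₁) g ∈ (1 : Submodule S K) ↔ _
    rw [Submodule.mem_one]
    exact and_congr Iff.rfl (exists_congr fun a => eq_comm)
  have hFfg : F.FG := by
    have h1 : (1 : Submodule S K).FG := by
      rw [Submodule.one_eq_span]
      exact Submodule.fg_span_singleton 1
    refine Submodule.fg_of_fg_map_injective (LinearMap.mulLeft S (algebraMap S K u ^ k₁))
      (fun a b hab => mul_left_cancel₀ (pow_ne_zero k₁ hφ) hab) (h1.of_le ?_)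
    rw [Submodule.map_le_iff_le_comap]
    exact inf_le_right
  obtain ⟨T, hT⟩ := hFfg
  let A := Algebra.adjoin S (T : Set K)
  have hTint : ∀ g ∈ (T : Set K), IsIntegral S g := fun g hg =>
    ((hF g).mp (hT ▸ Submodule.subset_span hg)).1
  have hAfin : Module.Finite S A :=
    Module.Finite.iff_fg.mpr (fg_adjoin_of_finite T.finite_toSet hTint)
  have hAN : IsNoetherianRing A := IsNoetherianRing.of_finite S A
  have hFA : ∀ g ∈ F, ∃ a : A, algebraMap A K a = g := by
    intro g hg
    rw [← hT] at hg
    exact ⟨⟨g, Algebra.span_le_adjoin S _ hg⟩, rfl⟩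
  have hAinj : Function.Injective (algebraMap A K) := Subtype.val_injective
  have : FaithfulSMul A K := (faithfulSMul_iff_algebraMap_injective _ _).mpr hAinj
  have huA0 : algebraMap S A u ≠ 0 := fun h => hφ (by
    rw [IsScalarTower.algebraMap_apply S A K, h, map_zero])
  have huA : IsPowerDenominator K (algebraMap S A u) := hu.of_isIntegral
  have hftA : Algebra.FiniteType R A := Algebra.FiniteType.trans hftS inferInstance
  refine hu.exists_isBoundedAt_of_liesOver (A := A) p fun P hP hPp => ?_
  have hPm : P.comap (algebraMap R A) = IsLocalRing.maximalIdeal R := by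
    rw [← hpm, ← hPp, Ideal.comap_comap, ← IsScalarTower.algebraMap_eq]
  have h1 : ∀ P' : Ideal A, P'.IsPrime → P' < P → IsBoundedAt K (algebraMap S A u) 0 P' := by
    intro P' hP' hlt f hf
    have hf' : IsIntegral S f := isIntegral_trans f hf
    have hlt' : P'.comap (algebraMap S A) < p := hPp ▸ Ideal.IsIntegral.comap_lt_comap hlt
    obtain ⟨s, hs, a, ha⟩ := hk₀ _ (Ideal.comap_isPrime _ _) hlt' f hf'
    obtain ⟨b, hb⟩ := hFA (algebraMap S K s * f) ((hF _).mpr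
      ⟨isIntegral_algebraMap.mul hf', u ^ (k₁ - k₀) * a, by
        rw [map_mul, ← ha, map_pow, ← Nat.sub_add_cancel hk₁, pow_add, Nat.add_sub_cancel]; ring⟩)
    exact ⟨algebraMap S A s, hs, b, by
      rw [pow_zero, one_mul, hb, ← IsScalarTower.algebraMap_apply]⟩
  have h2 : IsIntegralModAt K (algebraMap S A u) P := by
    intro f hf
    obtain ⟨s, hs, g, h, hg, hh, hga, hfg⟩ := hmod f (isIntegral_trans f hf)
    obtain ⟨b, hb⟩ := hFA g ((hF g).mpr ⟨hg, hga⟩)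
    refine ⟨algebraMap S A s, fun hs' => hs (hPp ▸ hs'), b, h, hh.tower_top, ?_⟩
    rw [hb, ← IsScalarTower.algebraMap_apply, ← IsScalarTower.algebraMap_apply, hfg]
  -- At a maximal ideal of `A` over that of `R` the completion is reduced.
  have hmax : ∀ Q : Ideal A, Q.IsMaximal → P ≤ Q → IsIntegralModAt K (algebraMap S A u) Q →
      IsBoundedAt K (algebraMap S A u) 0 Q := by
    intro Q hQ hPQ h2Q
    refine h2Q.isBoundedAt_zero huA0 huA fun n => ?_
    set q := Q.comap (algebraMap S A) with hq
    have hqmax : q.IsMaximal := Ideal.isMaximal_comap_of_isIntegral_of_isMaximal Q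
    have hpq : p ≤ q := hPp ▸ Ideal.comap_mono hPQ
    have hqm : q.comap (algebraMap R S) = IsLocalRing.maximalIdeal R :=
      ((IsLocalRing.maximalIdeal.isMaximal R).eq_of_le
        (Ideal.IsPrime.ne_top (Ideal.comap_isPrime _ _))
        (hpm ▸ Ideal.comap_mono hpq)).symm
    obtain ⟨h, hh, hhq⟩ := exists_monic_aeval_mem hqm x
    have hred : IsReduced (S ⊗[S] AdicCompletion q S) := by
      refine isReduced_tensor_of_monic (K := K) hR hx q hh hhq fun h0 => ?_
      have hint : IsIntegral R (algebraMap S K x) := by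
        refine IsIntegral.algebraMap ⟨h, hh, ?_⟩
        rwa [← Polynomial.aeval_def]
      obtain ⟨r, hr⟩ := IsIntegrallyClosed.isIntegral_iff.mp hint
      exact hxR r hr
    have hredA : IsReduced (A ⊗[S] AdicCompletion q S) := hu.isReduced_tensor (K := K) hu0
    obtain ⟨k, hk⟩ := exists_integralPowIdeal_le_pow (A := A) q hAinj (v := u) (hpq hup) huA0 n
    exact ⟨k, hk.trans (Ideal.pow_right_mono Ideal.map_comap_le n)⟩
  by_cases hPmax : P.IsMaximal
  · exact hmax P hPmax le_rfl h2
  have hupA : algebraMap S A u ∈ P := by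
    rw [← hPp] at hup
    exact hup
  -- Otherwise, since `S ⧸ p` is a quotient of the polynomial ring over the residue field of `R`,
  -- the inclusion `C ⊆ A + u C` extends from `P` to some maximal ideal `Q` containing `P`.
  have h3 : HasUniformDenominatorMod P := by
    have : p.LiesOver (IsLocalRing.maximalIdeal R) := ⟨hpm.symm⟩
    have : P.LiesOver p := ⟨hPp.symm⟩
    let _ : Field (R ⧸ IsLocalRing.maximalIdeal R) := Ideal.Quotient.field _
    have hSp : HasFiniteIntegralClosures (S ⧸ p) := by
      refine (HasFiniteIntegralClosures.polynomial_field
        (R ⧸ IsLocalRing.maximalIdeal R)).of_surjective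
        (Polynomial.aeval (Ideal.Quotient.mk p x)).toRingHom fun b => ?_
      obtain ⟨σ, rfl⟩ := Ideal.Quotient.mk_surjective b
      have hσ : σ ∈ Algebra.adjoin R {x} := hx ▸ Algebra.mem_top
      rw [Algebra.adjoin_singleton_eq_range_aeval] at hσ
      obtain ⟨Q, rfl⟩ := hσ
      refine ⟨Q.map (Ideal.Quotient.mk _), ?_⟩
      change Polynomial.aeval _ (Q.map (algebraMap R (R ⧸ IsLocalRing.maximalIdeal R))) =
        Ideal.Quotient.mk p (Polynomial.aeval x Q)
      rw [Polynomial.aeval_map_algebraMap]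
      exact Polynomial.aeval_algebraMap_apply (S ⧸ p) x Q
    have : Module.Finite S (A ⧸ P) := Module.Finite.trans A _
    have : Module.Finite (S ⧸ p) (A ⧸ P) := Module.Finite.of_restrictScalars_finite S _ _
    have hAP : HasFiniteIntegralClosures (A ⧸ P) := hSp.of_finite
    exact hAP.hasUniformDenominatorMod
  obtain ⟨c, hc, hcf⟩ := huA.exists_pow_mul_mod huA0 hupA h1 h2 h3
  obtain ⟨Q, hQ, hPQ, hcQ⟩ := exists_isMaximal_ge_notMem hPm hc
  have hQb := hmax Q hQ hPQ fun f hf => by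
    obtain ⟨m, a, h, hh, heq⟩ := hcf f hf
    exact ⟨c ^ m, fun h => hcQ (hQ.isPrime.mem_of_pow_mem m h), a, h, hh, by rw [map_pow, heq]⟩
  intro f hf
  obtain ⟨s, hs, a, ha⟩ := hQb f hf
  exact ⟨s, fun h => hs (hPQ h), a, ha⟩

end

section
variable {S S' K : Type*} [CommRing S] [CommRing S'] [Field K] [Algebra S S'] [Algebra S' K]
  [Algebra S K] [IsScalarTower S S' K]

lemma IsBoundedAt.of_isLocalization (N : Submonoid S) [IsLocalization N S'] [FaithfulSMul S' K]
    {u : S} {k : ℕ} {Q : Ideal S'} [Q.IsPrime]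
    (h : IsBoundedAt K (algebraMap S S' u) k Q) :
    IsBoundedAt K u k (Q.comap (algebraMap S S')) := by
  have hinj := FaithfulSMul.algebraMap_injective S' K
  intro f hf
  obtain ⟨s', hs', a', ha⟩ := h f hf.tower_top
  obtain ⟨⟨s, t⟩, hs⟩ := IsLocalization.surj N s'
  obtain ⟨⟨a, r⟩, har⟩ := IsLocalization.surj N a'
  have hunit : ∀ t : N, algebraMap S S' t ∉ Q := fun t ht =>
    (‹Q.IsPrime›).ne_top (Ideal.eq_top_of_isUnit_mem _ ht (IsLocalization.map_units S' t))
  refine ⟨s * r, ?_, a * t, ?_⟩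
  · rw [Ideal.mem_comap, map_mul, ← hs]
    exact fun hmem => ((‹Q.IsPrime›).mem_or_mem hmem).elim
      (fun h => ((‹Q.IsPrime›).mem_or_mem h).elim hs' (hunit t)) (hunit r)
  · have h1 := congrArg (algebraMap S' K) hs
    have h2 := congrArg (algebraMap S' K) har
    simp only [map_mul, ← IsScalarTower.algebraMap_apply] at h1 h2 ha ⊢
    linear_combination (-(algebraMap S K r * algebraMap S K u ^ k * f)) * h1 +
      algebraMap S K r * algebraMap S K t * ha + algebraMap S K t * h2

lemma IsBoundedAt.isLocalization (N : Submonoid S) [IsLocalization N S'] {u : S} {k : ℕ}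
    {Q : Ideal S'} [Q.IsPrime] (h : IsBoundedAt K u k (Q.comap (algebraMap S S'))) :
    IsBoundedAt K (algebraMap S S' u) k Q := by
  intro f hf
  obtain ⟨t, ht⟩ := IsIntegral.exists_multiple_integral_of_isLocalization N f hf
  obtain ⟨s, hs, a, ha⟩ := h _ ht
  refine ⟨algebraMap S S' (s * t), fun hmem => ?_, algebraMap S S' a, ?_⟩
  · rw [map_mul] at hmem
    exact ((‹Q.IsPrime›).mem_or_mem hmem).elim hs fun h => (‹Q.IsPrime›).ne_top
      (Ideal.eq_top_of_isUnit_mem _ h (IsLocalization.map_units S' t))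
  · rw [← IsScalarTower.algebraMap_apply, ← IsScalarTower.algebraMap_apply,
      ← IsScalarTower.algebraMap_apply, ← ha, map_mul, Submonoid.smul_def, Algebra.smul_def]
    ring

lemma IsPowerDenominator.isLocalization (N : Submonoid S) [IsLocalization N S']
    [FaithfulSMul S' K] {u : S}
    (hu : IsPowerDenominator K u) : IsPowerDenominator K (algebraMap S S' u) := by
  intro f hf
  obtain ⟨t, ht⟩ := IsIntegral.exists_multiple_integral_of_isLocalization N f hf
  obtain ⟨k, a, ha⟩ := hu _ ht
  obtain ⟨t', ht'⟩ := (IsLocalization.map_units S' t).exists_right_inv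
  refine ⟨k, algebraMap S S' a * t', ?_⟩
  rw [map_mul, ← IsScalarTower.algebraMap_apply, ← IsScalarTower.algebraMap_apply, ← ha,
    Submonoid.smul_def, Algebra.smul_def]
  have h1 := congrArg (algebraMap S' K) ht'
  rw [map_mul, map_one, ← IsScalarTower.algebraMap_apply] at h1
  linear_combination (-(algebraMap S K u ^ k * f)) * h1

end

section
variable {R S K : Type*} [CommRing R] [IsIntegrallyClosed R] [CommRing S] [Field K]
  [Algebra R S] [Algebra S K] [Algebra R K] [IsScalarTower R S K] [IsFractionRing R K]

/-- If `R` is normal and `x = a / b`, then `R[x] ⊆ R[1 / b]`, which is normal; so every element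
integral over `R[x]` has a power of `b` as a denominator. -/
lemma isPowerDenominator_of_adjoin_singleton {x : S} (hx : Algebra.adjoin R {x} = ⊤) {a b : R}
    (hb : b ≠ 0) (hab : algebraMap S K x * algebraMap R K b = algebraMap R K a) :
    IsPowerDenominator K (algebraMap R S b) := by
  have hinj := IsFractionRing.injective R K
  have hb0 : algebraMap R K b ≠ 0 := (map_ne_zero_iff _ hinj).mpr hb
  let g : Localization.Away b →+* K := IsLocalization.Away.lift b hb0.isUnit
  let _ : Algebra (Localization.Away b) K := g.toAlgebra
  have t1 : IsScalarTower R (Localization.Away b) K :=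
    IsScalarTower.of_algebraMap_eq fun r => (IsLocalization.Away.lift_eq b hb0.isUnit r).symm
  let C := integralClosure (Localization.Away b) K
  have hS : ∀ s : S, algebraMap S K s ∈ C := by
    intro s
    have hs : s ∈ Algebra.adjoin R {x} := hx ▸ Algebra.mem_top
    induction hs using Algebra.adjoin_induction with
    | mem y hy =>
      rw [Set.mem_singleton_iff.mp hy]
      have : algebraMap S K x = algebraMap (Localization.Away b) K
          (IsLocalization.mk' _ a ⟨b, Submonoid.mem_powers b⟩) := by
        have h1 := congrArg (algebraMap (Localization.Away b) K)
          (IsLocalization.mk'_spec (Localization.Away b) a ⟨b, Submonoid.mem_powers b⟩)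
        rw [map_mul, ← IsScalarTower.algebraMap_apply, ← IsScalarTower.algebraMap_apply,
          ← hab] at h1
        exact (mul_right_cancel₀ hb0 h1).symm
      rw [this]
      exact C.algebraMap_mem _
    | algebraMap r =>
      rw [← IsScalarTower.algebraMap_apply, IsScalarTower.algebraMap_apply R (Localization.Away b)]
      exact C.algebraMap_mem _
    | add y z _ _ hy hz => rw [map_add]; exact C.add_mem hy hz
    | mul y z _ _ hy hz => rw [map_mul]; exact C.mul_mem hy hz
  intro f hf
  have hfC : IsIntegral C f :=
    hf.map_of_comp_eq ((algebraMap S K).codRestrict C hS) (RingHom.id K) rfl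
  have hfb : IsIntegral (Localization.Away b) f := isIntegral_trans f hfC
  obtain ⟨⟨m, k, rfl⟩, hm⟩ :=
    IsIntegral.exists_multiple_integral_of_isLocalization (Submonoid.powers b) f hfb
  obtain ⟨r, hr⟩ := IsIntegrallyClosed.isIntegral_iff.mp hm
  refine ⟨k, algebraMap R S r, ?_⟩
  rw [← IsScalarTower.algebraMap_apply R S K, ← IsScalarTower.algebraMap_apply R S K, hr,
    Submonoid.smul_def, Algebra.smul_def, map_pow]

end

/-- The integral closure of a simple birational extension of a normal Nagata domain is finite. -/
theorem finite_integralClosure_of_adjoin_singleton {R S K : Type u} [CommRing R] [IsDomain R]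
    [IsIntegrallyClosed R] [CommRing S] [Field K] [Algebra R S] [Algebra S K] [Algebra R K]
    [IsScalarTower R S K] [IsFractionRing R K] [FaithfulSMul S K]
    (hR : HasFiniteIntegralClosures R) {x : S} (hx : Algebra.adjoin R {x} = ⊤) :
    Module.Finite S (integralClosure S K) := by
  have hinj := FaithfulSMul.algebraMap_injective S K
  have : IsDomain S := hinj.isDomain
  have hRN := hR.1
  have hftS : Algebra.FiniteType R S := ⟨⟨{x}, by rw [Finset.coe_singleton, hx]⟩⟩
  have hSN : IsNoetherianRing S := Algebra.FiniteType.isNoetherianRing R S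
  obtain ⟨a, b, hb, hab⟩ := IsFractionRing.div_surjective (A := R) (algebraMap S K x)
  have hb0 : b ≠ 0 := nonZeroDivisors.ne_zero hb
  have hbK : algebraMap R K b ≠ 0 := (map_ne_zero_iff _ (IsFractionRing.injective R K)).mpr hb0
  have hu : IsPowerDenominator K (algebraMap R S b) :=
    isPowerDenominator_of_adjoin_singleton hx hb0 (a := a) (by rw [← hab]; field_simp)
  set u := algebraMap R S b with hub
  have huK : algebraMap S K u ≠ 0 := by rwa [hub, ← IsScalarTower.algebraMap_apply]
  have hu0 : u ≠ 0 := fun h => huK (by rw [h, map_zero])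
  -- Induction on the height of `p`, after localizing `R` and `S` at the contraction `m` of `p` to
  -- `R`.
  have key : ∀ (n : ℕ∞) (p : Ideal S) [p.IsPrime], p.height = n → ∃ k, IsBoundedAt K u k p := by
    intro n
    induction n using WellFoundedLT.induction with
    | ind n ih =>
    intro p hp hpn
    let m := p.comap (algebraMap R S)
    have hm : m.IsPrime := Ideal.comap_isPrime _ _
    let M := Algebra.algebraMapSubmonoid S m.primeCompl
    let R' := Localization.AtPrime m
    let S' := Localization M
    have hRSi : Function.Injective (algebraMap R S) := fun y z h =>
      IsFractionRing.injective R K (by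
        rw [IsScalarTower.algebraMap_apply R S K, h, ← IsScalarTower.algebraMap_apply])
    have hM : M ≤ nonZeroDivisors S := by
      rintro _ ⟨y, hy, rfl⟩
      exact mem_nonZeroDivisors_of_ne_zero fun h => hy (by
        rw [(map_eq_zero_iff _ hRSi).mp h]; exact m.zero_mem)
    have hMu : ∀ y : M, IsUnit (algebraMap S K y) := fun y =>
      ((map_ne_zero_iff _ hinj).mpr (nonZeroDivisors.ne_zero (hM y.2))).isUnit
    let g : S' →+* K := IsLocalization.lift hMu
    let _ : Algebra S' K := g.toAlgebra
    have t1 : IsScalarTower S S' K :=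
      IsScalarTower.of_algebraMap_eq fun s => (IsLocalization.lift_eq hMu s).symm
    let _ : Algebra R' K := (g.comp (algebraMap R' S')).toAlgebra
    have t2 : IsScalarTower R' S' K := IsScalarTower.of_algebraMap_eq fun _ => rfl
    have t3 : IsScalarTower R S' K := IsScalarTower.of_algebraMap_eq fun r => by
      rw [IsScalarTower.algebraMap_apply R S S', ← IsScalarTower.algebraMap_apply S S' K,
        ← IsScalarTower.algebraMap_apply]
    have t4 : IsScalarTower R R' K := IsScalarTower.of_algebraMap_eq fun r => by
      rw [IsScalarTower.algebraMap_apply R' S' K, ← IsScalarTower.algebraMap_apply R R' S',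
        ← IsScalarTower.algebraMap_apply]
    have hfr : IsFractionRing R' K :=
      IsFractionRing.isFractionRing_of_isDomain_of_isLocalization m.primeCompl R' K
    have hnorm : IsIntegrallyClosed R' := isIntegrallyClosed_of_isLocalization R' m.primeCompl
      (Ideal.primeCompl_le_nonZeroDivisors m)
    have hS'N : IsNoetherianRing S' := IsLocalization.isNoetherianRing M S' hSN
    have hS'd : IsDomain S' := IsLocalization.isDomain_localization hM
    have hS'K : FaithfulSMul S' K := by
      rw [faithfulSMul_iff_algebraMap_injective]
      exact (IsLocalization.lift_injective_iff hMu).mpr fun y z =>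
        ⟨fun h => congrArg _ (IsLocalization.injective S' hM h), fun h => congrArg _ (hinj h)⟩
    have hx' : Algebra.adjoin R' {algebraMap S S' x} = ⊤ := by
      have hmem : ∀ s : S, algebraMap S S' s ∈ Algebra.adjoin R' {algebraMap S S' x} := by
        intro s
        have hs : s ∈ Algebra.adjoin R {x} := hx ▸ Algebra.mem_top
        induction hs using Algebra.adjoin_induction with
        | mem y hy =>
          rw [Set.mem_singleton_iff.mp hy]
          exact Algebra.subset_adjoin rfl
        | algebraMap r =>
          rw [← IsScalarTower.algebraMap_apply, IsScalarTower.algebraMap_apply R R' S']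
          exact Subalgebra.algebraMap_mem _ _
        | add y z _ _ hy hz => rw [map_add]; exact Subalgebra.add_mem _ hy hz
        | mul y z _ _ hy hz => rw [map_mul]; exact Subalgebra.mul_mem _ hy hz
      rw [eq_top_iff]
      rintro y -
      obtain ⟨⟨s, ⟨_, t, ht, rfl⟩⟩, hst⟩ := IsLocalization.surj M y
      obtain ⟨t', ht'⟩ := (IsLocalization.map_units R' (⟨t, ht⟩ : m.primeCompl)).exists_right_inv
      have h1 := congrArg (algebraMap R' S') ht'
      rw [map_mul, map_one, ← IsScalarTower.algebraMap_apply] at h1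
      have h2 : y = algebraMap S S' s * algebraMap R' S' t' := by
        rw [← hst, ← IsScalarTower.algebraMap_apply, mul_assoc, h1, mul_one]
      rw [h2]
      exact Subalgebra.mul_mem _ (hmem s) (Subalgebra.algebraMap_mem _ _)
    have hdisj : Disjoint (M : Set S) (p : Set S) := by
      rw [Set.disjoint_left]
      rintro _ ⟨y, hy, rfl⟩ h
      exact hy h
    let Q := p.map (algebraMap S S')
    have hQ : Q.IsPrime := IsLocalization.isPrime_of_isPrime_disjoint M S' p hp hdisj
    have hQp : Q.comap (algebraMap S S') = p :=
      IsLocalization.under_map_of_isPrime_disjoint M S' hp hdisj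
    suffices h : ∃ k, IsBoundedAt K (algebraMap S S' u) k Q by
      obtain ⟨k, hk⟩ := h
      exact ⟨k, hQp ▸ hk.of_isLocalization M⟩
    -- If `x` lies in `R_m`, then the localization of `S` is `R_m`, which is normal.
    by_cases hxR : ∃ r, algebraMap R' K r = algebraMap S' K (algebraMap S S' x)
    · obtain ⟨r, hr⟩ := hxR
      have hxr : algebraMap S S' x = algebraMap R' S' r := by
        refine FaithfulSMul.algebraMap_injective S' K ?_
        rw [← hr, IsScalarTower.algebraMap_apply R' S' K]
      have hsurj : ∀ y : S', ∃ r, algebraMap R' S' r = y := by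
        intro y
        have hy : y ∈ Algebra.adjoin R' {algebraMap S S' x} := hx' ▸ Algebra.mem_top
        rw [hxr] at hy
        have hle : Algebra.adjoin R' {algebraMap R' S' r} ≤ ⊥ :=
          Algebra.adjoin_le (Set.singleton_subset_iff.mpr (Subalgebra.algebraMap_mem _ r))
        exact Algebra.mem_bot.mp (hle hy)
      have hint : Algebra.IsIntegral R' S' := ⟨fun y => by
        obtain ⟨r, rfl⟩ := hsurj y
        exact isIntegral_algebraMap⟩
      refine ⟨0, fun f hf => ?_⟩
      obtain ⟨w, hw⟩ := IsIntegrallyClosed.isIntegral_iff.mp (isIntegral_trans (R := R') f hf)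
      refine ⟨1, fun h => hQ.ne_top ((Ideal.eq_top_iff_one _).mpr h), algebraMap R' S' w, ?_⟩
      rw [map_one, one_mul, pow_zero, one_mul, ← hw, ← IsScalarTower.algebraMap_apply]
    push Not at hxR
    refine exists_isBoundedAt_of_forall_lt (hR.of_isLocalization m.primeCompl) hx' hxR
      (fun h => hu0 (IsLocalization.injective S' hM (by rw [h, map_zero])))
      (hu.isLocalization M) Q ?_ fun Q' hQ' hlt => ?_
    · refine le_antisymm (IsLocalRing.le_maximalIdeal
        (Ideal.IsPrime.ne_top (Ideal.comap_isPrime _ _))) ?_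
      rw [← Localization.AtPrime.map_eq_maximalIdeal, Ideal.map_le_iff_le_comap,
        Ideal.comap_comap, ← IsScalarTower.algebraMap_eq, IsScalarTower.algebraMap_eq R S S',
        ← Ideal.comap_comap]
      exact Ideal.comap_mono hQp.ge
    · have hlt' : Q'.comap (algebraMap S S') < p := by
        rw [← hQp]
        exact (IsLocalization.orderEmbedding M S').lt_iff_lt.mpr hlt
      have hQ'p : (Q'.comap (algebraMap S S')).IsPrime := Ideal.comap_isPrime _ _
      obtain ⟨k, hk⟩ := ih _ (hpn ▸ Ideal.height_strict_mono_of_isPrime hlt') _ rfl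
      exact ⟨k, hk.isLocalization M⟩
  -- Only the finitely many associated primes of `S ⧸ (u)` matter.
  have hfinA := associatedPrimes.finite S (S ⧸ Ideal.span {u})
  have hk : ∃ k, ∀ P ∈ associatedPrimes S (S ⧸ Ideal.span {u}), IsBoundedAt K u k P := by
    have h1 : ∀ P : Ideal S, ∃ k, P ∈ associatedPrimes S (S ⧸ Ideal.span {u}) →
        IsBoundedAt K u k P := by
      intro P
      by_cases hP : P ∈ associatedPrimes S (S ⧸ Ideal.span {u})
      · have : P.IsPrime := hP.1
        obtain ⟨k, hk⟩ := key _ P rfl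
        exact ⟨k, fun _ => hk⟩
      · exact ⟨0, fun h => absurd h hP⟩
    choose κ hκ using h1
    exact ⟨hfinA.toFinset.sup κ, fun P hP =>
      (hκ P hP).mono (Finset.le_sup (hfinA.mem_toFinset.mpr hP))⟩
  obtain ⟨k, hk⟩ := hk
  -- A bound at all associated primes is a bound everywhere, so that `u ^ k C ⊆ S`.
  refine finite_integralClosure_of_le
    (Submodule.span S {(algebraMap S K u ^ k)⁻¹}) (Submodule.fg_span_singleton _) fun f hf => ?_
  obtain ⟨s, rfl, a, ha⟩ := hu.exists_mul_pow_mul_mem hu0 (k := k) ⊥ (fun P hP _ => hk P hP) hf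
  rw [map_one, one_mul] at ha
  rw [Submodule.mem_span_singleton]
  refine ⟨a, ?_⟩
  rw [Algebra.smul_def, ← ha]
  field_simp

/-! ### Finitely generated algebras over Nagata rings -/

section
open Polynomial

/-- The finiteness of integral closures for a simple extension `P` of a Nagata domain `R`, in a
finite extension of the fraction field of `R`. -/
lemma HasFiniteIntegralClosures.finite_integralClosure_of_adjoin_singleton {R P : Type u}
    [CommRing R] [IsDomain R] [CommRing P] [IsNoetherianRing P] (hR : HasFiniteIntegralClosures R)
    (K L : Type u) [Field K] [Field L] [Algebra R P] [Algebra R K] [IsFractionRing R K]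
    [Algebra R L] [Algebra K L] [Algebra P L] [IsScalarTower R K L] [IsScalarTower R P L] {x : P}
    (hx : Algebra.adjoin R {x} = ⊤) (hKL : FiniteDimensional K L) :
    Module.Finite P (integralClosure P L) := by
  -- The normalization `R₁` of `R` in `L` is a normal Nagata domain with fraction field `L`.
  let R₁ := integralClosure R L
  have hR₁f : Module.Finite R R₁ := hR.2 K L (IsFractionRing.exists_mul_algebraMap_eq R K) hKL
  have hR₁ : HasFiniteIntegralClosures R₁ := hR.of_finite
  have : IsIntegrallyClosed R₁ := integralClosure.isIntegrallyClosedOfFiniteExtension K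
  have : IsFractionRing R₁ L := integralClosure.isFractionRing_of_finite_extension K L
  obtain ⟨G, hG⟩ := (Module.Finite.iff_fg (N := Subalgebra.toSubmodule R₁)).mp hR₁f
  have hRR : ∀ g : L, IsIntegral R g → IsIntegral P g := fun g hg => hg.tower_top
  let S := Algebra.adjoin P (G : Set L)
  have hGi : ∀ g ∈ (G : Set L), IsIntegral R g := fun g hg => by
    have : g ∈ Subalgebra.toSubmodule (integralClosure R L) := hG ▸ Submodule.subset_span hg
    exact this
  have hSfin : Module.Finite P S := Module.Finite.iff_fg.mpr
    (fg_adjoin_of_finite G.finite_toSet fun g hg => hRR g (hGi g hg))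
  have hR₁S : ∀ y : R₁, (y : L) ∈ S := by
    rintro ⟨y, hy⟩
    have hy' : y ∈ Submodule.span R (G : Set L) := hG ▸ hy
    have := Submodule.span_le_restrictScalars R P (G : Set L) hy'
    exact Algebra.span_le_adjoin P _ this
  let _ : Algebra R₁ S := ((algebraMap R₁ L).codRestrict S hR₁S).toAlgebra
  have t6 : IsScalarTower R₁ S L := IsScalarTower.of_algebraMap_eq fun _ => rfl
  have : FaithfulSMul S L := (faithfulSMul_iff_algebraMap_injective _ _).mpr Subtype.val_injective
  have t7 : IsScalarTower R R₁ S := IsScalarTower.of_algebraMap_eq fun r => Subtype.ext rfl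
  have hadj : Algebra.adjoin R₁ {algebraMap P S x} = ⊤ := by
    have hp : ∀ Q : P, algebraMap P S Q ∈ Algebra.adjoin R₁ {algebraMap P S x} := by
      intro Q
      have hQ : Q ∈ Algebra.adjoin R {x} := hx ▸ Algebra.mem_top
      induction hQ using Algebra.adjoin_induction with
      | mem y hy =>
        rw [Set.mem_singleton_iff.mp hy]
        exact Algebra.subset_adjoin rfl
      | algebraMap r =>
        rw [← IsScalarTower.algebraMap_apply, IsScalarTower.algebraMap_apply R R₁ S]
        exact Subalgebra.algebraMap_mem _ _
      | add y z _ _ hy hz => rw [map_add]; exact Subalgebra.add_mem _ hy hz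
      | mul y z _ _ hy hz => rw [map_mul]; exact Subalgebra.mul_mem _ hy hz
    rw [eq_top_iff]
    rintro ⟨y, hy⟩ -
    induction hy using Algebra.adjoin_induction with
    | mem y hy =>
      exact Subalgebra.algebraMap_mem (Algebra.adjoin R₁ {algebraMap P S x})
        (⟨y, hGi y hy⟩ : R₁)
    | algebraMap Q => exact hp Q
    | add y z hy hz ihy ihz => exact Subalgebra.add_mem _ ihy ihz
    | mul y z hy hz ihy ihz => exact Subalgebra.mul_mem _ ihy ihz
  have hfinS : Module.Finite S (integralClosure S L) :=
    _root_.finite_integralClosure_of_adjoin_singleton hR₁ hadj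
  have : Module.Finite P (integralClosure S L) := Module.Finite.trans S _
  let N : Submodule P L := (Subalgebra.toSubmodule (integralClosure S L)).restrictScalars P
  have hN : Module.Finite P N := this
  exact finite_integralClosure_of_le N (Module.Finite.iff_fg.mp hN) fun y hy => hy.tower_top

/-- The case of `HasFiniteIntegralClosures.polynomial` of a field `k` in which `X` becomes
algebraic over a subdomain `R`. -/
lemma HasFiniteIntegralClosures.finite_integralClosure_polynomial_of_isAlgebraic {R : Type u}
    [CommRing R] [IsDomain R] (hR : HasFiniteIntegralClosures R) (k L : Type u) [Field k] [Field L]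
    [Algebra R[X] k] [Algebra R[X] L] [Algebra k L] [IsScalarTower R[X] k L]
    (hinj : ∀ r, algebraMap R[X] k (C r) = 0 → r = 0)
    (hninj : ¬ Function.Injective (algebraMap R[X] k))
    (hk : ∀ z : k, ∃ a b : R[X], algebraMap R[X] k b ≠ 0 ∧
      z * algebraMap R[X] k b = algebraMap R[X] k a)
    (hfin : FiniteDimensional k L) : Module.Finite R[X] (integralClosure R[X] L) := by
  have hRN := hR.1
  let K := FractionRing R
  let _ : Algebra R k := ((algebraMap R[X] k).comp C).toAlgebra
  let _ : Algebra R L := ((algebraMap R[X] L).comp C).toAlgebra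
  have hRk : Function.Injective (algebraMap R k) := (injective_iff_map_eq_zero _).mpr hinj
  have t0 : IsScalarTower R R[X] k := IsScalarTower.of_algebraMap_eq fun _ => rfl
  have t1 : IsScalarTower R R[X] L := IsScalarTower.of_algebraMap_eq fun _ => rfl
  have t2 : IsScalarTower R k L := IsScalarTower.of_algebraMap_eq fun r => by
    rw [IsScalarTower.algebraMap_apply R R[X] L, IsScalarTower.algebraMap_apply R R[X] k,
      ← IsScalarTower.algebraMap_apply R[X] k L]
  have : FaithfulSMul R k := (faithfulSMul_iff_algebraMap_injective _ _).mpr hRk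
  let _ : Algebra K k := FractionRing.liftAlgebra R k
  have t3 : IsScalarTower R K k := inferInstance
  let _ : Algebra K L := ((algebraMap k L).comp (algebraMap K k)).toAlgebra
  have t4 : IsScalarTower K k L := IsScalarTower.of_algebraMap_eq fun _ => rfl
  have t5 : IsScalarTower R K L := IsScalarTower.of_algebraMap_eq fun r => by
    rw [IsScalarTower.algebraMap_apply K k L, ← IsScalarTower.algebraMap_apply R K k,
      ← IsScalarTower.algebraMap_apply R k L]
  -- The field `k` is generated over `K` by the image of `X`, which is algebraic over `K`.
  have hKk : Module.Finite K k := by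
    set x := algebraMap R[X] k X with hx
    have haeval : ∀ Q : R[X], aeval x Q = algebraMap R[X] k Q := fun Q => by
      rw [hx, aeval_algebraMap_apply, aeval_X_left_apply]
    have hxint : IsIntegral K x := by
      rw [injective_iff_map_eq_zero] at hninj
      push Not at hninj
      obtain ⟨Q, hQ, hQ0⟩ := hninj
      have halg : IsAlgebraic R x := ⟨Q, hQ0, by rw [haeval, hQ]⟩
      exact (halg.extendScalars (IsFractionRing.injective R K)).isIntegral
    let W : Subalgebra K k := Algebra.adjoin K {x}
    have hWfg : (Subalgebra.toSubmodule W).FG := hxint.fg_adjoin_singleton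
    have hSW : ∀ Q : R[X], algebraMap R[X] k Q ∈ W := fun Q => by
      rw [← haeval, ← aeval_map_algebraMap K]
      exact aeval_mem_adjoin_singleton K x
    have hWi : Algebra.IsIntegral K W :=
      Algebra.IsIntegral.adjoin fun y hy => (Set.mem_singleton_iff.mp hy) ▸ hxint
    have htop : W = ⊤ := by
      refine eq_top_iff.mpr fun z _ => ?_
      obtain ⟨a, b, hb, hab⟩ := hk z
      have : z = algebraMap R[X] k a * (algebraMap R[X] k b)⁻¹ := by
        rw [← hab, mul_assoc, mul_inv_cancel₀ hb, mul_one]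
      rw [this]
      exact mul_mem (hSW a) (Algebra.IsIntegral.inv_mem (hSW b))
    rw [htop] at hWfg
    exact ⟨hWfg⟩
  have hKL : Module.Finite K L := Module.Finite.trans k L
  refine hR.finite_integralClosure_of_adjoin_singleton K L (x := X) ?_ hKL
  exact adjoin_X

/-- A polynomial ring over a Nagata ring is Nagata. -/
theorem HasFiniteIntegralClosures.polynomial {R : Type u} [CommRing R]
    (hR : HasFiniteIntegralClosures R) : HasFiniteIntegralClosures R[X] := by
  have hRN := hR.1
  refine ⟨inferInstance, fun k L _ _ _ _ _ _ hk hfin => ?_⟩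
  -- Replace `R` by its image `D` in `k`.
  let P := RingHom.ker ((algebraMap R[X] k).comp C)
  have hP : P.IsPrime := RingHom.ker_isPrime _
  let D := R ⧸ P
  have hD : HasFiniteIntegralClosures D :=
    hR.of_surjective _ (Ideal.Quotient.mk_surjective (I := P))
  let φ : R[X] →+* D[X] := mapRingHom (Ideal.Quotient.mk P)
  have hφ : Function.Surjective φ := map_surjective _ Ideal.Quotient.mk_surjective
  let ψ : D[X] →+* k := eval₂RingHom (RingHom.kerLift ((algebraMap R[X] k).comp C))
    (algebraMap R[X] k X)
  have hψφ : ψ.comp φ = algebraMap R[X] k := by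
    refine ringHom_ext (fun r => ?_) ?_
    · simp only [φ, ψ, RingHom.comp_apply, coe_mapRingHom, map_C, coe_eval₂RingHom, eval₂_C]
      rfl
    · simp [φ, ψ]
  let _ : Algebra R[X] D[X] := φ.toAlgebra
  let _ : Algebra D[X] k := ψ.toAlgebra
  let _ : Algebra D[X] L := ((algebraMap k L).comp ψ).toAlgebra
  have t1 : IsScalarTower R[X] D[X] k := IsScalarTower.of_algebraMap_eq fun Q =>
    (RingHom.congr_fun hψφ Q).symm
  have t2 : IsScalarTower D[X] k L := IsScalarTower.of_algebraMap_eq fun _ => rfl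
  have t3 : IsScalarTower R[X] D[X] L := IsScalarTower.of_algebraMap_eq fun Q => by
    rw [IsScalarTower.algebraMap_apply D[X] k L, ← IsScalarTower.algebraMap_apply R[X] D[X] k,
      ← IsScalarTower.algebraMap_apply R[X] k L]
  have hk' : ∀ z : k, ∃ a b : D[X], algebraMap D[X] k b ≠ 0 ∧
      z * algebraMap D[X] k b = algebraMap D[X] k a := fun z => by
    obtain ⟨a, b, hb, hab⟩ := hk z
    rw [IsScalarTower.algebraMap_apply R[X] D[X] k] at hb hab
    rw [IsScalarTower.algebraMap_apply R[X] D[X] k] at hab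
    exact ⟨_, _, hb, hab⟩
  have hfinD : Module.Finite D[X] (integralClosure D[X] L) := by
    by_cases hinj : Function.Injective (algebraMap D[X] k)
    · exact hD.finite_integralClosure_polynomial k L hinj hk' hfin
    · refine hD.finite_integralClosure_polynomial_of_isAlgebraic k L (fun r hr => ?_) hinj hk' hfin
      have h1 : ψ (C r) = RingHom.kerLift ((algebraMap R[X] k).comp C) r := by simp [ψ]
      exact (RingHom.kerLift_injective _) (by rw [map_zero, ← h1]; exact hr)
  have : Module.Finite R[X] D[X] := Module.Finite.of_surjective (Algebra.linearMap R[X] D[X]) hφ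
  have : Module.Finite R[X] (integralClosure D[X] L) := Module.Finite.trans D[X] _
  let N : Submodule R[X] L := (Subalgebra.toSubmodule (integralClosure D[X] L)).restrictScalars R[X]
  have hN : Module.Finite R[X] N := this
  exact finite_integralClosure_of_le N (Module.Finite.iff_fg.mp hN) fun y hy => hy.tower_top

lemma HasFiniteIntegralClosures.mvPolynomial {R : Type u} [CommRing R]
    (hR : HasFiniteIntegralClosures R) (n : ℕ) :
    HasFiniteIntegralClosures (MvPolynomial (Fin n) R) := by
  induction n with
  | zero =>
    exact hR.of_surjective (MvPolynomial.isEmptyAlgEquiv R (Fin 0)).symm.toRingHom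
      (MvPolynomial.isEmptyAlgEquiv R (Fin 0)).symm.surjective
  | succ n ih =>
    exact ih.polynomial.of_surjective (MvPolynomial.finSuccEquiv R n).symm.toRingHom
      (MvPolynomial.finSuccEquiv R n).symm.surjective

/-- A finitely generated algebra over a Nagata ring is Nagata. -/
theorem HasFiniteIntegralClosures.of_finiteType {R A : Type u} [CommRing R] [CommRing A]
    [Algebra R A] [hA : Algebra.FiniteType R A] (hR : HasFiniteIntegralClosures R) :
    HasFiniteIntegralClosures A := by
  obtain ⟨n, f, hf⟩ := Algebra.FiniteType.iff_quotient_mvPolynomial''.mp hA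
  exact (hR.mvPolynomial n).of_surjective f.toRingHom hf

end

/-! ### Finiteness of the integral closure of the Rees algebra -/

section
open Polynomial

namespace IdealFiltration

variable {R : Type*} [CommRing R] (I : IdealFiltration R)

lemma ideal_antitone : Antitone I.ideal := antitone_int_of_succ_le I.ideal_succ_le

lemma pow_mem {c : R} (hc : c ∈ I.ideal 1) {n d : ℕ} (h : n ≤ d) : c ^ d ∈ I.ideal n := by
  have key : ∀ d : ℕ, c ^ d ∈ I.ideal d := by
    intro d
    induction d with
    | zero => rw [Nat.cast_zero, I.ideal_zero]; trivial
    | succ d ih =>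
      rw [pow_succ, Nat.cast_succ]
      exact I.ideal_mul_le _ _ (Ideal.mul_mem_mul ih hc)
  exact I.ideal_antitone (Int.ofNat_le.mpr h) (key d)

lemma monomial_mem_reesAlgebra {n : ℕ} {c : R} (hc : c ∈ I.ideal n) :
    monomial n c ∈ I.reesAlgebra := by
  intro m
  rw [coeff_monomial]
  split_ifs with h
  · exact h ▸ hc
  · exact Ideal.zero_mem _

/-- A polynomial is brought into the Rees algebra by a high power of an element of `I₁`. -/
lemma C_pow_mul_mem_reesAlgebra {c : R} (hc : c ∈ I.ideal 1) {f : R[X]} {d : ℕ}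
    (hf : f.natDegree ≤ d) : C (c ^ d) * f ∈ I.reesAlgebra := by
  intro n
  rw [coeff_C_mul]
  by_cases h : n ≤ d
  · exact Ideal.mul_mem_right _ _ (I.pow_mem hc h)
  · rw [coeff_eq_zero_of_natDegree_lt (by omega), mul_zero]
    exact Ideal.zero_mem _

/-- A Noetherian Rees algebra is generated over `R` by the homogeneous components of generators of
its ideal of elements without constant term. -/
theorem finiteType_reesAlgebra (h : IsNoetherianRing I.reesAlgebra) :
    Algebra.FiniteType R I.reesAlgebra := by
  classical
  let J : Ideal I.reesAlgebra := RingHom.ker (constantCoeff.comp (algebraMap I.reesAlgebra R[X]))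
  have hJ : ∀ f : I.reesAlgebra, f ∈ J ↔ (f : R[X]).coeff 0 = 0 := fun f => by
    rw [RingHom.mem_ker]
    rfl
  obtain ⟨F, hF⟩ := IsNoetherian.noetherian J
  let G : Finset R[X] :=
    F.biUnion fun f => (f : R[X]).support.image fun n => monomial n ((f : R[X]).coeff n)
  have hG : ∀ f ∈ F, ∀ n, monomial n ((f : R[X]).coeff n) ∈ Algebra.adjoin R (G : Set R[X]) := by
    intro f hf n
    by_cases h0 : (f : R[X]).coeff n = 0
    · rw [h0, map_zero]; exact Subalgebra.zero_mem _
    · refine Algebra.subset_adjoin (Finset.mem_coe.mpr (Finset.mem_biUnion.mpr ⟨f, hf, ?_⟩))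
      exact Finset.mem_image.mpr ⟨n, mem_support_iff.mpr h0, rfl⟩
  have hmon : ∀ n : ℕ, ∀ c ∈ I.ideal n, monomial n c ∈ Algebra.adjoin R (G : Set R[X]) := by
    intro n
    induction n using Nat.strong_induction_on with
    | _ n ih =>
    intro c hc
    by_cases hn : n = 0
    · subst hn
      exact Subalgebra.algebraMap_mem _ c
    have hcJ : (⟨monomial n c, I.monomial_mem_reesAlgebra hc⟩ : I.reesAlgebra) ∈ J :=
      (hJ _).mpr (coeff_monomial_of_ne c (Ne.symm hn))
    -- In degree `n`, a product `g f` with `f ∈ J` involves the constant term of `g`, which is in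
    -- `R`, and products of two coefficients of positive degree less than `n`, as `f` has no
    -- constant term.
    have key : ∀ f ∈ Submodule.span I.reesAlgebra (F : Set I.reesAlgebra),
        monomial n ((f : R[X]).coeff n) ∈ Algebra.adjoin R (G : Set R[X]) := by
      intro f hf
      induction hf using Submodule.span_induction with
      | mem f hf => exact hG f hf n
      | zero => simp
      | add f g _ _ hf hg =>
        rw [Subalgebra.coe_add, coeff_add, map_add]
        exact Subalgebra.add_mem _ hf hg
      | smul g f hfs hf =>
        have h0 := (hJ f).mp (hF ▸ hfs)
        rw [smul_eq_mul, Subalgebra.coe_mul, coeff_mul, map_sum]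
        refine Subalgebra.sum_mem _ fun pq hpq => ?_
        have hpq' := Finset.HasAntidiagonal.mem_antidiagonal.mp hpq
        rw [← hpq', ← monomial_mul_monomial]
        rcases Nat.eq_zero_or_pos pq.1 with hp | hp
        · rw [hp, zero_add] at hpq'
          rw [hp, hpq']
          exact Subalgebra.mul_mem _ (Subalgebra.algebraMap_mem _ _) hf
        rcases Nat.eq_zero_or_pos pq.2 with hq | hq
        · rw [hq, h0, map_zero, mul_zero]
          exact Subalgebra.zero_mem _
        · exact Subalgebra.mul_mem _ (ih _ (by omega) _ (g.2 _)) (ih _ (by omega) _ (f.2 _))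
    have := key _ (hF ▸ hcJ)
    rwa [coeff_monomial_same] at this
  have hA : I.reesAlgebra = Algebra.adjoin R (G : Set R[X]) := by
    refine le_antisymm (fun f hf => ?_) (Algebra.adjoin_le fun g hg => ?_)
    · rw [f.as_sum_support]
      exact Subalgebra.sum_mem _ fun n _ => hmon n _ (hf n)
    · obtain ⟨f, -, hg⟩ := Finset.mem_biUnion.mp (Finset.mem_coe.mp hg)
      obtain ⟨n, -, rfl⟩ := Finset.mem_image.mp hg
      exact I.monomial_mem_reesAlgebra (f.2 n)
  rw [hA]
  exact (Subalgebra.fg_iff_finiteType _).mp ⟨G, rfl⟩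

end IdealFiltration

/-- If `I₁` lies in no minimal prime of the reduced ring `R`, then for each of the finitely many
minimal primes `P` the image of the Rees algebra in `(R ⧸ P)[t]` has the same fraction field as
`(R ⧸ P)[t]`; the integral closure embeds in the product of the finite integral closures in these
fields. -/
theorem IdealFiltration.finite_integralClosure_reesAlgebra {R : Type u} [CommRing R] [IsReduced R]
    (hR : HasFiniteIntegralClosures R) (I : IdealFiltration R)
    (hI : ∀ P ∈ minimalPrimes R, ¬ I.ideal 1 ≤ P) (hRees : IsNoetherianRing I.reesAlgebra) :
    Module.Finite I.reesAlgebra (integralClosure I.reesAlgebra R[X]) := by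
  have hRN := hR.1
  have := I.finiteType_reesAlgebra hRees
  have hA : HasFiniteIntegralClosures I.reesAlgebra := hR.of_finiteType
  have hfin : Finite (minimalPrimes R) := minimalPrimes.finite_of_isNoetherianRing R
  have hP : ∀ P : minimalPrimes R, P.1.IsPrime := fun P => P.2.1.1
  let L : minimalPrimes R → Type u := fun P => FractionRing (R ⧸ P.1)[X]
  let φ : ∀ P : minimalPrimes R, R[X] →+* L P := fun P =>
    (algebraMap (R ⧸ P.1)[X] (L P)).comp (mapRingHom (Ideal.Quotient.mk P.1))
  let _ : ∀ P, Algebra I.reesAlgebra (L P) := fun P =>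
    ((φ P).comp (algebraMap I.reesAlgebra R[X])).toAlgebra
  have hfinL : ∀ P, Module.Finite I.reesAlgebra (integralClosure I.reesAlgebra (L P)) := by
    intro P
    refine hA.2 (L P) (L P) (fun z => ?_) inferInstance
    obtain ⟨a, b, hb, rfl⟩ := IsFractionRing.div_surjective (A := (R ⧸ P.1)[X]) z
    obtain ⟨a, rfl⟩ := map_surjective _ Ideal.Quotient.mk_surjective a
    obtain ⟨b, rfl⟩ := map_surjective _ Ideal.Quotient.mk_surjective b
    obtain ⟨c, hc, hcP⟩ := Set.not_subset.mp (hI P P.2)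
    set d := max a.natDegree b.natDegree with hd
    have hinj := IsFractionRing.injective (R ⧸ P.1)[X] (L P)
    have hb0 : φ P b ≠ 0 := (map_ne_zero_iff _ hinj).mpr (nonZeroDivisors.ne_zero hb)
    have hc0 : φ P (C (c ^ d)) ≠ 0 := by
      refine (map_ne_zero_iff _ hinj).mpr ?_
      change ¬ map (Ideal.Quotient.mk P.1) (C (c ^ d)) = 0
      rw [map_C, C_eq_zero, Ideal.Quotient.eq_zero_iff_mem]
      exact fun h => hcP ((hP P).mem_of_pow_mem _ h)
    refine ⟨⟨_, I.C_pow_mul_mem_reesAlgebra hc (le_max_left a.natDegree b.natDegree)⟩,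
      ⟨_, I.C_pow_mul_mem_reesAlgebra hc (le_max_right a.natDegree b.natDegree)⟩, ?_, ?_⟩
    · change φ P (C (c ^ d) * b) ≠ 0
      rw [map_mul]
      exact mul_ne_zero hc0 hb0
    · change φ P a / φ P b * φ P (C (c ^ d) * b) = φ P (C (c ^ d) * a)
      rw [map_mul, map_mul, mul_comm (φ P (C _)), ← mul_assoc, div_mul_cancel₀ _ hb0, mul_comm]
  have hφint : ∀ P (f : integralClosure I.reesAlgebra R[X]),
      φ P f.1 ∈ integralClosure I.reesAlgebra (L P) := fun P f =>
    f.2.map_of_comp_eq (RingHom.id _) (φ P) rfl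
  let Φ : integralClosure I.reesAlgebra R[X] →ₗ[I.reesAlgebra]
      ∀ P, integralClosure I.reesAlgebra (L P) :=
    { toFun := fun f P => ⟨φ P f.1, hφint P f⟩
      map_add' := fun f g => funext fun P => Subtype.ext (map_add (φ P) _ _)
      map_smul' := fun a f => funext fun P => Subtype.ext (map_mul (φ P) _ _) }
  have hΦ : Function.Injective Φ := by
    refine (injective_iff_map_eq_zero _).mpr fun f hf => Subtype.ext (Polynomial.ext fun n => ?_)
    have h1 : ∀ P : minimalPrimes R, f.1.coeff n ∈ P.1 := by
      intro P
      have h2 : φ P f.1 = 0 := congrArg Subtype.val (congrFun hf P)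
      have h3 := (map_eq_zero_iff _ (IsFractionRing.injective (R ⧸ P.1)[X] (L P))).mp h2
      have h4 : (map (Ideal.Quotient.mk P.1) f.1).coeff n = 0 := by
        rw [show map (Ideal.Quotient.mk P.1) f.1 = 0 from h3, coeff_zero]
      rwa [coeff_map, Ideal.Quotient.eq_zero_iff_mem] at h4
    have h2 : f.1.coeff n ∈ sInf (minimalPrimes R) :=
      (Submodule.mem_sInf).mpr fun P hP => h1 ⟨P, hP⟩
    rw [minimalPrimes, Ideal.sInf_minimalPrimes] at h2
    have h3 : IsNilpotent (f.1.coeff n) := h2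
    exact h3.eq_zero
  exact Module.Finite.of_injective Φ hΦ

end

/-! ### Polynomial rings over rings satisfying Serre's condition `(S₂)` -/

section
open Polynomial

variable {R : Type*} [CommRing R]

/-- Divisibility by a constant after localizing at `P` may be checked on coefficients. -/
lemma Polynomial.exists_C_dvd_C_mul {P : Ideal R} [P.IsPrime] {r : R} {f : R[X]}
    (h : ∀ n, ∃ u ∉ P, r ∣ u * f.coeff n) : ∃ u ∉ P, C r ∣ C u * f := by
  choose u hu hr using h
  refine ⟨∏ n ∈ f.support, u n, fun hmem => ?_, ?_⟩
  · obtain ⟨n, -, hn⟩ := (Ideal.IsPrime.prod_mem_iff).mp hmem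
    exact hu n hn
  · rw [C_dvd_iff_dvd_coeff]
    intro n
    rw [coeff_C_mul]
    by_cases hn : f.coeff n = 0
    · rw [hn, mul_zero]; exact dvd_zero r
    · exact (hr n).trans (mul_dvd_mul_right
        (Finset.dvd_prod_of_mem u (mem_support_iff.mpr hn)) _)

/-- A polynomial annihilated by `h` is annihilated by a power of the leading coefficient of `h`. -/
lemma Polynomial.exists_C_leadingCoeff_pow_mul_eq_zero {h g : R[X]} (hg : h * g = 0) :
    ∃ N, C (h.leadingCoeff ^ N) * g = 0 := by
  induction hn : g.natDegree using Nat.strong_induction_on generalizing g with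
  | _ n ih =>
  have h1 : h.leadingCoeff * g.leadingCoeff = 0 := by
    rw [← coeff_mul_degree_add_degree, hg, coeff_zero]
  have h2 : C h.leadingCoeff * g = C h.leadingCoeff * g.eraseLead := by
    conv_lhs => rw [← g.eraseLead_add_C_mul_X_pow]
    rw [mul_add, ← mul_assoc, ← C_mul, h1, C_0, zero_mul, add_zero]
  by_cases hn0 : n = 0
  · refine ⟨1, ?_⟩
    rw [pow_one, h2]
    have hg0 : g = C (g.coeff 0) := eq_C_of_natDegree_eq_zero (hn.trans hn0)
    rw [hg0, eraseLead_C, mul_zero]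
  · have hlt : (C h.leadingCoeff * g).natDegree < n := by
      rw [h2]
      calc _ ≤ g.eraseLead.natDegree := natDegree_C_mul_le _ _
        _ ≤ g.natDegree - 1 := eraseLead_natDegree_le g
        _ < n := by omega
    obtain ⟨N, hN⟩ := ih _ hlt (g := C h.leadingCoeff * g)
      (by rw [mul_left_comm, hg, mul_zero]) rfl
    exact ⟨N + 1, by rw [pow_succ, C_mul, mul_assoc, hN]⟩

/-- A prime of the form `(a : b)` of `R[t]`, with `a` regular, does not contain a sequence
`r, h` with `r` constant that becomes regular after localizing at the contraction `P`. -/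
lemma Polynomial.false_of_colon_of_regular {P : Ideal R} [P.IsPrime] {Q : Ideal R[X]}
    (hQP : Q.comap C = P) {a b : R[X]} (ha : a ∈ nonZeroDivisors R[X])
    (hab : ∀ q, q ∈ Q ↔ q * b ∈ Ideal.span {a}) {r : R} (hr : r ∈ P)
    (hr0 : ∀ x, r * x = 0 → ∃ u ∉ P, u * x = 0) {h : R[X]} (hh : h ∈ Q)
    (hhr : ∀ x y, h * x = C r * y → ∃ u ∉ P, C r ∣ C u * x) : False := by
  have hrQ : C r ∈ Q := by rw [← hQP] at hr; exact hr
  obtain ⟨x, hx⟩ := Ideal.mem_span_singleton'.mp ((hab _).mp hrQ)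
  obtain ⟨y, hy⟩ := Ideal.mem_span_singleton'.mp ((hab _).mp hh)
  have h1 : h * x = C r * y := mul_cancel_right_mem_nonZeroDivisors ha |>.mp (by
    linear_combination h * hx - C r * hy)
  obtain ⟨u, hu, e, he⟩ := hhr x y h1
  have h2 : C r * (C u * b - a * e) = 0 := by
    linear_combination -C u * hx + a * he
  obtain ⟨v, hv, w, hw⟩ := Polynomial.exists_C_dvd_C_mul (P := P) (r := 0)
    (f := C u * b - a * e) (fun n => by
      obtain ⟨u, hu, hux⟩ := hr0 ((C u * b - a * e).coeff n) (by
        rw [← coeff_C_mul, h2, coeff_zero])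
      exact ⟨u, hu, 0, by rw [hux, zero_mul]⟩)
  rw [C_0, zero_mul] at hw
  have h3 : C (v * u) ∈ Q := (hab _).mpr (Ideal.mem_span_singleton'.mpr ⟨C v * e, by
    rw [C_mul]; linear_combination -hw⟩)
  have h4 : v * u ∈ P := by rw [← hQP]; exact h3
  exact ((‹P.IsPrime›).mem_or_mem h4).elim hv hu

attribute [local instance] Polynomial.algebra Polynomial.isLocalization in
/-- After localizing at the contraction `P`, the height of `Q` is at most `dim R_P[t] = ht P + 1`.
-/
lemma Polynomial.height_le_height_comap_C_add_one [IsNoetherianRing R] (Q : Ideal R[X])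
    [hQ : Q.IsPrime] : Q.height ≤ (Q.comap C).height + 1 := by
  let P := Q.comap (C : R →+* R[X])
  have hP : P.IsPrime := Ideal.comap_isPrime _ _
  let A := Localization.AtPrime P
  have hdisj : Disjoint ((P.primeCompl.map C : Submonoid R[X]) : Set R[X]) (Q : Set R[X]) := by
    rw [Set.disjoint_left]
    rintro _ ⟨y, hy, rfl⟩ h
    exact hy h
  have h1 := IsLocalization.height_map_of_disjoint (S := A[X]) (P.primeCompl.map C) Q hdisj
  have h2 : (Q.map (algebraMap R[X] A[X])).IsPrime :=
    IsLocalization.isPrime_of_isPrime_disjoint (P.primeCompl.map C) _ _ hQ hdisj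
  have h3 := Ideal.height_le_ringKrullDim_of_ne_top h2.ne_top
  rw [h1, ringKrullDim_of_isNoetherianRing,
    IsLocalization.AtPrime.ringKrullDim_eq_height P A] at h3
  exact_mod_cast h3

/-- Over a prime of height at least two, Serre's condition `(S₂)` provides a sequence in `P` of
length two that becomes regular after localizing. -/
lemma IsSerreRing.exists_regular_pair (hR : IsSerreRing 2 R) (P : Ideal R) [P.IsPrime]
    (hP : 2 ≤ P.height) : ∃ r ∈ P, ∃ s ∈ P, (∀ x, r * x = 0 → ∃ u ∉ P, u * x = 0) ∧
      ∀ x y, s * x = r * y → ∃ u ∉ P, r ∣ u * x := by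
  let A := Localization.AtPrime P
  have h1 := hR.min_le_depth P
  rw [IsLocalization.AtPrime.ringKrullDim_eq_height P A] at h1
  have h2 : (2 : ℕ∞) ≤ localRingDepth A :=
    WithBot.coe_le_coe.mp (le_trans (le_min le_rfl (WithBot.coe_le_coe.mpr hP)) h1)
  have h3 : (1 : ℕ∞) < localRingDepth A := lt_of_lt_of_le (by norm_num) h2
  obtain ⟨⟨rs, hrs, hreg⟩, hlen⟩ := lt_iSup_iff.mp h3
  match rs, hrs, hreg, hlen with
  | [], _, _, hlen => simp at hlen
  | [_], _, _, hlen => simp at hlen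
  | r :: s :: rs, hrs, hreg, _ =>
    obtain ⟨hr, hs⟩ :=
      (RingTheory.Sequence.isWeaklyRegular_cons_iff A r _).mp hreg.toIsWeaklyRegular
    have hs := ((RingTheory.Sequence.isWeaklyRegular_cons_iff _ s _).mp hs).1
    have hs' : ∀ x y, s * x = r * y → r ∣ x := by
      intro x y hxy
      have h4 := (isSMulRegular_quotient_iff_mem_of_smul_mem _ _).mp hs x (by
        rw [smul_eq_mul, hxy]
        exact Submodule.smul_mem_pointwise_smul y r ⊤ trivial)
      obtain ⟨z, -, hz⟩ := (Submodule.mem_smul_pointwise_iff_exists _ _ _).mp h4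
      exact ⟨z, hz.symm⟩
    have hrm := hrs r (by simp)
    have hsm := hrs s (by simp)
    obtain ⟨⟨r₀, u⟩, hu⟩ := IsLocalization.surj P.primeCompl r
    obtain ⟨⟨s₀, v⟩, hv⟩ := IsLocalization.surj P.primeCompl s
    have hmem : ∀ z₀, algebraMap R A z₀ ∈ IsLocalRing.maximalIdeal A → z₀ ∈ P := fun z₀ =>
      (IsLocalization.AtPrime.to_map_mem_maximal_iff A P z₀).mp
    obtain ⟨u', hu'⟩ := (IsLocalization.map_units A u).exists_right_inv
    obtain ⟨v', hv'⟩ := (IsLocalization.map_units A v).exists_right_inv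
    refine ⟨r₀, hmem _ (hu ▸ Ideal.mul_mem_right _ _ hrm), s₀,
      hmem _ (hv ▸ Ideal.mul_mem_right _ _ hsm), fun x hx => ?_, fun x y hxy => ?_⟩
    · have h5 : r * algebraMap R A x = 0 := by
        have := congrArg (algebraMap R A) hx
        rw [map_mul, ← hu, map_zero] at this
        linear_combination u' * this - r * algebraMap R A x * hu'
      have h6 : algebraMap R A x = 0 := isSMulRegular_iff_right_eq_zero_of_smul.mp hr _ h5
      obtain ⟨w, hw⟩ := (IsLocalization.map_eq_zero_iff P.primeCompl A x).mp h6
      exact ⟨w, w.2, hw⟩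
    · have h5 := congrArg (algebraMap R A) hxy
      rw [map_mul, map_mul, ← hu, ← hv] at h5
      obtain ⟨e, he⟩ := hs' (algebraMap R A x) (v' * algebraMap R A u * algebraMap R A y) (by
        linear_combination v' * h5 - s * algebraMap R A x * hv')
      obtain ⟨⟨e₀, w⟩, hw⟩ := IsLocalization.surj P.primeCompl (e * u')
      have h6 : algebraMap R A (w * x) = algebraMap R A (r₀ * e₀) := by
        rw [map_mul, map_mul, ← hu, ← hw, he]
        linear_combination (-r * e * algebraMap R A w) * hu'
      obtain ⟨w', hw'⟩ := (IsLocalization.eq_iff_exists P.primeCompl A).mp h6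
      exact ⟨w' * w, (w' * w).2, ⟨w' * e₀, by linear_combination hw'⟩⟩

/-- In a reduced ring an ideal outside all minimal primes contains a regular element. -/
lemma exists_mem_nonZeroDivisors_of_forall_minimalPrimes [IsNoetherianRing R] [IsReduced R]
    {J : Ideal R} (hJ : ∀ P ∈ minimalPrimes R, ¬ J ≤ P) : ∃ r ∈ J, r ∈ nonZeroDivisors R := by
  have hfin : (minimalPrimes R).Finite := minimalPrimes.finite_of_isNoetherianRing R
  have hnot : ¬ ((J : Set R) ⊆ ⋃ P ∈ hfin.toFinset, (P : Set R)) := by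
    intro hsub
    obtain ⟨P, hP, hle⟩ := (Ideal.subset_union_prime (f := fun P => P) ⊥ ⊥ fun P hP _ _ =>
      (hfin.mem_toFinset.mp hP).1.1).mp hsub
    exact hJ P (hfin.mem_toFinset.mp hP) hle
  obtain ⟨r, hr, hrP⟩ := Set.not_subset.mp hnot
  refine ⟨r, hr, (mem_nonZeroDivisors_iff_right).mpr fun x hx => ?_⟩
  have h1 : x ∈ sInf (minimalPrimes R) := Submodule.mem_sInf.mpr fun P hP => by
    have h2 : x * r ∈ P := hx ▸ P.zero_mem
    refine (hP.1.1.mem_or_mem h2).resolve_right fun h => hrP ?_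
    exact Set.mem_biUnion (hfin.mem_toFinset.mpr hP) h
  rw [minimalPrimes, Ideal.sInf_minimalPrimes] at h1
  exact IsNilpotent.eq_zero h1

/-- Leading terms with coefficients in `P` may be removed without leaving `Q`. -/
lemma Polynomial.exists_mem_leadingCoeff_notMem {P : Ideal R} {Q : Ideal R[X]}
    (hPQ : P.map C ≤ Q) {h : R[X]} (hh : h ∈ Q) (hhP : h ∉ P.map C) :
    ∃ g ∈ Q, g.leadingCoeff ∉ P := by
  induction hn : h.natDegree using Nat.strong_induction_on generalizing h with
  | _ n ih =>
  by_cases hl : h.leadingCoeff ∈ P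
  · have h1 : C h.leadingCoeff * X ^ h.natDegree ∈ P.map C :=
      Ideal.mul_mem_right _ _ (Ideal.mem_map_of_mem C hl)
    have h2 : h.eraseLead = h - C h.leadingCoeff * X ^ h.natDegree :=
      eq_sub_of_add_eq h.eraseLead_add_C_mul_X_pow
    have h3 : h.eraseLead ∉ P.map C := fun h3 => hhP (by
      rw [← h.eraseLead_add_C_mul_X_pow]
      exact Ideal.add_mem _ h3 h1)
    have hn0 : n ≠ 0 := fun h0 => h3 (by
      rw [eq_C_of_natDegree_eq_zero (hn.trans h0), eraseLead_C]
      exact Ideal.zero_mem _)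
    refine ih _ ?_ (h := h.eraseLead) (h2 ▸ Q.sub_mem hh (hPQ h1)) h3 rfl
    have := eraseLead_natDegree_le h
    omega
  · exact ⟨h, hh, hl⟩

/-- In the polynomial ring over a reduced ring satisfying `(S₂)`, principal ideals generated by
regular elements have associated primes of height at most one, lying over primes of height at most
one. -/
theorem IsSerreRing.height_le_one_of_mem_associatedPrimes_polynomial [IsReduced R]
    (hR : IsSerreRing 2 R) {a : R[X]} (ha : a ∈ nonZeroDivisors R[X]) {Q : Ideal R[X]}
    (hQ : Q ∈ associatedPrimes R[X] (R[X] ⧸ Ideal.span {a})) :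
    (Q.comap C).height ≤ 1 ∧ Q.height ≤ 1 := by
  have hRN := hR.isNoetherianRing
  obtain ⟨hQp, b, hb⟩ := mem_associatedPrimes_quotient_iff.mp hQ
  set P := Q.comap (C : R →+* R[X]) with hPdef
  have hP : P.IsPrime := Ideal.comap_isPrime _ _
  have hP1 : P.height ≤ 1 := by
    by_contra hcon
    have h2 : 2 ≤ P.height := by
      have := Order.add_one_le_of_lt (not_le.mp hcon)
      exact le_trans (by norm_num) this
    obtain ⟨r, hr, s, hs, hr0, hrs⟩ := hR.exists_regular_pair P h2
    refine false_of_colon_of_regular (P := P) rfl ha hb hr hr0 (h := C s) hs fun x y hxy => ?_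
    refine exists_C_dvd_C_mul fun n => hrs _ (y.coeff n) ?_
    rw [← coeff_C_mul, hxy, coeff_C_mul]
  refine ⟨hP1, ?_⟩
  by_cases hmin : P ∈ minimalPrimes R
  · have := height_le_height_comap_C_add_one Q
    rwa [← hPdef, Ideal.height_eq_zero_iff.mpr hmin, zero_add] at this
  -- Otherwise `P` contains a regular element, and `Q` is extended from `P`.
  have hreg : ∃ r ∈ P, r ∈ nonZeroDivisors R :=
    exists_mem_nonZeroDivisors_of_forall_minimalPrimes fun P' hP' hle => by
      have := hP'.1.1
      exact hmin ((hP'.2 ⟨hP, bot_le⟩ hle).antisymm hle ▸ hP')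
  obtain ⟨r, hrP, hr⟩ := hreg
  have hQP : Q = P.map C := by
    refine le_antisymm (fun h hh => ?_) Ideal.map_comap_le
    by_contra hcon
    obtain ⟨g, hg, hgP⟩ := exists_mem_leadingCoeff_notMem (P := P) Ideal.map_comap_le hh hcon
    -- The leading coefficient of `g` is a unit locally at `P`, so that `r, g` is a regular sequence
    -- there.
    refine false_of_colon_of_regular (P := P) rfl ha hb hrP
      (fun x hx => ⟨1, P.one_notMem, ?_⟩) hg fun x y hxy => ?_
    · rw [one_mul]
      exact (mem_nonZeroDivisors_iff.mp hr).1 x hx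
    · let φ := mapRingHom (Ideal.Quotient.mk (Ideal.span {r}))
      have hlc : (φ g).leadingCoeff = Ideal.Quotient.mk _ g.leadingCoeff := by
        refine leadingCoeff_map_of_leadingCoeff_ne_zero _ fun h0 => hgP ?_
        exact (Ideal.span_singleton_le_iff_mem P).mpr hrP (Ideal.Quotient.eq_zero_iff_mem.mp h0)
      obtain ⟨N, hN⟩ := exists_C_leadingCoeff_pow_mul_eq_zero (h := φ g) (g := φ x) (by
        rw [← map_mul, hxy, map_mul]
        have : φ (C r) = 0 := by
          change map _ (C r) = 0
          rw [map_C, Ideal.Quotient.eq_zero_iff_mem.mpr (Ideal.mem_span_singleton_self r), C_0]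
        rw [this, zero_mul])
      refine ⟨g.leadingCoeff ^ N, fun h => hgP (hP.mem_of_pow_mem N h), ?_⟩
      rw [C_dvd_iff_dvd_coeff]
      intro n
      rw [← Ideal.mem_span_singleton, ← Ideal.Quotient.eq_zero_iff_mem, coeff_C_mul, map_mul,
        map_pow, ← hlc]
      have := congrArg (fun p => p.coeff n) hN
      change (C _ * map _ x).coeff n = _ at this
      rwa [coeff_C_mul, coeff_map, coeff_zero] at this
  have hmin : Q ∈ (Ideal.span {C r}).minimalPrimes := by
    refine ⟨⟨hQp, (Ideal.span_singleton_le_iff_mem _).mpr hrP⟩, fun Q' ⟨hQ', hrQ'⟩ hle => ?_⟩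
    rw [hQP, Ideal.map_le_iff_le_comap]
    have hle' : Q'.comap C ≤ P := Ideal.comap_mono hle
    rcases hle'.lt_or_eq with hlt | heq
    · exfalso
      have hQ'P : (Q'.comap C).IsPrime := Ideal.comap_isPrime _ _
      have h1 := Ideal.height_strict_mono_of_isPrime hlt
      have h2 : (Q'.comap C).height = 0 := Order.lt_one_iff.mp (h1.trans_le hP1)
      exact notMem_nonZeroDivisors_of_mem_mem_minimalPrimes (x := r)
        (hrQ' (Ideal.mem_span_singleton_self _)) (Ideal.height_eq_zero_iff.mp h2) hr
    · exact heq.ge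
  exact Ideal.height_le_one_of_isPrincipal_of_mem_minimalPrimes _ _ hmin

end

/-! ### Serre's condition `(S₂)` for the integral closure -/

section

lemma RingTheory.Sequence.IsWeaklyRegular.length_le_localRingDepth {B : Type*} [CommRing B]
    {rs : List B} (h : IsWeaklyRegular B rs) (P : Ideal B) [P.IsPrime] (hP : ∀ r ∈ rs, r ∈ P) :
    (rs.length : ℕ∞) ≤ localRingDepth (Localization.AtPrime P) := by
  refine le_trans ?_ (le_iSup (fun rs : {rs : List (Localization.AtPrime P) //
    (∀ r ∈ rs, r ∈ IsLocalRing.maximalIdeal _) ∧ IsRegular _ rs} => (rs.1.length : ℕ∞))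
    ⟨rs.map (algebraMap B _), fun r hr => ?_,
      h.isRegular_of_isLocalization_of_mem (Localization.AtPrime P) P hP⟩)
  · rw [List.length_map]
  · obtain ⟨s, hs, rfl⟩ := List.mem_map.mp hr
    exact (IsLocalization.AtPrime.to_map_mem_maximal_iff _ P s).mpr (hP s hs)

/-- A reduced Noetherian ring satisfies `(S₂)` if the associated primes of its principal ideals
generated by regular elements have height at most one. -/
theorem IsSerreRing.of_height_le_one {B : Type*} [CommRing B] [hB : IsNoetherianRing B]
    [IsReduced B] (h : ∀ a ∈ nonZeroDivisors B,
      ∀ Q ∈ associatedPrimes B (B ⧸ Ideal.span {a}), Q.height ≤ 1) : IsSerreRing 2 B := by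
  refine ⟨hB, fun P hP => ?_⟩
  rw [IsLocalization.AtPrime.ringKrullDim_eq_height P (Localization.AtPrime P)]
  by_cases hmin : P ∈ minimalPrimes B
  · rw [Ideal.height_eq_zero_iff.mpr hmin]
    exact (min_le_right _ _).trans (WithBot.coe_le_coe.mpr (zero_le))
  obtain ⟨r, hrP, hr⟩ := exists_mem_nonZeroDivisors_of_forall_minimalPrimes (J := P)
    fun P' hP' hle => hmin ((hP'.2 ⟨hP, bot_le⟩ hle).antisymm hle ▸ hP')
  have hrreg : IsSMulRegular B r := isSMulRegular_iff_right_eq_zero_of_smul.mpr fun x hx =>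
    (mem_nonZeroDivisors_iff.mp hr).1 x hx
  by_cases h2 : P.height ≤ 1
  · refine (min_le_right _ _).trans (WithBot.coe_le_coe.mpr (h2.trans ?_))
    have := ((RingTheory.Sequence.isWeaklyRegular_singleton_iff B r).mpr
      hrreg).length_le_localRingDepth P (by simpa using hrP)
    simpa using this
  obtain ⟨s, hsP, hs⟩ := exists_mem_regular_of_not_le (J := Ideal.span {r}) (I := P)
    fun p hp hle => h2 ((Ideal.height_mono hle).trans (h r hr p hp))
  refine (min_le_left _ _).trans (WithBot.coe_le_coe.mpr (?_ : (2 : ℕ∞) ≤ _))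
  have hreg : RingTheory.Sequence.IsWeaklyRegular B [r, s] := by
    refine (RingTheory.Sequence.isWeaklyRegular_cons_iff B r _).mpr ⟨hrreg,
      (RingTheory.Sequence.isWeaklyRegular_singleton_iff _ s).mpr ?_⟩
    refine (isSMulRegular_quotient_iff_mem_of_smul_mem _ _).mpr fun x hx => ?_
    obtain ⟨y, -, hy⟩ := (Submodule.mem_smul_pointwise_iff_exists _ _ _).mp hx
    obtain ⟨z, hz⟩ := Ideal.mem_span_singleton.mp
      (hs x (Ideal.mem_span_singleton.mpr ⟨y, hy.symm⟩))
    exact (Submodule.mem_smul_pointwise_iff_exists _ _ _).mpr ⟨z, trivial, hz.symm⟩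
  simpa using hreg.length_le_localRingDepth P (by simp [hrP, hsP])

variable {B E : Type*} [CommRing B] [CommRing E] [Algebra B E]

/-- Where `B` and `E` become equal after inverting an element of `B`, they have primes of the same
height. -/
lemma Ideal.height_comap_of_forall_exists_pow_mul (hinj : Function.Injective (algebraMap B E))
    {c : B} (hc : ∀ f : E, ∃ d b, algebraMap B E b = algebraMap B E c ^ d * f) (Q : Ideal E)
    [hQ : Q.IsPrime] (hcQ : algebraMap B E c ∉ Q) :
    (Q.comap (algebraMap B E)).height = Q.height := by
  let T := Localization.Away (algebraMap B E c)
  have hunit : IsUnit (algebraMap B T c) :=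
    IsLocalization.Away.algebraMap_isUnit (S := T) (algebraMap B E c)
  have hloc : IsLocalization.Away c T := by
    refine ⟨?_, fun z => ?_, fun {x y} hxy => ?_⟩
    · rintro ⟨_, n, rfl⟩
      change IsUnit (algebraMap B T (c ^ n))
      rw [map_pow]
      exact hunit.pow n
    · obtain ⟨⟨f, ⟨_, n, rfl⟩⟩, hf⟩ :=
        IsLocalization.surj (Submonoid.powers (algebraMap B E c)) z
      obtain ⟨d, b, hb⟩ := hc f
      refine ⟨⟨b, ⟨c ^ (d + n), d + n, rfl⟩⟩, ?_⟩
      change z * algebraMap E T (algebraMap B E c ^ n) = algebraMap E T f at hf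
      change z * algebraMap B T (c ^ (d + n)) = algebraMap B T b
      rw [IsScalarTower.algebraMap_apply B E T b, hb, map_mul, ← hf, map_pow, pow_add, map_pow,
        map_pow, IsScalarTower.algebraMap_apply B E T c]
      ring
    · rw [IsScalarTower.algebraMap_apply B E T, IsScalarTower.algebraMap_apply B E T y] at hxy
      obtain ⟨⟨_, n, rfl⟩, hn⟩ :=
        (IsLocalization.eq_iff_exists (Submonoid.powers (algebraMap B E c)) T).mp hxy
      refine ⟨⟨c ^ n, n, rfl⟩, hinj ?_⟩
      simpa using hn
  have hdisj : Disjoint ((Submonoid.powers (algebraMap B E c)) : Set E) (Q : Set E) := by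
    rw [Set.disjoint_left]
    rintro _ ⟨n, rfl⟩ h
    exact hcQ (hQ.mem_of_pow_mem n h)
  have h1 := IsLocalization.height_map_of_disjoint (S := T) _ Q hdisj
  have h2 : (Q.map (algebraMap E T)).comap (algebraMap E T) = Q :=
    IsLocalization.under_map_of_isPrime_disjoint _ T hQ hdisj
  rw [← h1, ← IsLocalization.height_under (Submonoid.powers c) (Q.map (algebraMap E T))]
  change _ = ((Q.map (algebraMap E T)).comap (algebraMap B T)).height
  rw [IsScalarTower.algebraMap_eq B E T, ← Ideal.comap_comap, h2]

/-- Let `B` be integrally closed in `E`, and `a` a regular element of `B` such that the associated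
primes of `aE` have height at most one and lie over the locus where `B` and `E` agree. Then an
associated prime `(aB : b)` of `aB` has height at most one: it is contracted from `E` if `b / a` is
not in `E`, and locally principal, as it is not stable under multiplication by `b / a`, if it is. -/
theorem Ideal.height_le_one_of_mem_associatedPrimes_of_isIntegrallyClosedIn [IsNoetherianRing B]
    [IsNoetherianRing E] (hinj : Function.Injective (algebraMap B E))
    (hint : ∀ f : E, IsIntegral B f → ∃ b, algebraMap B E b = f) {a : B}
    (ha : algebraMap B E a ∈ nonZeroDivisors E)
    (h : ∀ Q ∈ associatedPrimes E (E ⧸ Ideal.span {algebraMap B E a}), Q.height ≤ 1 ∧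
      ∃ c, algebraMap B E c ∉ Q ∧ ∀ f : E, ∃ d b, algebraMap B E b = algebraMap B E c ^ d * f)
    {Q : Ideal B} (hQ : Q ∈ associatedPrimes B (B ⧸ Ideal.span {a})) : Q.height ≤ 1 := by
  have haQ : a ∈ Q := associatedPrimes_quotient_le hQ (Ideal.mem_span_singleton_self a)
  obtain ⟨hQp, b, hb⟩ := mem_associatedPrimes_quotient_iff.mp hQ
  by_cases hba : algebraMap B E b ∈ Ideal.span {algebraMap B E a}
  · obtain ⟨f, hf⟩ := Ideal.mem_span_singleton'.mp hba
    have hQf : ∀ q ∈ Q, ∃ z, algebraMap B E z = algebraMap B E q * f := by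
      intro q hq
      obtain ⟨z, hz⟩ := Ideal.mem_span_singleton'.mp ((hb q).mp hq)
      refine ⟨z, (mul_cancel_right_mem_nonZeroDivisors ha).mp ?_⟩
      rw [← map_mul, hz, map_mul, ← hf, mul_assoc]
    have hex : ∃ π ∈ Q, ∃ s ∉ Q, algebraMap B E s = algebraMap B E π * f := by
      by_contra! hcon
      have hpow : ∀ i : ℕ, ∃ z ∈ Q, algebraMap B E a * f ^ i = algebraMap B E z := by
        intro i
        induction i with
        | zero => exact ⟨a, haQ, by rw [pow_zero, mul_one]⟩
        | succ i ih =>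
          obtain ⟨z, hz, hzi⟩ := ih
          obtain ⟨w, hw⟩ := hQf z hz
          by_cases hwQ : w ∈ Q
          · exact ⟨w, hwQ, by rw [hw, ← hzi, pow_succ, mul_assoc]⟩
          · exact absurd hw (hcon z hz w hwQ)
      obtain ⟨z, hz⟩ := hint f (isIntegral_of_forall_mul_pow_mem ha fun i =>
        (hpow i).imp fun z hz => hz.2)
      refine hQp.ne_top ((Ideal.eq_top_iff_one _).mpr ((hb 1).mpr ?_))
      rw [one_mul]
      exact Ideal.mem_span_singleton'.mpr ⟨z, hinj (by rw [map_mul, hz, hf])⟩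
    obtain ⟨π, hπ, s, hs, hsπ⟩ := hex
    have hmin : Q ∈ (Ideal.span {π}).minimalPrimes := by
      refine ⟨⟨hQp, (Ideal.span_singleton_le_iff_mem _).mpr hπ⟩, fun Q' ⟨hQ', hπQ'⟩ hle q hq => ?_⟩
      obtain ⟨z, hz⟩ := hQf q hq
      have h1 : q * s = π * z := hinj (by rw [map_mul, map_mul, hsπ, hz]; ring)
      have h2 : q * s ∈ Q' :=
        h1 ▸ Q'.mul_mem_right z (hπQ' (Ideal.mem_span_singleton_self π))
      exact (hQ'.mem_or_mem h2).resolve_right fun h => hs (hle h)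
    exact Ideal.height_le_one_of_isPrincipal_of_mem_minimalPrimes _ _ hmin
  · obtain ⟨Q', hQ', hle⟩ := exists_le_isAssociatedPrime_of_isNoetherianRing E
      (Ideal.Quotient.mk (Ideal.span {algebraMap B E a}) (algebraMap B E b))
      fun h0 => hba (Ideal.Quotient.eq_zero_iff_mem.mp h0)
    obtain ⟨hht, c, hcQ, hc⟩ := h Q' hQ'
    have hQ'p : Q'.IsPrime := hQ'.1
    rw [← Ideal.height_comap_of_forall_exists_pow_mul hinj hc Q' hcQ] at hht
    refine (Ideal.height_mono fun q hq => ?_).trans hht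
    refine hle ?_
    rw [Submodule.mem_colon_singleton, Submodule.mem_bot, Algebra.smul_def,
      Ideal.Quotient.algebraMap_eq, ← map_mul, ← map_mul, Ideal.Quotient.eq_zero_iff_mem]
    obtain ⟨z, hz⟩ := Ideal.mem_span_singleton'.mp ((hb q).mp hq)
    exact Ideal.mem_span_singleton'.mpr ⟨algebraMap B E z, by rw [← map_mul, hz]⟩

open Polynomial in
/-- A Noetherian subring of `R[t]` that is integrally closed in `R[t]` satisfies `(S₂)` if `R` does
and the two rings agree away from the zero locus of an ideal of `R` of height at least two. -/
theorem IsSerreRing.of_isIntegrallyClosedIn_polynomial {R : Type*} [CommRing R] [IsReduced R]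
    (hS2 : IsSerreRing 2 R) {J : Ideal R} (hJ : 2 ≤ J.height) {B : Type*} [CommRing B]
    [IsNoetherianRing B] [Algebra B R[X]] (hinj : Function.Injective (algebraMap B R[X]))
    (hint : ∀ f : R[X], IsIntegral B f → ∃ b, algebraMap B R[X] b = f)
    (hden : ∀ c ∈ J, ∃ c' : B, algebraMap B R[X] c' = C c ∧
      ∀ f : R[X], ∃ d b, algebraMap B R[X] b = algebraMap B R[X] c' ^ d * f) :
    IsSerreRing 2 B := by
  have hRN := hS2.isNoetherianRing
  have hnot : ∀ P : Ideal R, P.height ≤ 1 → ¬ J ≤ P := fun P hP hle =>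
    absurd (hJ.trans ((Ideal.height_mono hle).trans hP)) (by norm_num)
  have hmin : ∀ P ∈ minimalPrimes R, ¬ J ≤ P := fun P hP => by
    have := hP.1.1
    exact hnot P ((Ideal.height_eq_zero_iff.mpr hP).le.trans zero_le_one)
  have hred : IsReduced R[X] := ⟨fun f hf => ext fun n =>
    (Polynomial.isNilpotent_iff.mp hf n).eq_zero⟩
  have hBred : IsReduced B := isReduced_of_injective _ hinj
  refine IsSerreRing.of_height_le_one fun a ha Q hQ => ?_
  have haE : algebraMap B R[X] a ∈ nonZeroDivisors R[X] := by
    obtain ⟨c, hc, hcreg⟩ := exists_mem_nonZeroDivisors_of_forall_minimalPrimes hmin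
    obtain ⟨c', hc', hcd⟩ := hden c hc
    refine mem_nonZeroDivisors_iff_right.mpr fun f hf => ?_
    obtain ⟨d, b, hb⟩ := hcd f
    have h1 : b * a = 0 := hinj (by rw [map_mul, hb, mul_assoc, hf, mul_zero, map_zero])
    have h2 : b = 0 := (mem_nonZeroDivisors_iff_right.mp ha) b h1
    rw [h2, map_zero, hc', ← C_pow] at hb
    ext n
    have h3 := congrArg (fun p => p.coeff n) hb.symm
    rw [coeff_C_mul, coeff_zero] at h3
    exact (mem_nonZeroDivisors_iff.mp (pow_mem hcreg d)).1 _ h3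
  refine Ideal.height_le_one_of_mem_associatedPrimes_of_isIntegrallyClosedIn hinj
    hint (a := a) haE (fun Q' hQ' => ?_) hQ
  obtain ⟨h1, h2⟩ := hS2.height_le_one_of_mem_associatedPrimes_polynomial haE hQ'
  obtain ⟨c, hc, hcQ⟩ := Set.not_subset.mp (hnot _ h1)
  obtain ⟨c', hc', hcd⟩ := hden c hc
  exact ⟨h2, c', fun h => hcQ (show C c ∈ Q' from hc' ▸ h), hcd⟩

end

theorem mainTheorem4 {R : Type u} [CommRing R] [IsNoetherianRing R] [IsLocalRing R] [IsReduced R]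
    (hNagata : IsNagataRing R) (hS2 : IsSerreRing 2 R)
    (I : IdealFiltration R) (hI : I.ideal 1 ≠ ⊤) (hheight : 2 ≤ (I.ideal 1).height)
    (hRees : IsNoetherianRing I.reesAlgebra) :
    IsSerreRing 2 (integralClosure I.reesAlgebra (Polynomial R)) := by
  have hmin : ∀ P ∈ minimalPrimes R, ¬ I.ideal 1 ≤ P := fun P hP hle => by
    have := hP.1.1
    have h := hheight.trans (Ideal.height_mono hle)
    rw [Ideal.height_eq_zero_iff.mpr hP] at h
    exact absurd h (by norm_num)
  set B := integralClosure I.reesAlgebra (Polynomial R)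
  have hfin : Module.Finite I.reesAlgebra B :=
    I.finite_integralClosure_reesAlgebra hNagata.hasFiniteIntegralClosures hmin hRees
  have hB : IsNoetherianRing B := IsNoetherianRing.of_finite I.reesAlgebra B
  have hinj : Function.Injective (algebraMap B (Polynomial R)) := Subtype.val_injective
  refine hS2.of_isIntegrallyClosedIn_polynomial hheight hinj
    (fun f hf => ⟨⟨f, isIntegral_trans f hf⟩, rfl⟩) fun c hc => ?_
  have hmem := fun f : Polynomial R => I.C_pow_mul_mem_reesAlgebra hc (le_refl f.natDegree)
  refine ⟨algebraMap I.reesAlgebra B (algebraMap R I.reesAlgebra c), rfl, fun f =>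
    ⟨f.natDegree, algebraMap I.reesAlgebra B ⟨_, hmem f⟩, ?_⟩⟩
  change Polynomial.C (c ^ f.natDegree) * f = Polynomial.C c ^ f.natDegree * f
  rw [Polynomial.C_pow]
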